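/- Let $\mathcal G$ be a metric graph with finitely many vertices $\mathcal V$, finitely many internal edges $i$ of finite length $\mathcal R_i>0$ and external edges $e\in\mathcal E$ of infinite length, and without loops. Let $d$ be the shortest-path distance (with $d=+\infty$ between different components), and let $\mathcal L(v)$ be the set of edges incident with the vertex $v$. A *Brownian motion* on $\mathcal G$ is a right continuous strong Markov process $X$ on $\mathcal G$, with an isolated cemetery point $\Delta$ at distance $+\infty$ from $\mathcal G$, which, started inside an edge $l$ and stopped when it leaves this open edge, is equivalent to a one-dimensional Brownian motion on $(0,\mathcal R_l)$ stopped when it leaves this interval. For $v\in\mathcal V$ and $\varepsilon>0$ put $\tau_\varepsilon=\inf\{t\ge 0: d(X_t,X_0)>\varepsilon\}$, $X_\infty=\Delta$, and, for Borel sets $A\subseteq\mathcal G\setminus\{v\}$, $$\nu^v_\varepsilon(A)=\frac{\mathbb P_v(X_{\tau_\varepsilon}\in A)}{\mathbb E_v(\tau_\varepsilon)},\quad K^v_\varepsilon=1+\frac{\mathbb P_v(X_{\tau_\varepsilon}=\Delta)}{\mathbb E_v(\tau_\varepsilon)}+\int_{\mathcal G\setminus\{v\}}\big(1-e^{-d(v,g)}\big)\,\nu^v_\varepsilon(dg),\quad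 \mu^v_\varepsilon(A)=\frac1{K^v_\varepsilon}\int_A\big(1-e^{-d(v,g)}\big)\,\nu^v_\varepsilon(dg)$$ (quotients by $\mathbb E_v(\tau_\varepsilon)=+\infty$ are $0$). Let $\overline{\mathcal G\setminus\{v\}}$ be the compactification of $\mathcal G\setminus\{v\}$ which adds one end at $v$ for every edge $l\in\mathcal L(v)$ (that is, $(l,0+)$ or $(l,\mathcal R_l-)$) and one end $(e,+\infty)$ for every external edge $e\in\mathcal E$. Let sequences of positive numbers $\varepsilon^v_n\to 0$, $v\in\mathcal V$, be given. The process $X$ has, along these sequences, the *Feller–Wentzell data* $$\big(c^{v,\Delta}_1,c^{v,\infty}_1,(c^{v,l}_2)_{l\in\mathcal L(v)},c^v_3,c^v_4\big)_{v\in\mathcal V}$$ if for every $v$ the measures $\mu^v_{\varepsilon^v_n}$, extended by $0$, converge weakly on $\overline{\mathcal G\setminus\{v\}}$ to a finite measure $\overline\mu^v$, and $$c^{v,\Delta}_1=\lim_n\frac{\mathbb P_v(X_{\tau_{\varepsilon^v_n}}=\Delta)}{\mathbb E_v(\tau_{\varepsilon^v_n})K^v_{\varepsilon^v_n}},\qquad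 c^{v,\infty}_1=\sum_{e\in\mathcal E}\overline\mu^v(\{(e,+\infty)\}),\qquad c^v_3=\lim_n\frac1{K^v_{\varepsilon^v_n}},$$ $c^{v,l}_2$ is the $\overline\mu^v$-mass of the end of $l$ at $v$, and $c^v_4(A)=\int_A(1-e^{-d(v,g)})^{-1}\,\overline\mu^v(dg)$ for Borel sets $A\subseteq\mathcal G\setminus\{v\}$. **Statement.** Let $X$ be a Brownian motion on $\mathcal G$ with the Feller–Wentzell data $\big(c^{v,\Delta}_1,c^{v,\infty}_1,(c^{v,l}_2)_{l\in\mathcal L(v)},c^v_3,c^v_4\big)_{v\in\mathcal V}$ along sequences $(\varepsilon^v_n)_n$. Let $F\subsetneq\mathcal G$ be isolated (open and closed in $\mathcal G$) and absorbing for $X$ (for all $g\in F$, $\mathbb P_g$-a.s., $X_t\in F$ for all $t\ge0$). Then $\mathcal G\setminus F$ is the metric graph formed by the vertices outside $F$ and the edges whose end points are outside $F$. Let $\psi$ be the identity on $\mathcal G\setminus F$, and $\psi=\Delta$ on $F\cup\{\Delta\}$, and let $Y=\psi(X)$ be the process on $\mathcal G\setminus F$ resulting from killing $X$ on $F$. If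 $Y$ is a Brownian motion on $\mathcal G\setminus F$, then $Y$ has, along the same sequences, the Feller–Wentzell data $$\big(c^{v,\Delta}_1+c^v_4(F),\;c^{v,\infty}_1,\;(c^{v,l}_2)_{l\in\mathcal L(v)},\;c^v_3,\;c^v_4(\,\cdot\,\cap F^{\complement})\big)_{v\in\mathcal V\setminus F}.$$ -/

import Mathlib

open Set Filter Topology MeasureTheory ProbabilityTheory
open scoped NNReal ENNReal BoundedContinuousFunction

noncomputable section

/-- The combinatorial data and edge lengths of a metric graph without loops: `V` is the set of
vertices, `E` the set of external edges (half-lines attached to the vertex `base e`), `I` the set of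
internal edges (of length `len i`, running from `init i` to `term i`). -/
structure MetricGraph (V E I : Type*) where
  base : E → V
  init : I → V
  term : I → V
  len : I → ℝ
  len_pos : ∀ i, 0 < len i
  no_loop : ∀ i, init i ≠ term i

namespace MetricGraph

variable {V E I : Type*}

/-- The points of a metric graph: the vertices and the points in the interior of the edges. -/
inductive Point (G : MetricGraph V E I) where
  | vertex (v : V) : Point G
  | ext (e : E) (x : ℝ) (pos : 0 < x) : Point G
  | int (i : I) (x : ℝ) (pos : 0 < x) (lt : x < G.len i) : Point G

/-- All edges, external and internal. -/
abbrev Edge (_G : MetricGraph V E I) := E ⊕ I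

/-- `l ∈ L(v)`: the edge `l` is incident with the vertex `v`. -/
def Incident (G : MetricGraph V E I) (v : V) : G.Edge → Prop
  | .inl e => G.base e = v
  | .inr i => G.init i = v ∨ G.term i = v

/-- The parameter interval `[0, R_l]` of the closed edge `l` (with `R_l = ∞` excluded). -/
def dom (G : MetricGraph V E I) : G.Edge → Set ℝ
  | .inl _ => Ici 0
  | .inr i => Icc 0 (G.len i)

/-- The parameter interval `(0, R_l)` of the open edge `l`. -/
def openDom (G : MetricGraph V E I) : G.Edge → Set ℝ
  | .inl _ => Ioi 0
  | .inr i => Ioo 0 (G.len i)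

open Classical in
/-- The parametrisation of the closed edge `l` by `G.dom l`; the end points of the interval are
mapped to the end vertices of the edge (as are the parameters beyond them). -/
def param (G : MetricGraph V E I) : G.Edge → ℝ → G.Point
  | .inl e, x => if h : 0 < x then .ext e x h else .vertex (G.base e)
  | .inr i, x =>
      if h : 0 < x then
        if h' : x < G.len i then .int i x h h' else .vertex (G.term i)
      else .vertex (G.init i)

/-- The open edge `l` as a set of points of the graph. -/
def openEdge (G : MetricGraph V E I) (l : G.Edge) : Set G.Point := G.param l '' G.openDom l

/-- The length of the shortest segment that joins `g` and `h` inside one closed edge (infinite if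
`g ≠ h` do not lie on a common closed edge). -/
def segDist (G : MetricGraph V E I) (g h : G.Point) : ℝ≥0∞ :=
  (⨅ _ : g = h, 0) ⊓
    ⨅ (l : G.Edge) (s : ℝ) (t : ℝ) (_ : s ∈ G.dom l ∧ t ∈ G.dom l ∧
      G.param l s = g ∧ G.param l t = h), ENNReal.ofReal |s - t|

/-- The length of the polygonal path from `g` to `h` through the listed points. -/
def chainLength (G : MetricGraph V E I) : G.Point → List G.Point → G.Point → ℝ≥0∞
  | g, [], h => G.segDist g h
  | g, p :: c, h => G.segDist g p + chainLength G p c h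

theorem segDist_self (G : MetricGraph V E I) (g : G.Point) : G.segDist g g = 0 := by
  simp [segDist]

theorem segDist_comm (G : MetricGraph V E I) (g h : G.Point) :
    G.segDist g h = G.segDist h g := by
  have key : ∀ a b : G.Point, G.segDist a b ≤ G.segDist b a := by
    intro a b
    refine le_inf ?_ ?_
    · refine le_iInf fun hab => ?_
      subst hab
      simp [segDist]
    · refine le_iInf fun l => le_iInf fun s => le_iInf fun t => le_iInf fun hst => ?_
      refine inf_le_right.trans ?_
      rw [abs_sub_comm]
      exact iInf_le_of_le l (iInf_le_of_le t (iInf_le_of_le s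
        (iInf_le_of_le ⟨hst.2.1, hst.1, hst.2.2.2, hst.2.2.1⟩ le_rfl)))
  exact le_antisymm (key g h) (key h g)

theorem chainLength_append (G : MetricGraph V E I) (c : List G.Point) :
    ∀ (g p : G.Point) (c' : List G.Point) (h : G.Point),
      G.chainLength g (c ++ p :: c') h = G.chainLength g c p + G.chainLength p c' h := by
  induction c with
  | nil => intro g p c' h; rfl
  | cons q c ih =>
    intro g p c' h
    simp only [List.cons_append, chainLength, ih, add_assoc]

theorem chainLength_reverse (G : MetricGraph V E I) (c : List G.Point) :
    ∀ g h : G.Point, G.chainLength g c h = G.chainLength h c.reverse g := by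
  induction c with
  | nil => intro g h; exact G.segDist_comm g h
  | cons q c ih =>
    intro g h
    rw [List.reverse_cons, chainLength_append, chainLength, chainLength, ih q h,
      G.segDist_comm g q, add_comm]

/-- The distance on a metric graph is the length of the shortest path; it is infinite between
points in different components. -/
instance (G : MetricGraph V E I) : PseudoEMetricSpace G.Point where
  edist g h := ⨅ c : List G.Point, G.chainLength g c h
  edist_self g := by
    refine le_antisymm ((iInf_le _ []).trans ?_) bot_le
    simp [chainLength, segDist_self]
  edist_comm g h := by
    refine le_antisymm ?_ ?_ <;>
    · refine le_iInf fun c => (iInf_le _ c.reverse).trans ?_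
      rw [← G.chainLength_reverse]
  edist_triangle g p h := by
    rw [ENNReal.iInf_add]
    refine le_iInf fun c => ?_
    rw [ENNReal.add_iInf]
    refine le_iInf fun c' => (iInf_le _ (c ++ p :: c')).trans ?_
    rw [chainLength_append]

instance (G : MetricGraph V E I) : MeasurableSpace G.Point := borel G.Point

instance (G : MetricGraph V E I) : BorelSpace G.Point := ⟨rfl⟩

theorem param_eq_vertex {G : MetricGraph V E I} {v : V} {l : G.Edge} {s : ℝ}
    (h : G.param l s = .vertex v) : G.Incident v l := by
  rcases l with e | i
  · simp only [param] at h
    split_ifs at h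
    simpa [Incident] using h
  · simp only [param] at h
    split_ifs at h
    · exact Or.inr (by simpa using h)
    · exact Or.inl (by simpa using h)

theorem exists_param_eq {G : MetricGraph V E I} (g : G.Point) :
    (∃ v, g = .vertex v) ∨ ∃ l, ∃ s ∈ G.openDom l, G.param l s = g := by
  rcases g with v | ⟨e, x, hx⟩ | ⟨i, x, hx, hx'⟩
  · exact Or.inl ⟨v, rfl⟩
  · exact Or.inr ⟨.inl e, x, hx, by simp [param, hx]⟩
  · exact Or.inr ⟨.inr i, x, ⟨hx, hx'⟩, by simp [param, hx, hx']⟩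

theorem continuousOn_param (G : MetricGraph V E I) (l : G.Edge) :
    ContinuousOn (G.param l) (G.dom l) := by
  refine LipschitzOnWith.continuousOn (K := 1) fun s hs t ht => ?_
  refine (iInf_le _ []).trans ?_
  rw [ENNReal.coe_one, one_mul, edist_dist, Real.dist_eq]
  exact inf_le_right.trans (iInf_le_of_le l (iInf_le_of_le s (iInf_le_of_le t
    (iInf_le_of_le ⟨hs, ht, rfl, rfl⟩ le_rfl))))

/-! ### The compactification of the graph without one vertex -/

/-- The points of the compactification of `G \ {v}`: the points of `G \ {v}`, the end `(l, 0+)` or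
`(l, R_l-)` at `v` of each edge `l` incident with `v`, and the end `(e, +∞)` of each external
edge `e`. -/
inductive Compactification (G : MetricGraph V E I) (v : V) where
  | inner (g : G.Point) (ne : g ≠ .vertex v) : Compactification G v
  | germ (l : G.Edge) (inc : G.Incident v l) : Compactification G v
  | atInfinity (e : E) : Compactification G v

namespace Compactification

open Classical in
/-- The point with parameter `s` on the closed edge `l`, cut open at `v`. -/
def place (G : MetricGraph V E I) (v : V) (l : G.Edge) (s : ℝ) : Compactification G v :=
  if h : G.param l s = .vertex v then .germ l (param_eq_vertex h) else .inner (G.param l s) h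

open Classical in
/-- The parametrisation of the compact edge `[0, R_l]`, where now `R_l = ∞` is included for
external edges; for internal edges the parameters beyond `R_l` are mapped to the end point. -/
def param (G : MetricGraph V E I) (v : V) : G.Edge → ℝ≥0∞ → Compactification G v
  | .inl e, t => if t = ⊤ then .atInfinity e else place G v (.inl e) t.toReal
  | .inr i, t => place G v (.inr i) (min t (ENNReal.ofReal (G.len i))).toReal

/-- The compact edges, cut open at `v`, are glued together at the vertices other than `v`: a set is
open if and only if its trace on every compact edge is open. -/
instance (G : MetricGraph V E I) (v : V) : TopologicalSpace (Compactification G v) :=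
  ⨆ l : G.Edge, TopologicalSpace.coinduced (param G v l) inferInstance

instance (G : MetricGraph V E I) (v : V) : MeasurableSpace (Compactification G v) :=
  borel (Compactification G v)

instance (G : MetricGraph V E I) (v : V) : BorelSpace (Compactification G v) := ⟨rfl⟩

end Compactification

end MetricGraph

/-! ### Right continuous strong Markov processes -/

/-- A family of processes `(X_t)` with values in the state space `S`, enlarged by an isolated
cemetery point `Δ = Sum.inr ()`, on a measurable space `Ω` with one law for every starting
point. -/
structure ProcessFamily (S Ω : Type*) [MeasurableSpace Ω] where
  path : ℝ≥0 → Ω → S ⊕ Unit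
  law : S ⊕ Unit → Measure Ω

namespace ProcessFamily

variable {S Ω : Type*} [MeasurableSpace Ω]

/-- The filtration `σ(X_s, s ≤ t)` generated by the process. -/
def filtration [MeasurableSpace S] (X : ProcessFamily S Ω) (h : ∀ t, Measurable (X.path t)) :
    Filtration ℝ≥0 (inferInstance : MeasurableSpace Ω) where
  seq t := ⨆ s ≤ t, MeasurableSpace.comap (X.path s) inferInstance
  mono' _ _ hst := biSup_mono fun _ hr => hr.trans hst
  le' _ := iSup₂_le fun s _ => (h s).comap_le

/-- `X` is a normal, right continuous, strong Markov process; the strong Markov property is with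
respect to the right continuous filtration generated by the process. -/
structure IsStrongMarkov [TopologicalSpace S] [MeasurableSpace S] (X : ProcessFamily S Ω) :
    Prop where
  prob : ∀ x, IsProbabilityMeasure (X.law x)
  measurable : ∀ t, Measurable (X.path t)
  rightCont : ∀ ω t, ContinuousWithinAt (fun s => X.path s ω) (Ici t) t
  normal : ∀ x, ∀ᵐ ω ∂X.law x, X.path 0 ω = x
  cemetery : ∀ x, ∀ᵐ ω ∂X.law x, ∀ s t, s ≤ t → X.path s ω = .inr () → X.path t ω = .inr ()
  /-- The transition functions are universally measurable. -/
  measurable_law : ∀ t, ∀ B : Set (S ⊕ Unit), MeasurableSet B →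
    ∀ m : Measure (S ⊕ Unit), IsFiniteMeasure m →
      AEMeasurable (fun x => X.law x (X.path t ⁻¹' B)) m
  strongMarkov : ∀ (τ : Ω → WithTop ℝ≥0)
    (hτ : IsStoppingTime (X.filtration measurable).rightCont τ) (A : Set Ω),
    MeasurableSet[hτ.measurableSpace] A → ∀ (t : ℝ≥0) (B : Set (S ⊕ Unit)), MeasurableSet B →
      ∀ x, X.law x {ω | ω ∈ A ∧ τ ω ≠ ⊤ ∧ X.path ((τ ω).untopD 0 + t) ω ∈ B} =
        ∫⁻ ω in {ω | ω ∈ A ∧ τ ω ≠ ⊤},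
          X.law (X.path ((τ ω).untopD 0) ω) (X.path t ⁻¹' B) ∂X.law x

/-- The first time at which the process is in the set `C`. -/
def hittingTime (X : ProcessFamily S Ω) (C : Set (S ⊕ Unit)) (ω : Ω) : ℝ≥0∞ :=
  ⨅ (t : ℝ≥0) (_ : X.path t ω ∈ C), (t : ℝ≥0∞)

/-- The process stopped at the first time at which it is in `C`. -/
def stopped (X : ProcessFamily S Ω) (C : Set (S ⊕ Unit)) (t : ℝ≥0) (ω : Ω) : S ⊕ Unit :=
  X.path (min (t : ℝ≥0∞) (X.hittingTime C ω)).toNNReal ω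

/-- `F` is absorbing: the process never leaves `F` when it is started in `F`. -/
def IsAbsorbing (X : ProcessFamily S Ω) (F : Set S) : Prop :=
  ∀ x ∈ F, ∀ᵐ ω ∂X.law (.inl x), ∀ t, X.path t ω ∈ Sum.inl '' F

/-- The distance on the enlarged state space, with `Δ` at infinite distance from all of `S`. -/
def cemeteryDist [PseudoEMetricSpace S] : S ⊕ Unit → S ⊕ Unit → ℝ≥0∞
  | .inl x, .inl y => edist x y
  | .inr _, .inr _ => 0
  | _, _ => ⊤

/-- `τ_ε = inf {t ≥ 0 | d(X_t, X_0) > ε}`. -/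
def exitTime [PseudoEMetricSpace S] (X : ProcessFamily S Ω) (ε : ℝ≥0) (ω : Ω) : ℝ≥0∞ :=
  ⨅ (t : ℝ≥0) (_ : (ε : ℝ≥0∞) < cemeteryDist (X.path t ω) (X.path 0 ω)), (t : ℝ≥0∞)

open Classical in
/-- The exit position `X_{τ_ε}`, with `X_∞ = Δ`. -/
def exitPosition [PseudoEMetricSpace S] (X : ProcessFamily S Ω) (ε : ℝ≥0) (ω : Ω) : S ⊕ Unit :=
  if X.exitTime ε ω = ⊤ then .inr () else X.path (X.exitTime ε ω).toNNReal ω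

end ProcessFamily

namespace MetricGraph

variable {V E I Ω : Type*} [MeasurableSpace Ω]

/-! ### Brownian motions on metric graphs -/

/-- The exit time of the path `b` from the set `U`. -/
def realExitTime (U : Set ℝ) (b : ℝ≥0 → ℝ) : ℝ≥0∞ := ⨅ (t : ℝ≥0) (_ : b t ∉ U), (t : ℝ≥0∞)

/-- The path `b`, stopped at its exit from `U`. -/
def realStopped (U : Set ℝ) (b : ℝ≥0 → ℝ) (t : ℝ≥0) : ℝ :=
  b (min (t : ℝ≥0∞) (realExitTime U b)).toNNReal

/-- A Brownian motion on the metric graph `G` is a right continuous strong Markov process which,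
when started inside an edge `l` and stopped when it leaves this open edge, has the law of a standard
one-dimensional Brownian motion (`x + B` below) stopped when it leaves the interval `(0, R_l)`. -/
structure IsBrownianMotion (G : MetricGraph V E I) (X : ProcessFamily G.Point Ω) : Prop
    extends X.IsStrongMarkov where
  edge : ∀ l : G.Edge, ∀ x ∈ G.openDom l,
    ∃ (Ω' : Type) (_ : MeasurableSpace Ω') (Q : Measure Ω') (B : ℝ≥0 → Ω' → ℝ),
      IsProbabilityMeasure Q ∧ IsBrownianReal B Q ∧
      ∀ J : Finset ℝ≥0, IdentDistrib
        (fun ω (t : J) => X.stopped (Sum.inl '' G.openEdge l)ᶜ t ω)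
        (fun ω' (t : J) => (Sum.inl (G.param l
          (realStopped (G.openDom l) (fun s => x + B s ω') t)) : G.Point ⊕ Unit))
        (X.law (.inl (G.param l x))) Q

/-! ### Feller–Wentzell data -/

/-- A candidate for the Feller–Wentzell data: for every vertex `v` the killing weights
`c₁^{v,Δ}` and `c₁^{v,∞}`, the reflection weights `c₂^{v,l}` of the edges `l ∈ L(v)`, the diffusion
weight `c₃^v`, and the jump measure `c₄^v` on `G \ {v}` (here a measure on `G`). -/
structure FellerWentzellData (G : MetricGraph V E I) where
  killCemetery : V → ℝ≥0∞
  killInfinity : V → ℝ≥0∞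
  reflection : (v : V) → {l : G.Edge // G.Incident v l} → ℝ≥0∞
  diffusion : V → ℝ≥0∞
  jump : V → Measure G.Point

/-- The weight `1 - e^{-d(v,g)}`, which is `1` if `d(v,g) = ∞`. -/
def weight (G : MetricGraph V E I) (v : V) (g : G.Point) : ℝ≥0∞ :=
  1 - EReal.exp (-((edist (Point.vertex v) g : ℝ≥0∞) : EReal))

section Data

variable {G : MetricGraph V E I} (X : ProcessFamily G.Point Ω) (v : V) (ε : ℝ≥0)

/-- `E_v(τ_ε)`. -/
def meanExitTime : ℝ≥0∞ := ∫⁻ ω, X.exitTime ε ω ∂X.law (.inl (.vertex v))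

/-- `P_v(X_{τ_ε} = Δ) / E_v(τ_ε)`. -/
def killRate : ℝ≥0∞ :=
  X.law (.inl (.vertex v)) {ω | X.exitPosition ε ω = .inr ()} / meanExitTime X v ε

/-- `ν_ε^v(A) = P_v(X_{τ_ε} ∈ A) / E_v(τ_ε)`. -/
def scaledExit : Measure G.Point :=
  (meanExitTime X v ε)⁻¹ •
    ((X.law (.inl (.vertex v))).map (X.exitPosition ε)).comap Sum.inl

/-- `K_ε^v = 1 + P_v(X_{τ_ε} = Δ) / E_v(τ_ε) + ∫ (1 - e^{-d(v,g)}) ν_ε^v(dg)`. -/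
def normalization : ℝ≥0∞ := 1 + killRate X v ε + ∫⁻ g, G.weight v g ∂scaledExit X v ε

/-- `μ_ε^v(A) = ∫_A (1 - e^{-d(v,g)}) ν_ε^v(dg) / K_ε^v`. -/
def normalizedExit : Measure G.Point :=
  (normalization X v ε)⁻¹ • (scaledExit X v ε).withDensity (G.weight v)

open Classical in
/-- The restriction to `G \ {v}` of a function on the compactification (extended by `0` to `v`).
The integral of this function with respect to `μ_ε^v` is the integral of `f` with respect to
the extension of `μ_ε^v` to the compactification, under which the added points are a null set. -/
def restrictFun {v : V} (f : Compactification G v → ℝ) (g : G.Point) : ℝ :=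
  if h : g ≠ .vertex v then f (.inner g h) else 0

open Classical in
/-- The function `1_A(g) / (1 - e^{-d(v,g)})` for `g ∈ G \ {v}`, extended by `0` to the added points
of the compactification. -/
def jumpDensity {v : V} (A : Set G.Point) : Compactification G v → ℝ≥0∞
  | .inner g _ => if g ∈ A then (G.weight v g)⁻¹ else 0
  | .germ _ _ => 0
  | .atInfinity _ => 0

/-- `c` is the Feller–Wentzell data of `X`, computed along the null sequences `(ε_n^v)`: at
every vertex `v`, the measures `μ_ε^v` converge weakly on the compactification of `G \ {v}` along the
sequence to a finite measure `μ`, and with this limit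

* `c₁^{v,Δ} = lim P_v(X_{τ_ε} = Δ) / (E_v(τ_ε) K_ε^v)`,
* `c₁^{v,∞} = ∑_{e ∈ E} μ({(e, +∞)})`,
* `c₂^{v,l}` is the mass under `μ` of the end of the edge `l` at `v`,
* `c₃^v = lim 1 / K_ε^v`,
* `c₄^v(A) = ∫_A (1 - e^{-d(v,g)})⁻¹ μ(dg)`. -/
def HasFellerWentzellData (ε : V → ℕ → ℝ≥0) (c : FellerWentzellData G) : Prop :=
  ∀ v, (∀ n, 0 < ε v n) ∧ Tendsto (ε v) atTop (𝓝 0) ∧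
    Tendsto (fun n => killRate X v (ε v n) / normalization X v (ε v n)) atTop
      (𝓝 (c.killCemetery v)) ∧
    Tendsto (fun n => (normalization X v (ε v n))⁻¹) atTop (𝓝 (c.diffusion v)) ∧
    ∃ μ : Measure (Compactification G v), IsFiniteMeasure μ ∧
      (∀ f : Compactification G v →ᵇ ℝ,
        Tendsto (fun n => ∫ g, restrictFun f g ∂normalizedExit X v (ε v n)) atTop
          (𝓝 (∫ y, f y ∂μ))) ∧
      c.killInfinity v = ∑' e : E, μ {.atInfinity e} ∧
      (∀ l, c.reflection v l = μ {.germ l.1 l.2}) ∧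
      ∀ A, MeasurableSet A → c.jump v A = ∫⁻ y, jumpDensity A y ∂μ

end Data

/-! ### Killing on a set -/

/-- The metric graph `G \ F`: the vertices outside `F` together with the edges all of whose
end points are outside `F`. If `F` is open and closed, then the points of this graph are exactly
the points of `G` outside `F`, see `range_incl`. -/
def delete (G : MetricGraph V E I) (F : Set G.Point) :
    MetricGraph {v : V // Point.vertex v ∉ F} {e : E // Point.vertex (G.base e) ∉ F}
      {i : I // Point.vertex (G.init i) ∉ F ∧ Point.vertex (G.term i) ∉ F} where
  base e := ⟨G.base e.1, e.2⟩
  init i := ⟨G.init i.1, i.2.1⟩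
  term i := ⟨G.term i.1, i.2.2⟩
  len i := G.len i.1
  len_pos i := G.len_pos i.1
  no_loop i h := G.no_loop i.1 (congrArg Subtype.val h)

/-- The inclusion of `G \ F` into `G`. -/
def incl (G : MetricGraph V E I) (F : Set G.Point) : (G.delete F).Point → G.Point
  | .vertex v => .vertex v.1
  | .ext e x h => .ext e.1 x h
  | .int i x h h' => .int i.1 x h h'

/-- The inclusion on the level of edges. -/
def inclEdge (G : MetricGraph V E I) (F : Set G.Point) : (G.delete F).Edge → G.Edge :=
  Sum.map Subtype.val Subtype.val

theorem incident_inclEdge {G : MetricGraph V E I} {F : Set G.Point}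
    {v : {v : V // Point.vertex v ∉ F}} {l : (G.delete F).Edge} (h : (G.delete F).Incident v l) :
    G.Incident v.1 (G.inclEdge F l) := by
  rcases l with e | i
  · exact congrArg Subtype.val h
  · exact h.imp (congrArg Subtype.val) (congrArg Subtype.val)

theorem incl_injective (G : MetricGraph V E I) (F : Set G.Point) :
    Function.Injective (G.incl F) := by
  rintro (⟨v, hv⟩ | ⟨⟨e, he⟩, x, hx⟩ | ⟨⟨i, hi⟩, x, hx, hx'⟩)
    (⟨w, hw⟩ | ⟨⟨e', he'⟩, y, hy⟩ | ⟨⟨i', hi'⟩, y, hy, hy'⟩) h <;>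
    simp only [incl] at h <;> cases h <;> rfl

theorem range_incl (G : MetricGraph V E I) {F : Set G.Point} (hF : IsClopen F) :
    range (G.incl F) = Fᶜ := by
  have edge : ∀ l, ∀ s ∈ G.dom l, ∀ t ∈ G.dom l, G.param l s ∈ F → G.param l t ∈ F := by
    intro l s hs t ht hsF
    have hc : IsPreconnected (G.dom l) := by
      rcases l with e | i
      · exact isPreconnected_Ici
      · exact isPreconnected_Icc
    exact (hc.image _ (G.continuousOn_param l)).subset_isClopen hF
      ⟨_, mem_image_of_mem _ hs, hsF⟩ (mem_image_of_mem _ ht)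
  have ext : ∀ e x (hx : 0 < x), Point.ext e x hx ∈ F ↔ Point.vertex (G.base e) ∈ F := by
    intro e x hx
    have h0 : G.param (.inl e) 0 = .vertex (G.base e) := by simp [param]
    have hxx : G.param (.inl e) x = .ext e x hx := by simp [param, hx]
    rw [← h0, ← hxx]
    exact ⟨edge (.inl e) x hx.le 0 self_mem_Ici, edge (.inl e) 0 self_mem_Ici x hx.le⟩
  have int : ∀ i x (hx : 0 < x) (hx' : x < G.len i),
      (Point.int i x hx hx' ∈ F ↔ Point.vertex (G.init i) ∈ F) ∧
      (Point.int i x hx hx' ∈ F ↔ Point.vertex (G.term i) ∈ F) := by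
    intro i x hx hx'
    have h0 : G.param (.inr i) 0 = .vertex (G.init i) := by simp [param]
    have h1 : G.param (.inr i) (G.len i) = .vertex (G.term i) := by simp [param, G.len_pos i]
    have hxx : G.param (.inr i) x = .int i x hx hx' := by simp [param, hx, hx']
    have m0 : (0 : ℝ) ∈ G.dom (.inr i) := ⟨le_rfl, (G.len_pos i).le⟩
    have m1 : G.len i ∈ G.dom (.inr i) := ⟨(G.len_pos i).le, le_rfl⟩
    have mx : x ∈ G.dom (.inr i) := ⟨hx.le, hx'.le⟩
    rw [← h0, ← h1, ← hxx]
    exact ⟨⟨edge _ _ mx _ m0, edge _ _ m0 _ mx⟩, ⟨edge _ _ mx _ m1, edge _ _ m1 _ mx⟩⟩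
  ext g
  constructor
  · rintro ⟨v | ⟨e, x, hx⟩ | ⟨i, x, hx, hx'⟩, rfl⟩
    · exact v.2
    · exact fun h => e.2 ((ext _ _ _).1 h)
    · exact fun h => i.2.1 ((int _ _ _ _).1.1 h)
  · intro hg
    rcases g with v | ⟨e, x, hx⟩ | ⟨i, x, hx, hx'⟩
    · exact ⟨.vertex ⟨v, hg⟩, rfl⟩
    · exact ⟨.ext ⟨e, fun h => hg ((ext _ _ _).2 h)⟩ x hx, rfl⟩
    · exact ⟨.int ⟨i, fun h => hg ((int _ _ _ _).1.2 h), fun h => hg ((int _ _ _ _).2.2 h)⟩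
        x hx hx', rfl⟩

open Classical in
/-- The map `ψ` which is the identity on `G \ F` and maps `F` to `Δ`. -/
def killMap (G : MetricGraph V E I) (F : Set G.Point) (g : G.Point) :
    (G.delete F).Point ⊕ Unit :=
  if h : g ∉ F ∧ ∃ y, G.incl F y = g then .inl h.2.choose else .inr ()

/-- The process `ψ(X)` on `G \ F` that results from killing `X` on `F`. -/
def killedProcess {G : MetricGraph V E I} (X : ProcessFamily G.Point Ω) (F : Set G.Point) :
    ProcessFamily (G.delete F).Point Ω where
  path t ω := Sum.elim (G.killMap F) (fun _ => .inr ()) (X.path t ω)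
  law y := X.law (Sum.map (G.incl F) id y)

/-- The data obtained from `c` by restriction to the vertices outside `F`, where the jump measures
are restricted to the complement of `F` and the masses `c₄^v(F)` are added to the killing weights
`c₁^{v,Δ}`. -/
def FellerWentzellData.killed {G : MetricGraph V E I} (c : FellerWentzellData G)
    (F : Set G.Point) : FellerWentzellData (G.delete F) where
  killCemetery v := c.killCemetery v.1 + c.jump v.1 F
  killInfinity v := c.killInfinity v.1
  reflection v l := c.reflection v.1 ⟨G.inclEdge F l.1, incident_inclEdge l.2⟩
  diffusion v := c.diffusion v.1
  jump v := (c.jump v.1).comap (G.incl F)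

end MetricGraph

end

noncomputable section

set_option linter.unusedSectionVars false

/-! ### Borel structure of the state space with cemetery -/

section SumUnit

variable {S : Type*} [PseudoEMetricSpace S]

/-! Points of `F` are at infinite distance from the rest of the graph, exactly like the cemetery.
Killing on `F` therefore changes neither exit times nor mean exit times at a vertex outside `F`; it
only relabels exits into `F` as exits to `Δ`. On `F` the weight `1 - e^{-d}` equals `1`, so the mass
`ν_ε(F)` lost from the integral in `K_ε` reappears in the killing term: `K_ε` is unchanged, and the
killed `μ_ε` is the restriction of the old one to `G \ F` (`normalization_killedProcess`,
`normalizedExit_killedProcess`). The compactification belonging to `G \ F` embeds as a clopen subset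
into the one belonging to `G`, so weak limits restrict to it, and `μ_ε(F)` converges to the limit
mass of its complement.

This complement consists of the points of `F` and the ends `(e, +∞)` of the external edges in `F`.
The first part has mass `c₄(F)`. The theorem thus rests on the claim that the limit measure does not
charge the ends at infinity in `F` (`measure_atInfinity_eq_zero`); otherwise the new killing weight
would exceed `c₁^Δ + c₄(F)`, and `c₁^∞` would change.

The claim is a finite-dimensionality argument. Assign to each state `y` its entrance law into `F`,
the functional `g ↦ E_y g(X_σ)` with `σ` the first time in `F`. Started inside an edge outside `F`,
a Brownian motion must pass a vertex before it can enter `F`, so the entrance law of every `y ∉ F`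
lies in the span `W` of the finitely many entrance laws of vertices (`entranceFun_mem_vertexSpan`).
By the strong Markov property at `τ_ε`, the exit law on `F` is the entrance law of `v` minus an
average of entrance laws of points outside `F`; it lies in `W` as well, for every `ε`
(`IsStop.exitLaw_mem`). In `W` finitely many evaluations control a functional, so the normalized
exit laws, having mass at most `1`, are uniformly small on any test functions tending pointwise to
`0`, in particular on the tails of an external edge (`exists_uniform_bound`).

Much of the work is the strong Markov property for entrance positions, since it is given only for
one future time and one Borel set, with transition functions that are merely universally measurable.
Entrance into an absorbing clopen set is approximated along time grids, where every term involves
the path at no more than two times (`IsStop.entranceMean_eq`). -/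

instance pseudoMetrizableSpace_sumUnit : TopologicalSpace.PseudoMetrizableSpace (S ⊕ Unit) := by
  have h : (uniformity (S ⊕ Unit)).IsCountablyGenerated := by
    rw [Sum.uniformity]
    infer_instance
  exact UniformSpace.pseudoMetrizableSpace

theorem measurableSet_borel_image {S T : Type*} [TopologicalSpace S] [MeasurableSpace S]
    [BorelSpace S] [TopologicalSpace T] {f : S → T} (hf : IsOpenEmbedding f) {A : Set S}
    (hA : MeasurableSet A) : MeasurableSet[borel T] (f '' A) := by
  borelize T
  exact hf.measurableEmbedding.measurableSet_image.2 hA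

instance borelSpace_sumUnit [MeasurableSpace S] [BorelSpace S] : BorelSpace (S ⊕ Unit) := by
  refine ⟨le_antisymm (fun s hs => ?_) (MeasurableSpace.generateFrom_le fun s hs => ?_)⟩
  · have e : s = Sum.inl '' (Sum.inl ⁻¹' s : Set S) ∪ Sum.inr '' (Sum.inr ⁻¹' s : Set Unit) := by
      ext x
      rcases x with x | ⟨⟩
      · simp
      · exact ⟨fun h => Or.inr ⟨(), h, rfl⟩, by simp⟩
    rw [e]
    exact @MeasurableSet.union _ (borel _) _ _
      (measurableSet_borel_image IsOpenEmbedding.inl (measurable_inl hs))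
      (MeasurableSpace.measurableSet_generateFrom (isOpenMap_inr _ (isOpen_discrete _)))
  · exact measurableSet_sum_iff.2
      ⟨(isOpen_sum_iff.1 hs).1.measurableSet, (isOpen_sum_iff.1 hs).2.measurableSet⟩

end SumUnit

/-- The first point of the grid of mesh `1 / (n + 1)` strictly after `t`. -/
def nextGrid (n : ℕ) (t : ℝ≥0) : ℝ≥0 := (⌊t * (n + 1)⌋₊ + 1) / (n + 1)

theorem lt_nextGrid (n : ℕ) (t : ℝ≥0) : t < nextGrid n t := by
  rw [nextGrid, lt_div_iff₀ (by positivity)]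
  exact Nat.lt_floor_add_one _

theorem tendsto_nextGrid (t : ℝ≥0) : Tendsto (fun n => nextGrid n t) atTop (𝓝[≥] t) := by
  refine tendsto_nhdsWithin_iff.2 ⟨?_, Eventually.of_forall fun n => (lt_nextGrid n t).le⟩
  have h : Tendsto (fun n : ℕ => t + 1 / ((n : ℝ≥0) + 1)) atTop (𝓝 t) := by
    have := (NNReal.tendsto_coe.1
      (by simpa using tendsto_one_div_add_atTop_nhds_zero_nat (𝕜 := ℝ)) :
      Tendsto (fun n : ℕ => 1 / ((n : ℝ≥0) + 1)) atTop (𝓝 0))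
    simpa using this.const_add t
  refine tendsto_of_tendsto_of_tendsto_of_le_of_le tendsto_const_nhds h
    (fun n => (lt_nextGrid n t).le) fun n => ?_
  have hn : (0 : ℝ≥0) < n + 1 := by positivity
  show nextGrid n t ≤ _
  rw [nextGrid, add_div]
  gcongr
  rw [div_le_iff₀ hn]
  exact Nat.floor_le (by positivity)

/-! ### The strong Markov property for universally measurable functions -/

namespace ProcessFamily

variable {S Ω : Type*} [MeasurableSpace Ω] {X : ProcessFamily S Ω}

section StrongMarkov

variable [PseudoEMetricSpace S] [MeasurableSpace S] [BorelSpace S]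

/-- Rounding the random time up to a grid leaves countably many times, for which measurability is
clear; right continuity passes it to the limit. -/
theorem IsStrongMarkov.measurable_path_comp (hX : X.IsStrongMarkov) {t : Ω → ℝ≥0}
    (ht : Measurable t) : Measurable fun ω => X.path (t ω) ω := by
  refine measurable_of_tendsto_metrizable (f := fun (n : ℕ) ω => X.path (nextGrid n (t ω)) ω)
    (fun n => ?_) (tendsto_pi_nhds.2 fun ω =>
      (hX.rightCont ω (t ω)).tendsto.comp (tendsto_nextGrid (t ω)))
  have h1 : ∀ c : ℕ → ℝ≥0, Measurable fun p : ℕ × Ω => X.path (c p.1) p.2 := fun c =>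
    measurable_from_prod_countable_right fun k => hX.measurable (c k)
  have h2 : Measurable fun ω => (⌊t ω * (n + 1)⌋₊, ω) :=
    (Nat.measurable_floor.comp (ht.mul_const _)).prodMk measurable_id
  have h3 := (h1 fun k => (k + 1) / (n + 1)).comp h2
  simpa only [nextGrid, Function.comp_def] using h3

/-- The transition operator `P_t u`. -/
def trans (X : ProcessFamily S Ω) (t : ℝ≥0) (u : S ⊕ Unit → ℝ≥0∞) (x : S ⊕ Unit) : ℝ≥0∞ :=
  ∫⁻ ω, u (X.path t ω) ∂X.law x

/-- Universal measurability with respect to the finite measures. -/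
def UnivMeasurable (u : S ⊕ Unit → ℝ≥0∞) : Prop :=
  ∀ m : Measure (S ⊕ Unit), IsFiniteMeasure m → AEMeasurable u m

theorem IsStrongMarkov.univMeasurable_trans (hX : X.IsStrongMarkov) (t : ℝ≥0)
    {u : S ⊕ Unit → ℝ≥0∞} (hu : Measurable u) : UnivMeasurable (X.trans t u) := by
  intro m hm
  refine Measurable.ennreal_induction
    (motive := fun u => AEMeasurable (X.trans t u) m) ?_ ?_ ?_ hu
  · intro c s hs
    have : X.trans t (s.indicator fun _ => c) = fun x => c * X.law x (X.path t ⁻¹' s) := by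
      ext x
      have : (fun ω => (s.indicator (fun _ => c) (X.path t ω))) =
        (X.path t ⁻¹' s).indicator fun _ => c := rfl
      rw [trans, this, lintegral_indicator_const (hX.measurable t hs)]
    rw [this]
    exact (hX.measurable_law t s hs m hm).const_mul c
  · intro f g _ hf hg ihf ihg
    have : X.trans t (f + g) = X.trans t f + X.trans t g := by
      ext x
      exact lintegral_add_left (hf.comp (hX.measurable t)) _
    rw [this]
    exact ihf.add ihg
  · intro f hf hmono ih
    have : X.trans t (fun x => ⨆ n, f n x) = fun x => ⨆ n, X.trans t (f n) x := by
      ext x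
      exact lintegral_iSup (fun n => (hf n).comp (hX.measurable t))
        fun i j hij ω => hmono hij _
    rw [this]
    exact AEMeasurable.iSup ih

/-- `τ` is a stopping time of the right continuous filtration of the process. -/
def IsStop (hX : X.IsStrongMarkov) (τ : Ω → ℝ≥0∞) : Prop :=
  IsStoppingTime (ι := ℝ≥0) (X.filtration hX.measurable).rightCont τ

/-- The state of the process at the time `τ` on `{τ < ∞}`. -/
def stateAt (X : ProcessFamily S Ω) (τ : Ω → ℝ≥0∞) (ω : Ω) : S ⊕ Unit :=
  X.path (τ ω).toNNReal ω

variable {hX : X.IsStrongMarkov} {τ : Ω → ℝ≥0∞}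

theorem IsStop.measurable (hτ : IsStop hX τ) : Measurable τ := by
  refine measurable_of_Iic fun a => ?_
  rcases eq_or_ne a ⊤ with rfl | ha
  · simp
  · lift a to ℝ≥0 using ha
    exact (X.filtration hX.measurable).rightCont.le a _ (hτ a)

theorem IsStop.measurable_stateAt (hτ : IsStop hX τ) : Measurable (X.stateAt τ) :=
  hX.measurable_path_comp (ENNReal.measurable_toNNReal.comp hτ.measurable)

theorem isStop_of_lt (hτ : ∀ i : ℝ≥0, MeasurableSet[X.filtration hX.measurable i] {ω | τ ω < i}) :
    IsStop hX τ :=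
  isStoppingTime_of_measurableSet_lt_of_isRightContinuous
    fun i => Filtration.le_rightCont _ i _ (hτ i)

theorem isStop_const (hX : X.IsStrongMarkov) (s : ℝ≥0) : IsStop hX fun _ => (s : ℝ≥0∞) :=
  isStoppingTime_const _ s

theorem IsStop.add_const (hτ : IsStop hX τ) (s : ℝ≥0) : IsStop hX fun ω => τ ω + s := by
  intro i
  rcases le_or_gt s i with h | h
  · have : {ω | τ ω + s ≤ i} = {ω | τ ω ≤ (i - s : ℝ≥0)} := by
      ext ω
      simp only [mem_ofPred_eq, ENNReal.coe_sub]
      exact (ENNReal.le_sub_iff_add_le_right ENNReal.coe_ne_top (by exact_mod_cast h)).symm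
    change MeasurableSet[(X.filtration hX.measurable).rightCont i] {ω | τ ω + s ≤ i}
    rw [this]
    exact (X.filtration hX.measurable).rightCont.mono tsub_le_self _ (hτ (i - s))
  · have : {ω | τ ω + s ≤ i} = ∅ := by
      ext ω
      simp only [mem_ofPred_eq, mem_empty_iff_false, iff_false, not_le]
      exact lt_of_lt_of_le (by exact_mod_cast h) le_add_self
    change MeasurableSet[(X.filtration hX.measurable).rightCont i] {ω | τ ω + s ≤ i}
    rw [this]
    exact @MeasurableSet.empty Ω ((X.filtration hX.measurable).rightCont i)

theorem IsStop.iSup {τ : ℕ → Ω → ℝ≥0∞} (hτ : ∀ n, IsStop hX (τ n)) :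
    IsStop hX fun ω => ⨆ n, τ n ω := by
  intro i
  have : {ω | ⨆ n, τ n ω ≤ i} = ⋂ n, {ω | τ n ω ≤ i} := by
    ext ω
    simp
  change MeasurableSet[(X.filtration hX.measurable).rightCont i] {ω | ⨆ n, τ n ω ≤ i}
  rw [this]
  exact @MeasurableSet.iInter _ _ _ _ _ fun n => hτ n i

/-- Iterating the Markov property produces functions such as `P_t g`, which need not be Borel. This
is why `u` is only universally measurable here. -/
theorem IsStop.lintegral_path_add (hτ : IsStop hX τ) {E : Set Ω}
    (hE : MeasurableSet[IsStoppingTime.measurableSpace hτ] E) (t : ℝ≥0) (x : S ⊕ Unit)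
    {u : S ⊕ Unit → ℝ≥0∞} (hu : UnivMeasurable u) :
    ∫⁻ ω in {ω | ω ∈ E ∧ τ ω ≠ ⊤}, u (X.path ((τ ω).toNNReal + t) ω) ∂X.law x =
      ∫⁻ ω in {ω | ω ∈ E ∧ τ ω ≠ ⊤}, X.trans t u (X.stateAt τ ω) ∂X.law x := by
  have := hX.prob x
  set D : Set Ω := {ω | ω ∈ E ∧ τ ω ≠ ⊤} with hD
  have hDm : MeasurableSet D :=
    (IsStoppingTime.measurableSpace_le hτ _ hE).inter
      (hτ.measurable (measurableSet_singleton _).compl)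
  have hpath : Measurable fun ω => X.path ((τ ω).toNNReal + t) ω :=
    hX.measurable_path_comp ((ENNReal.measurable_toNNReal.comp hτ.measurable).add_const t)
  have hset : ∀ B, MeasurableSet B → (X.law x).restrict D
      ((fun ω => X.path ((τ ω).toNNReal + t) ω) ⁻¹' B) =
      ∫⁻ ω in D, X.law (X.stateAt τ ω) (X.path t ⁻¹' B) ∂X.law x := by
    intro B hB
    rw [Measure.restrict_apply (hpath hB), inter_comm]
    refine Eq.trans ?_ (hX.strongMarkov τ hτ E hE t B hB x)
    congr 1
    ext ω
    simp only [hD, mem_inter_iff, mem_ofPred_eq, mem_preimage, and_assoc]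
    rfl
  have haem : ∀ w, UnivMeasurable w →
      AEMeasurable (fun ω => w (X.stateAt τ ω)) ((X.law x).restrict D) := fun w hw =>
    (hw _ inferInstance).comp_measurable hτ.measurable_stateAt
  have key : ∀ w : S ⊕ Unit → ℝ≥0∞, Measurable w →
      ∫⁻ ω in D, w (X.path ((τ ω).toNNReal + t) ω) ∂X.law x =
      ∫⁻ ω in D, X.trans t w (X.stateAt τ ω) ∂X.law x := by
    intro w hw
    refine Measurable.ennreal_induction (motive := fun w =>
      ∫⁻ ω in D, w (X.path ((τ ω).toNNReal + t) ω) ∂X.law x =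
      ∫⁻ ω in D, X.trans t w (X.stateAt τ ω) ∂X.law x) ?_ ?_ ?_ hw
    · intro c B hB
      have h1 : ∀ y, X.trans t (B.indicator fun _ => c) y = c * X.law y (X.path t ⁻¹' B) := by
        intro y
        have : (fun ω => (B.indicator (fun _ => c) (X.path t ω))) =
          (X.path t ⁻¹' B).indicator fun _ => c := rfl
        rw [trans, this, lintegral_indicator_const (hX.measurable t hB)]
      simp only [h1]
      have h2 : (fun ω => B.indicator (fun _ => c) (X.path ((τ ω).toNNReal + t) ω)) =
        ((fun ω => X.path ((τ ω).toNNReal + t) ω) ⁻¹' B).indicator fun _ => c := rfl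
      rw [h2, lintegral_indicator_const (hpath hB), hset B hB, lintegral_const_mul'']
      exact haem _ (hX.measurable_law t B hB)
    · intro f g _ hf hg ihf ihg
      have h1 : ∀ y, X.trans t (f + g) y = X.trans t f y + X.trans t g y := fun y =>
        lintegral_add_left (hf.comp (hX.measurable t)) _
      simp only [h1, Pi.add_apply]
      have h2 : Measurable fun ω => f (X.path ((τ ω).toNNReal + t) ω) := hf.comp hpath
      rw [lintegral_add_left h2, ihf, ihg, lintegral_add_left']
      exact haem _ (hX.univMeasurable_trans t hf)
    · intro f hf hmono ih
      have h1 : ∀ y, X.trans t (fun x => ⨆ n, f n x) y = ⨆ n, X.trans t (f n) y := fun y =>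
        lintegral_iSup (fun n => (hf n).comp (hX.measurable t)) fun i j hij ω => hmono hij _
      simp only [h1]
      have h2 : ∀ n, Measurable fun ω => f n (X.path ((τ ω).toNNReal + t) ω) :=
        fun n => (hf n).comp hpath
      rw [lintegral_iSup h2 fun i j hij ω => hmono hij _,
        lintegral_iSup' (fun n => haem _ (hX.univMeasurable_trans t (hf n)))]
      · exact iSup_congr ih
      · exact Eventually.of_forall fun ω i j hij => lintegral_mono fun ω' => hmono hij _
  -- Passage from Borel to universally measurable `u`: let `w` be a Borel version of `u` under the
  -- law `m` of `X_{τ+t}`. The Borel null set containing `{u ≠ w}` is, by `hset`, also null for the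
  -- transition probability from almost every `X_τ`, so `u` may be exchanged with `w` on both sides.
  set m := ((X.law x).restrict D).map fun ω => X.path ((τ ω).toNNReal + t) ω with hm
  have hum := hu m (Measure.isFiniteMeasure_map _ _)
  obtain ⟨w, hw, huw⟩ := hum
  have h1 : ∀ᵐ ω ∂(X.law x).restrict D,
      u (X.path ((τ ω).toNNReal + t) ω) = w (X.path ((τ ω).toNNReal + t) ω) :=
    ae_of_ae_map hpath.aemeasurable huw
  rw [lintegral_congr_ae h1, key w hw]
  obtain ⟨N, hN, hNm, hN0⟩ := exists_measurable_superset_of_null (ae_iff.1 huw)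
  have h2 : ∀ᵐ ω ∂(X.law x).restrict D, X.law (X.stateAt τ ω) (X.path t ⁻¹' N) = 0 := by
    rw [hm, Measure.map_apply hpath hNm, hset N hNm,
      lintegral_eq_zero_iff' (haem _ (hX.measurable_law t N hNm))] at hN0
    exact hN0
  refine lintegral_congr_ae ?_
  filter_upwards [h2] with ω hω
  refine lintegral_congr_ae ?_
  refine measure_mono_null (fun ω' hω' => ?_) hω
  exact hN fun h => hω' h.symm

end StrongMarkov

end ProcessFamily

/-! ### Entrance of a single path into an absorbing closed set -/

section Path

variable {T : Type*} [TopologicalSpace T] {w : ℝ≥0 → T} {C : Set T}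

theorem exists_rat_mem_of_rightCont {t i : ℝ≥0} (hw : ContinuousWithinAt w (Ici t) t) {U : Set T}
    (hU : IsOpen U) (ht : w t ∈ U) (hi : t < i) :
    ∃ q : ℚ, t < Real.toNNReal q ∧ Real.toNNReal q < i ∧ w (Real.toNNReal q) ∈ U := by
  have h1 : ∀ᶠ s in 𝓝[>] t, w s ∈ U :=
    (hw.eventually (hU.mem_nhds ht)).filter_mono (nhdsWithin_mono _ Ioi_subset_Ici_self)
  obtain ⟨u, hu, h2⟩ := (mem_nhdsGT_iff_exists_Ioo_subset' hi).1 h1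
  obtain ⟨q, -, h3, h4⟩ := (NNReal.lt_iff_exists_rat_btwn t (min u i)).1 (lt_min hu hi)
  exact ⟨q, h3, h4.trans_le (min_le_right _ _), h2 ⟨h3, h4.trans_le (min_le_left _ _)⟩⟩

/-- The first time at which the path `w` is in `C`. -/
def entranceTime (C : Set T) (w : ℝ≥0 → T) : ℝ≥0 := sInf {t | w t ∈ C}

open Classical in
/-- The value of `g` at the position of the first entrance into `C`; it is `0` if `C` is never
entered. -/
def entranceValue (C : Set T) (g : T → ℝ≥0∞) (w : ℝ≥0 → T) : ℝ≥0∞ :=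
  if ∃ t, w t ∈ C then g (w (entranceTime C w)) else 0

/-- The approximation of `entranceValue` along the grid of mesh `1 / (n + 1)`. -/
def gridSum (n : ℕ) (C : Set T) (g : T → ℝ≥0∞) (w : ℝ≥0 → T) : ℝ≥0∞ :=
  g (w 0) + ∑' k : ℕ, Cᶜ.indicator 1 (w (k / (n + 1))) * g (w (k / (n + 1) + 1 / (n + 1)))

/-- The infimum is approached from the right by times spent in `C`, so right continuity and
closedness suffice. -/
theorem mem_entranceTime (hr : ∀ t, ContinuousWithinAt w (Ici t) t) (hC : IsClosed C)
    (h : ∃ t, w t ∈ C) : w (entranceTime C w) ∈ C := by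
  have h1 : entranceTime C w ∈ closure {t | w t ∈ C} :=
    csInf_mem_closure h (OrderBot.bddBelow _)
  have h2 : ∃ᶠ t in 𝓝[≥] entranceTime C w, w t ∈ C := by
    rw [mem_closure_iff_frequently] at h1
    rw [frequently_nhdsWithin_iff]
    exact h1.mono fun t ht => ⟨ht, csInf_le (OrderBot.bddBelow _) ht⟩
  exact hC.mem_of_frequently_of_tendsto h2 (hr _)

theorem mem_iff_entranceTime_le (hr : ∀ t, ContinuousWithinAt w (Ici t) t) (hC : IsClosed C)
    (ha : ∀ s t, s ≤ t → w s ∈ C → w t ∈ C) (h : ∃ t, w t ∈ C) (t : ℝ≥0) :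
    w t ∈ C ↔ entranceTime C w ≤ t :=
  ⟨fun ht => csInf_le (OrderBot.bddBelow _) ht, fun ht => ha _ _ ht (mem_entranceTime hr hC h)⟩

/-- An absorbed path crosses into `C` only once: exactly one grid step starts outside `C` and ends
inside. Only this term survives, evaluated at the first grid time not before the entrance. -/
theorem gridSum_of_entranceTime_pos (hr : ∀ t, ContinuousWithinAt w (Ici t) t) (hC : IsClosed C)
    (ha : ∀ s t, s ≤ t → w s ∈ C → w t ∈ C) (h : ∃ t, w t ∈ C) {g : T → ℝ≥0∞}
    (hg : ∀ x ∉ C, g x = 0) (hpos : 0 < entranceTime C w) (n : ℕ) :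
    gridSum n C g w = g (w (⌈entranceTime C w * (n + 1)⌉₊ / (n + 1))) := by
  have hn : (0 : ℝ≥0) < n + 1 := by positivity
  have hmem := mem_iff_entranceTime_le hr hC ha h
  set σ := entranceTime C w with hσ
  -- `m` indexes the last grid point strictly before the entrance time.
  obtain ⟨m, hm⟩ : ∃ m, ⌈σ * (n + 1)⌉₊ = m + 1 :=
    Nat.exists_eq_succ_of_ne_zero (Nat.ceil_pos.2 (by positivity)).ne'
  have hm1 : σ ≤ (m + 1) / (n + 1) := by
    rw [le_div_iff₀ hn]
    exact_mod_cast hm ▸ Nat.le_ceil (σ * (n + 1))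
  have hm2 : (m : ℝ≥0) / (n + 1) < σ := by
    rw [div_lt_iff₀ hn]
    exact Nat.lt_ceil.1 (by omega)
  rw [gridSum, hg _ (fun h0 => hpos.not_ge ((hmem 0).1 h0)), zero_add, tsum_eq_single m]
  · rw [indicator_of_mem, Pi.one_apply, one_mul, ← add_div, hm]
    · push_cast; rfl
    · exact fun h0 => hm2.not_ge ((hmem _).1 h0)
  · intro k hk
    rcases lt_or_gt_of_ne hk with hk | hk
    · rw [hg, mul_zero]
      intro h0
      rw [hmem, ← add_div] at h0
      refine hm2.not_ge (h0.trans ?_)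
      gcongr
      exact_mod_cast hk
    · rw [indicator_of_notMem, zero_mul]
      rw [notMem_compl_iff, hmem]
      refine hm1.trans ?_
      gcongr
      exact_mod_cast hk

theorem gridSum_of_mem_zero (ha : ∀ s t, s ≤ t → w s ∈ C → w t ∈ C) {g : T → ℝ≥0∞}
    (h : w 0 ∈ C) (n : ℕ) : gridSum n C g w = g (w 0) := by
  have : ∀ t, w t ∈ C := fun t => ha 0 t zero_le h
  simp [gridSum, this]

theorem gridSum_of_forall_notMem {g : T → ℝ≥0∞} (hg : ∀ x ∉ C, g x = 0) (h : ¬ ∃ t, w t ∈ C)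
    (n : ℕ) : gridSum n C g w = 0 := by
  have : ∀ t, g (w t) = 0 := fun t => hg _ fun ht => h ⟨t, ht⟩
  simp [gridSum, this]

theorem gridSum_le_one (hr : ∀ t, ContinuousWithinAt w (Ici t) t) (hC : IsClosed C)
    (ha : ∀ s t, s ≤ t → w s ∈ C → w t ∈ C) {g : T → ℝ≥0∞}
    (hg : ∀ x ∉ C, g x = 0) (hg1 : ∀ x, g x ≤ 1) (n : ℕ) : gridSum n C g w ≤ 1 := by
  by_cases h : ∃ t, w t ∈ C
  · rcases (zero_le (a := entranceTime C w)).eq_or_lt with h0 | h0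
    · rw [gridSum_of_mem_zero ha (h0 ▸ mem_entranceTime hr hC h)]
      exact hg1 _
    · rw [gridSum_of_entranceTime_pos hr hC ha h hg h0]
      exact hg1 _
  · rw [gridSum_of_forall_notMem hg h]
    exact zero_le

/-- Grid times are rounded up, so they approach the entrance time from the right and right
continuity is enough. -/
theorem tendsto_gridSum (hr : ∀ t, ContinuousWithinAt w (Ici t) t) (hC : IsClosed C)
    (ha : ∀ s t, s ≤ t → w s ∈ C → w t ∈ C) {g : T → ℝ≥0∞} (hgc : Continuous g)
    (hg : ∀ x ∉ C, g x = 0) :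
    Tendsto (fun n => gridSum n C g w) atTop (𝓝 (entranceValue C g w)) := by
  by_cases h : ∃ t, w t ∈ C
  · rw [entranceValue, if_pos h]
    rcases (zero_le (a := entranceTime C w)).eq_or_lt with h0 | h0
    · simp only [gridSum_of_mem_zero ha (h0 ▸ mem_entranceTime hr hC h), ← h0]
      exact tendsto_const_nhds
    · simp only [gridSum_of_entranceTime_pos hr hC ha h hg h0]
      refine (hgc.tendsto _).comp ((hr _).tendsto.comp (tendsto_nhdsWithin_iff.2 ⟨?_, ?_⟩))
      · have h1 : Tendsto (fun n : ℕ => entranceTime C w + 1 / ((n : ℝ≥0) + 1)) atTop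
            (𝓝 (entranceTime C w)) := by
          have := (NNReal.tendsto_coe.1
            (by simpa using tendsto_one_div_add_atTop_nhds_zero_nat (𝕜 := ℝ)) :
            Tendsto (fun n : ℕ => 1 / ((n : ℝ≥0) + 1)) atTop (𝓝 0))
          simpa using this.const_add (entranceTime C w)
        refine tendsto_of_tendsto_of_tendsto_of_le_of_le tendsto_const_nhds h1
          (fun n => ?_) fun n => ?_
        · show _ ≤ _ / _
          rw [le_div_iff₀ (by positivity)]
          exact Nat.le_ceil _
        · have hn : (0 : ℝ≥0) < n + 1 := by positivity
          show _ / _ ≤ _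
          rw [div_le_iff₀ hn, add_mul, one_div, inv_mul_cancel₀ hn.ne']
          exact (Nat.ceil_lt_add_one zero_le).le
      · refine Eventually.of_forall fun n => ?_
        rw [mem_Ici, le_div_iff₀ (by positivity)]
        exact Nat.le_ceil _
  · rw [entranceValue, if_neg h]
    simp only [gridSum_of_forall_notMem hg h]
    exact tendsto_const_nhds

theorem entranceValue_shift (g : T → ℝ≥0∞) {a : ℝ≥0} (h : ∀ t < a, w t ∉ C) :
    entranceValue C g (fun t => w (a + t)) = entranceValue C g w := by
  have h1 : (∃ t, w (a + t) ∈ C) ↔ ∃ t, w t ∈ C := by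
    refine ⟨fun ⟨t, ht⟩ => ⟨_, ht⟩, fun ⟨t, ht⟩ => ⟨t - a, ?_⟩⟩
    rwa [add_tsub_cancel_of_le (not_lt.1 fun hlt => h t hlt ht)]
  by_cases hne : ∃ t, w t ∈ C
  · rw [entranceValue, if_pos (h1.2 hne), entranceValue, if_pos hne]
    congr 2
    have hne' : {t | w (a + t) ∈ C}.Nonempty := h1.2 hne
    refine le_antisymm (le_csInf hne fun t ht => ?_) ?_
    · have hat : a ≤ t := not_lt.1 fun hlt => h t hlt ht
      rw [← add_tsub_cancel_of_le hat]
      gcongr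
      refine csInf_le (OrderBot.bddBelow _) ?_
      show w (a + (t - a)) ∈ C
      rwa [add_tsub_cancel_of_le hat]
    · have hale : a ≤ entranceTime C w :=
        le_csInf hne fun t ht => not_lt.1 fun hlt => h t hlt ht
      rw [← tsub_le_iff_left]
      refine le_csInf hne' fun t ht => ?_
      rw [tsub_le_iff_left]
      exact csInf_le (OrderBot.bddBelow _) ht
  · rw [entranceValue, if_neg (mt h1.1 hne), entranceValue, if_neg hne]

end Path

/-! ### Hitting times of open sets, and absorbing clopen sets -/

namespace ProcessFamily

variable {S Ω : Type*} [MeasurableSpace Ω] {X : ProcessFamily S Ω}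
  [PseudoEMetricSpace S] [MeasurableSpace S] [BorelSpace S] {hX : X.IsStrongMarkov}

theorem hittingTime_lt_iff {U : Set (S ⊕ Unit)} {ω : Ω} {i : ℝ≥0∞} :
    X.hittingTime U ω < i ↔ ∃ t : ℝ≥0, (t : ℝ≥0∞) < i ∧ X.path t ω ∈ U := by
  simp only [hittingTime, iInf_lt_iff]
  exact ⟨fun ⟨t, h, h'⟩ => ⟨t, h', h⟩, fun ⟨t, h, h'⟩ => ⟨t, h', h⟩⟩

theorem notMem_of_lt_hittingTime {U : Set (S ⊕ Unit)} {ω : Ω} {t : ℝ≥0}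
    (h : (t : ℝ≥0∞) < X.hittingTime U ω) : X.path t ω ∉ U :=
  fun ht => h.not_ge (iInf₂_le t ht)

theorem measurableSet_filtration (hX : X.IsStrongMarkov) {s t : ℝ≥0} (hst : s ≤ t)
    {B : Set (S ⊕ Unit)} (hB : MeasurableSet B) :
    MeasurableSet[X.filtration hX.measurable t] (X.path s ⁻¹' B) := by
  have : MeasurableSpace.comap (X.path s) inferInstance ≤ X.filtration hX.measurable t :=
    le_iSup₂ (f := fun s (_ : s ≤ t) => MeasurableSpace.comap (X.path s) inferInstance) s hst
  exact this _ ⟨B, hB, rfl⟩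

/-- By right continuity an open set visited before time `i` is also visited at a rational time
before `i`. No completion of the filtration is needed. -/
theorem isStop_hittingTime (hX : X.IsStrongMarkov) {U : Set (S ⊕ Unit)} (hU : IsOpen U) :
    IsStop hX (X.hittingTime U) := by
  refine isStop_of_lt fun i => ?_
  have : {ω | X.hittingTime U ω < i} =
      ⋃ (q : ℚ) (_ : Real.toNNReal q < i), X.path (Real.toNNReal q) ⁻¹' U := by
    ext ω
    simp only [mem_ofPred_eq, hittingTime_lt_iff, mem_iUnion, mem_preimage, exists_prop,
      ENNReal.coe_lt_coe]
    constructor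
    · rintro ⟨t, hti, ht⟩
      obtain ⟨q, -, h1, h2⟩ := exists_rat_mem_of_rightCont (hX.rightCont ω t) hU ht hti
      exact ⟨q, h1, h2⟩
    · rintro ⟨q, h1, h2⟩
      exact ⟨_, h1, h2⟩
  rw [this]
  exact @MeasurableSet.iUnion _ _ (X.filtration hX.measurable i) _ _ fun q =>
    @MeasurableSet.iUnion _ _ (X.filtration hX.measurable i) _ _ fun hq =>
    measurableSet_filtration hX hq.le hU.measurableSet

/-- Started in `C`, the process never leaves `C`. -/
def NeverLeaves (X : ProcessFamily S Ω) (C : Set (S ⊕ Unit)) : Prop :=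
  ∀ x ∈ C, ∀ᵐ ω ∂X.law x, ∀ t, X.path t ω ∈ C

/-- `NeverLeaves` speaks only of starting points in `C`; the Markov property at rational times
extends it to the path after any visit to `C`. Both `C` and its complement are open, so right
continuity carries a violation at real times over to slightly later rational times. -/
theorem NeverLeaves.ae_mono {C : Set (S ⊕ Unit)} (h : X.NeverLeaves C) (hX : X.IsStrongMarkov)
    (hC : IsClopen C) (x : S ⊕ Unit) :
    ∀ᵐ ω ∂X.law x, ∀ s t, s ≤ t → X.path s ω ∈ C → X.path t ω ∈ C := by
  have hrat : ∀ᵐ ω ∂X.law x, ∀ s t : ℚ, X.path (Real.toNNReal s) ω ∈ C →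
      X.path (Real.toNNReal s + (Real.toNNReal t - Real.toNNReal s)) ω ∈ C := by
    refine ae_all_iff.2 fun s => ae_all_iff.2 fun t => ?_
    set r := Real.toNNReal s
    set r' := Real.toNNReal t - r
    set E : Set Ω := X.path r ⁻¹' C
    have hCm : MeasurableSet C := hC.isOpen.measurableSet
    have hu : Measurable (Cᶜ.indicator (1 : S ⊕ Unit → ℝ≥0∞)) :=
      measurable_one.indicator hCm.compl
    have hE : MeasurableSet[IsStoppingTime.measurableSpace (isStop_const hX r)] E := by
      have := (X.filtration hX.measurable).le_rightCont r _
        (measurableSet_filtration hX le_rfl hCm)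
      have e := IsStoppingTime.measurableSpace_const (X.filtration hX.measurable).rightCont r
      rw [← e] at this
      exact this
    have h1 := (isStop_const hX r).lintegral_path_add hE r' x
      (u := Cᶜ.indicator 1) fun m _ => hu.aemeasurable
    have h2 : ∀ ω ∈ E, X.trans r' (Cᶜ.indicator 1)
        (X.stateAt (fun _ => (r : ℝ≥0∞)) ω) = 0 := by
      intro ω hω
      refine (lintegral_eq_zero_iff (hu.comp (hX.measurable _))).2 ?_
      have : X.stateAt (fun _ => (r : ℝ≥0∞)) ω ∈ C := by
        rw [stateAt, ENNReal.toNNReal_coe]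
        exact hω
      filter_upwards [h _ this] with ω' hω'
      simp [hω' _]
    have hEm : MeasurableSet {ω | ω ∈ E ∧ (r : ℝ≥0∞) ≠ ⊤} := by
      simpa using hX.measurable r hCm
    have hpm : Measurable fun ω => Cᶜ.indicator (1 : S ⊕ Unit → ℝ≥0∞)
        (X.path (r + r') ω) := hu.comp (hX.measurable _)
    rw [setLIntegral_congr_fun hEm (fun ω hω => h2 ω hω.1), lintegral_zero] at h1
    simp only [ENNReal.toNNReal_coe] at h1
    rw [lintegral_eq_zero_iff hpm] at h1
    filter_upwards [ae_imp_of_ae_restrict h1] with ω hω hωE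
    by_contra hcon
    have := hω ⟨hωE, ENNReal.coe_ne_top⟩
    simp [indicator_of_mem (mem_compl hcon)] at this
  filter_upwards [hrat] with ω hω s t hst hs
  rcases hst.eq_or_lt with rfl | hlt
  · exact hs
  obtain ⟨q, -, hqt, hq⟩ := exists_rat_mem_of_rightCont (hX.rightCont ω s) hC.isOpen hs hlt
  by_contra hcon
  obtain ⟨p, htp, -, hp⟩ := exists_rat_mem_of_rightCont (hX.rightCont ω t) hC.isClosed.isOpen_compl
    hcon (lt_add_one t)
  have := hω q p hq
  rw [add_tsub_cancel_of_le (hqt.trans htp).le] at this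
  exact hp this

end ProcessFamily

/-! ### Entrance laws and the strong Markov property -/

namespace ProcessFamily

variable {S Ω : Type*} [MeasurableSpace Ω] {X : ProcessFamily S Ω}
  [PseudoEMetricSpace S] [MeasurableSpace S] [BorelSpace S] {hX : X.IsStrongMarkov}

theorem UnivMeasurable.trans (hX : X.IsStrongMarkov) {u : S ⊕ Unit → ℝ≥0∞}
    (hu : UnivMeasurable u) (t : ℝ≥0) : UnivMeasurable (X.trans t u) := by
  intro m hm
  have haem : ∀ B, MeasurableSet B → AEMeasurable (fun y => X.law y (X.path t ⁻¹' B)) m :=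
    fun B hB => hX.measurable_law t B hB m hm
  -- `m'` is `m P_t`; a Borel version of `u` under `m'` gives a Borel integrand whose image under
  -- `P_t` agrees with `P_t u` outside an `m`-null set.
  let m' : Measure (S ⊕ Unit) := Measure.ofMeasurable
    (fun B _ => ∫⁻ y, X.law y (X.path t ⁻¹' B) ∂m) (by simp) (by
      intro f hf hd
      rw [← lintegral_tsum fun i => haem _ (hf i)]
      congr 1
      ext y
      rw [preimage_iUnion, measure_iUnion]
      · exact fun i j hij => (hd hij).preimage _
      · exact fun i => hX.measurable t (hf i))
  have hm' : ∀ B, MeasurableSet B → m' B = ∫⁻ y, X.law y (X.path t ⁻¹' B) ∂m := fun B hB =>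
    Measure.ofMeasurable_apply B hB
  have hfin : IsFiniteMeasure m' := by
    refine ⟨?_⟩
    rw [hm' _ MeasurableSet.univ]
    have := fun y => (hX.prob y).measure_univ
    simp [this]
  obtain ⟨v, hv, huv⟩ := hu m' hfin
  obtain ⟨N, hN, hNm, hN0⟩ := exists_measurable_superset_of_null (ae_iff.1 huv)
  rw [hm' N hNm, lintegral_eq_zero_iff' (haem N hNm)] at hN0
  refine (hX.univMeasurable_trans t hv m hm).congr ?_
  filter_upwards [hN0] with y hy
  refine lintegral_congr_ae ?_
  refine measure_mono_null (fun ω' hω' => ?_) hy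
  exact hN fun h => hω' h.symm

theorem UnivMeasurable.mul {u v : S ⊕ Unit → ℝ≥0∞} (hu : UnivMeasurable u)
    (hv : UnivMeasurable v) : UnivMeasurable fun y => u y * v y :=
  fun m hm => (hu m hm).mul (hv m hm)

/-- The event `{X_τ ∉ C}` may be inserted into the Markov property if `C` is absorbing. -/
theorem IsStop.lintegral_indicator_mul {τ : Ω → ℝ≥0∞} (hτ : IsStop hX τ) {C : Set (S ⊕ Unit)}
    (hC : IsClopen C) (habs : X.NeverLeaves C) {g : S ⊕ Unit → ℝ≥0∞} (hg : Measurable g)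
    (t : ℝ≥0) (x : S ⊕ Unit) :
    ∫⁻ ω in {ω | τ ω ≠ ⊤}, Cᶜ.indicator 1 (X.stateAt τ ω) *
        g (X.path ((τ ω).toNNReal + t) ω) ∂X.law x =
      ∫⁻ ω in {ω | τ ω ≠ ⊤}, Cᶜ.indicator 1 (X.stateAt τ ω) *
        X.trans t g (X.stateAt τ ω) ∂X.law x := by
  have hσ := isStop_hittingTime hX hC.isOpen
  -- `E` replaces `{X_τ ∉ C}`: it belongs to the σ-algebra of `τ` by comparison of two stopping
  -- times, and on `{τ < ∞}` it agrees almost surely with `{X_τ ∉ C}`, because `C` is absorbing and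
  -- is entered at its entrance time.
  set E : Set Ω := {ω | X.hittingTime C ω ≤ τ ω}ᶜ with hE
  have hEτ : MeasurableSet[IsStoppingTime.measurableSpace hτ] E :=
    @MeasurableSet.compl _ _ (IsStoppingTime.measurableSpace hτ)
      (IsStoppingTime.measurableSet_stopping_time_le hσ hτ)
  have hEm : MeasurableSet E := IsStoppingTime.measurableSpace_le hτ _ hEτ
  have hDm : MeasurableSet {ω | τ ω ≠ ⊤} := hτ.measurable (measurableSet_singleton _).compl
  have hiff : ∀ᵐ ω ∂X.law x, τ ω ≠ ⊤ → (X.stateAt τ ω ∈ C ↔ ω ∉ E) := by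
    filter_upwards [habs.ae_mono hX hC x] with ω hω hne
    simp only [hE, notMem_compl_iff, mem_ofPred_eq, stateAt]
    constructor
    · intro h
      have h1 : X.hittingTime C ω ≤ ((τ ω).toNNReal : ℝ≥0∞) := iInf₂_le (τ ω).toNNReal h
      rwa [ENNReal.coe_toNNReal hne] at h1
    · intro h
      have h1 : ∃ t, X.path t ω ∈ C := by
        obtain ⟨t, -, ht⟩ := hittingTime_lt_iff.1 (h.trans_lt hne.lt_top)
        exact ⟨t, ht⟩
      rw [mem_iff_entranceTime_le (w := fun t => X.path t ω) (hX.rightCont ω) hC.isClosed hω h1,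
        ← ENNReal.coe_le_coe, ENNReal.coe_toNNReal hne]
      refine le_trans (le_iInf₂ fun t ht => ?_) h
      exact ENNReal.coe_le_coe.2 (csInf_le (OrderBot.bddBelow _) ht)
  have key : ∀ f : Ω → ℝ≥0∞, ∫⁻ ω in {ω | τ ω ≠ ⊤}, Cᶜ.indicator 1 (X.stateAt τ ω) * f ω ∂X.law x
      = ∫⁻ ω in {ω | ω ∈ E ∧ τ ω ≠ ⊤}, f ω ∂X.law x := by
    intro f
    have : {ω | ω ∈ E ∧ τ ω ≠ ⊤} = E ∩ {ω | τ ω ≠ ⊤} := rfl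
    rw [this, ← setLIntegral_indicator hEm]
    refine setLIntegral_congr_fun_ae hDm ?_
    filter_upwards [hiff] with ω hω hne
    by_cases h : ω ∈ E
    · have h' : X.stateAt τ ω ∈ Cᶜ := fun h' => (hω hne).1 h' h
      simp [h, h']
    · have h' : X.stateAt τ ω ∉ Cᶜ := notMem_compl_iff.2 ((hω hne).2 h)
      rw [indicator_of_notMem h, indicator_of_notMem h', zero_mul]
  rw [key, key]
  exact hτ.lintegral_path_add hEτ t x fun m _ => hg.aemeasurable

/-- The mean of `g` at time `s + t`, on the event that the process is outside `C` at time `s`. -/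
def twoStep (X : ProcessFamily S Ω) (C : Set (S ⊕ Unit)) (g : S ⊕ Unit → ℝ≥0∞) (s t : ℝ≥0)
    (y : S ⊕ Unit) : ℝ≥0∞ :=
  ∫⁻ ω, Cᶜ.indicator 1 (X.path s ω) * g (X.path (s + t) ω) ∂X.law y

theorem twoStep_eq_trans (hX : X.IsStrongMarkov) {C : Set (S ⊕ Unit)}
    (hC : IsClopen C) (habs : X.NeverLeaves C) {g : S ⊕ Unit → ℝ≥0∞} (hg : Measurable g)
    (s t : ℝ≥0) : X.twoStep C g s t = X.trans s fun y => Cᶜ.indicator 1 y * X.trans t g y := by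
  ext y
  have := (isStop_const hX s).lintegral_indicator_mul hC habs hg t y
  simpa [stateAt, twoStep, ProcessFamily.trans] using this

theorem univMeasurable_indicator_mul_trans (hX : X.IsStrongMarkov) {C : Set (S ⊕ Unit)}
    (hC : IsClopen C) {g : S ⊕ Unit → ℝ≥0∞} (hg : Measurable g) (t : ℝ≥0) :
    UnivMeasurable fun y => Cᶜ.indicator 1 y * X.trans t g y :=
  UnivMeasurable.mul (fun _ _ => (measurable_one.indicator
    hC.isClosed.isOpen_compl.measurableSet).aemeasurable) (hX.univMeasurable_trans t hg)

theorem univMeasurable_twoStep (hX : X.IsStrongMarkov) {C : Set (S ⊕ Unit)}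
    (hC : IsClopen C) (habs : X.NeverLeaves C) {g : S ⊕ Unit → ℝ≥0∞} (hg : Measurable g)
    (s t : ℝ≥0) : UnivMeasurable (X.twoStep C g s t) := by
  rw [twoStep_eq_trans hX hC habs hg]
  exact UnivMeasurable.trans hX (univMeasurable_indicator_mul_trans hX hC hg t) s

/-- Both sides equal the mean of `1_{Cᶜ} P_t g` at `X_{τ+s}`: the left one by the Markov property at
the stopping time `τ + s`, the right one by the Markov property at `τ`. -/
theorem IsStop.lintegral_twoStep {τ : Ω → ℝ≥0∞} (hτ : IsStop hX τ) {C : Set (S ⊕ Unit)}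
    (hC : IsClopen C) (habs : X.NeverLeaves C) {g : S ⊕ Unit → ℝ≥0∞} (hg : Measurable g)
    (s t : ℝ≥0) (x : S ⊕ Unit) :
    ∫⁻ ω in {ω | τ ω ≠ ⊤}, Cᶜ.indicator 1 (X.path ((τ ω).toNNReal + s) ω) *
        g (X.path ((τ ω).toNNReal + (s + t)) ω) ∂X.law x =
      ∫⁻ ω in {ω | τ ω ≠ ⊤}, X.twoStep C g s t (X.stateAt τ ω) ∂X.law x := by
  have hDm : MeasurableSet {ω | τ ω ≠ ⊤} := hτ.measurable (measurableSet_singleton _).compl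
  have h1 := (hτ.add_const s).lintegral_indicator_mul hC habs hg t x
  have hD : {ω | τ ω + s ≠ ⊤} = {ω | τ ω ≠ ⊤} := by
    ext ω
    simp
  have hst : ∀ ω, τ ω ≠ ⊤ → (τ ω + s).toNNReal = (τ ω).toNNReal + s := fun ω hω => by
    rw [ENNReal.toNNReal_add hω ENNReal.coe_ne_top, ENNReal.toNNReal_coe]
  have h2 := hτ.lintegral_path_add (E := univ)
    (@MeasurableSet.univ _ (IsStoppingTime.measurableSpace hτ)) s x
    (univMeasurable_indicator_mul_trans hX hC hg t)
  simp only [mem_univ, true_and] at h2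
  rw [hD] at h1
  rw [twoStep_eq_trans hX hC habs hg, ← h2]
  refine Eq.trans (setLIntegral_congr_fun hDm fun ω hω => ?_)
    (h1.trans (setLIntegral_congr_fun hDm fun ω hω => ?_))
  · simp only [stateAt, hst ω hω, add_assoc]
  · simp only [stateAt, hst ω hω]

/-- The continuous functions with values in `[0, 1]` that vanish outside `C`. -/
structure IsTest (C : Set (S ⊕ Unit)) (g : S ⊕ Unit → ℝ≥0∞) : Prop where
  continuous : Continuous g
  eq_zero : ∀ x ∉ C, g x = 0
  le_one : ∀ x, g x ≤ 1

/-- The mean of `g` at the first entrance into `C`. -/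
def entranceMean (X : ProcessFamily S Ω) (C : Set (S ⊕ Unit)) (g : S ⊕ Unit → ℝ≥0∞)
    (x : S ⊕ Unit) : ℝ≥0∞ :=
  ∫⁻ ω, entranceValue C g (fun t => X.path t ω) ∂X.law x

/-- The mean of the approximation of `g` at the first entrance into `C`. -/
def gridMean (X : ProcessFamily S Ω) (n : ℕ) (C : Set (S ⊕ Unit)) (g : S ⊕ Unit → ℝ≥0∞)
    (x : S ⊕ Unit) : ℝ≥0∞ :=
  X.trans 0 g x + ∑' k : ℕ, X.twoStep C g (k / (n + 1)) (1 / (n + 1)) x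

theorem measurable_gridSum (hX : X.IsStrongMarkov) {t : Ω → ℝ≥0} (ht : Measurable t) (n : ℕ)
    {C : Set (S ⊕ Unit)} (hC : IsClopen C) {g : S ⊕ Unit → ℝ≥0∞} (hg : Measurable g) :
    Measurable fun ω => gridSum n C g fun s => X.path (t ω + s) ω := by
  have hp : ∀ s, Measurable fun ω => X.path (t ω + s) ω := fun s =>
    hX.measurable_path_comp (ht.add_const s)
  refine (hg.comp (hp 0)).add (Measurable.tsum fun k => ?_)
  exact ((measurable_one.indicator hC.isClosed.isOpen_compl.measurableSet).comp (hp _)).mul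
    (hg.comp (hp _))

theorem IsStop.lintegral_gridSum {τ : Ω → ℝ≥0∞} (hτ : IsStop hX τ) {C : Set (S ⊕ Unit)}
    (hC : IsClopen C) (habs : X.NeverLeaves C) {g : S ⊕ Unit → ℝ≥0∞} (hg : Measurable g)
    (n : ℕ) (x : S ⊕ Unit) :
    ∫⁻ ω in {ω | τ ω ≠ ⊤}, gridSum n C g (fun t => X.path ((τ ω).toNNReal + t) ω) ∂X.law x =
      ∫⁻ ω in {ω | τ ω ≠ ⊤}, X.gridMean n C g (X.stateAt τ ω) ∂X.law x := by
  have := hX.prob x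
  have ht : Measurable fun ω => (τ ω).toNNReal := ENNReal.measurable_toNNReal.comp hτ.measurable
  have hp : ∀ s, Measurable fun ω => X.path ((τ ω).toNNReal + s) ω := fun s =>
    hX.measurable_path_comp (ht.add_const s)
  have haem : ∀ w, UnivMeasurable w → AEMeasurable (fun ω => w (X.stateAt τ ω))
      ((X.law x).restrict {ω | τ ω ≠ ⊤}) := fun w hw =>
    (hw _ inferInstance).comp_measurable hτ.measurable_stateAt
  have hg0 : Measurable fun ω => g (X.path ((τ ω).toNNReal + 0) ω) := hg.comp (hp 0)
  have hk : ∀ k : ℕ, Measurable fun ω =>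
      Cᶜ.indicator (1 : S ⊕ Unit → ℝ≥0∞) (X.path ((τ ω).toNNReal + k / (n + 1)) ω) *
        g (X.path ((τ ω).toNNReal + (k / (n + 1) + 1 / (n + 1))) ω) := fun k =>
    ((measurable_one.indicator hC.isClosed.isOpen_compl.measurableSet).comp (hp _)).mul
      (hg.comp (hp _))
  have h2 := hτ.lintegral_path_add (E := univ)
    (@MeasurableSet.univ _ (IsStoppingTime.measurableSpace hτ)) 0 x
    (u := g) fun m _ => hg.aemeasurable
  simp only [mem_univ, true_and] at h2
  simp only [gridSum, gridMean]
  rw [lintegral_add_left hg0, lintegral_tsum fun k => (hk k).aemeasurable,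
    lintegral_add_left' (haem _ (hX.univMeasurable_trans 0 hg)),
    lintegral_tsum fun k => haem _ (univMeasurable_twoStep hX hC habs hg _ _), h2]
  congr 1
  exact tsum_congr fun k => hτ.lintegral_twoStep hC habs hg _ _ x

theorem gridMean_eq (hX : X.IsStrongMarkov) {C : Set (S ⊕ Unit)}
    (hC : IsClopen C) {g : S ⊕ Unit → ℝ≥0∞} (hg : Measurable g)
    (n : ℕ) (y : S ⊕ Unit) :
    X.gridMean n C g y = ∫⁻ ω, gridSum n C g (fun t => X.path t ω) ∂X.law y := by
  have hg0 : Measurable fun ω => g (X.path 0 ω) := hg.comp (hX.measurable 0)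
  simp only [gridSum]
  rw [lintegral_add_left hg0, lintegral_tsum]
  · rfl
  · exact fun k => (((measurable_one.indicator hC.isClosed.isOpen_compl.measurableSet).comp
      (hX.measurable _)).mul (hg.comp (hX.measurable _))).aemeasurable

theorem tendsto_gridMean (hX : X.IsStrongMarkov) {C : Set (S ⊕ Unit)}
    (hC : IsClopen C) (habs : X.NeverLeaves C) {g : S ⊕ Unit → ℝ≥0∞} (hg : IsTest C g)
    (y : S ⊕ Unit) :
    Tendsto (fun n => X.gridMean n C g y) atTop (𝓝 (X.entranceMean C g y)) := by
  have := hX.prob y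
  simp only [gridMean_eq hX hC hg.continuous.measurable]
  refine tendsto_lintegral_of_dominated_convergence (fun _ => 1) (fun n => ?_) (fun n => ?_)
    (by simp) ?_
  · simpa using measurable_gridSum hX (measurable_const (a := 0)) n hC hg.continuous.measurable
  · filter_upwards [habs.ae_mono hX hC y] with ω hω
    exact gridSum_le_one (hX.rightCont ω) hC.isClosed hω hg.eq_zero hg.le_one n
  · filter_upwards [habs.ae_mono hX hC y] with ω hω
    exact tendsto_gridSum (hX.rightCont ω) hC.isClosed hω hg.continuous hg.eq_zero

theorem gridMean_le_one (hX : X.IsStrongMarkov) {C : Set (S ⊕ Unit)}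
    (hC : IsClopen C) (habs : X.NeverLeaves C) {g : S ⊕ Unit → ℝ≥0∞} (hg : IsTest C g)
    (n : ℕ) (y : S ⊕ Unit) : X.gridMean n C g y ≤ 1 := by
  have := hX.prob y
  rw [gridMean_eq hX hC hg.continuous.measurable]
  calc _ ≤ ∫⁻ _, 1 ∂X.law y := by
        refine lintegral_mono_ae ?_
        filter_upwards [habs.ae_mono hX hC y] with ω hω
        exact gridSum_le_one (hX.rightCont ω) hC.isClosed hω hg.eq_zero hg.le_one n
    _ = 1 := by simp

theorem entranceMean_le_one (hX : X.IsStrongMarkov) {C : Set (S ⊕ Unit)}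
    (hC : IsClopen C) (habs : X.NeverLeaves C) {g : S ⊕ Unit → ℝ≥0∞} (hg : IsTest C g)
    (y : S ⊕ Unit) : X.entranceMean C g y ≤ 1 :=
  le_of_tendsto' (tendsto_gridMean hX hC habs hg y) fun n => gridMean_le_one hX hC habs hg n y

theorem univMeasurable_gridMean (hX : X.IsStrongMarkov) {C : Set (S ⊕ Unit)}
    (hC : IsClopen C) (habs : X.NeverLeaves C) {g : S ⊕ Unit → ℝ≥0∞} (hg : Measurable g)
    (n : ℕ) : UnivMeasurable (X.gridMean n C g) := fun m hm =>
  (hX.univMeasurable_trans 0 hg m hm).add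
    (AEMeasurable.tsum fun _ => univMeasurable_twoStep hX hC habs hg _ _ m hm)

theorem univMeasurable_entranceMean (hX : X.IsStrongMarkov) {C : Set (S ⊕ Unit)}
    (hC : IsClopen C) (habs : X.NeverLeaves C) {g : S ⊕ Unit → ℝ≥0∞} (hg : IsTest C g) :
    UnivMeasurable (X.entranceMean C g) := fun m hm =>
  aemeasurable_of_tendsto_metrizable_ae'
    (fun n => univMeasurable_gridMean hX hC habs hg.continuous.measurable n m hm)
    (Eventually.of_forall fun y => tendsto_gridMean hX hC habs hg y)

/-- The strong Markov property for the position of the first entrance into an absorbing clopen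
set. -/
theorem IsStop.entranceMean_eq {τ : Ω → ℝ≥0∞} (hτ : IsStop hX τ) {C : Set (S ⊕ Unit)}
    (hC : IsClopen C) (habs : X.NeverLeaves C) {g : S ⊕ Unit → ℝ≥0∞} (hg : IsTest C g)
    (x : S ⊕ Unit) (hle : ∀ᵐ ω ∂X.law x, ∀ t : ℝ≥0, (t : ℝ≥0∞) < τ ω → X.path t ω ∉ C) :
    X.entranceMean C g x =
      ∫⁻ ω in {ω | τ ω ≠ ⊤}, X.entranceMean C g (X.stateAt τ ω) ∂X.law x := by
  have := hX.prob x
  have hDm : MeasurableSet {ω | τ ω ≠ ⊤} := hτ.measurable (measurableSet_singleton _).compl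
  have ht : Measurable fun ω => (τ ω).toNNReal := ENNReal.measurable_toNNReal.comp hτ.measurable
  have hae := ae_restrict_of_ae (s := {ω | τ ω ≠ ⊤}) (habs.ae_mono hX hC x)
  -- There is no entrance before `τ`. On `{τ = ∞}` the set `C` is then never entered and the value
  -- is `0`; elsewhere the path after `τ` has the same entrance position.
  have h1 : X.entranceMean C g x = ∫⁻ ω in {ω | τ ω ≠ ⊤},
      entranceValue C g (fun t => X.path ((τ ω).toNNReal + t) ω) ∂X.law x := by
    rw [entranceMean, ← lintegral_indicator hDm]
    refine lintegral_congr_ae ?_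
    filter_upwards [hle] with ω hω
    by_cases h : τ ω = ⊤
    · rw [indicator_of_notMem (by simpa using h), entranceValue, if_neg]
      rintro ⟨t, ht⟩
      exact hω t (h ▸ ENNReal.coe_lt_top) ht
    · rw [indicator_of_mem (by simpa using h)]
      refine (entranceValue_shift (w := fun t => X.path t ω) g fun t ht => hω t ?_).symm
      rw [← ENNReal.coe_toNNReal h]
      exact_mod_cast ht
  have h2 : Tendsto (fun n => ∫⁻ ω in {ω | τ ω ≠ ⊤},
      gridSum n C g (fun t => X.path ((τ ω).toNNReal + t) ω) ∂X.law x) atTop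
      (𝓝 (X.entranceMean C g x)) := by
    rw [h1]
    have hgood : ∀ᵐ ω ∂(X.law x).restrict {ω | τ ω ≠ ⊤},
        (∀ t, ContinuousWithinAt (fun t => X.path ((τ ω).toNNReal + t) ω) (Ici t) t) ∧
        ∀ s t, s ≤ t → X.path ((τ ω).toNNReal + s) ω ∈ C →
          X.path ((τ ω).toNNReal + t) ω ∈ C := by
      filter_upwards [hae] with ω hω
      refine ⟨fun t => ?_, fun s t hst => hω _ _ (by gcongr)⟩
      refine (hX.rightCont ω _).comp (f := fun t => (τ ω).toNNReal + t)
        (by fun_prop) fun s hs => ?_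
      exact add_le_add_right (mem_Ici.1 hs) _
    refine tendsto_lintegral_of_dominated_convergence (fun _ => 1)
      (fun n => measurable_gridSum hX ht n hC hg.continuous.measurable) (fun n => ?_)
      (by simp) ?_
    · filter_upwards [hgood] with ω hω
      exact gridSum_le_one hω.1 hC.isClosed hω.2 hg.eq_zero hg.le_one n
    · filter_upwards [hgood] with ω hω
      exact tendsto_gridSum hω.1 hC.isClosed hω.2 hg.continuous hg.eq_zero
  -- The same sequence is now evaluated after conditioning at `τ`; dominated convergence identifies
  -- its limit with the right-hand side.
  refine tendsto_nhds_unique h2 ?_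
  simp only [hτ.lintegral_gridSum hC habs hg.continuous.measurable]
  refine tendsto_lintegral_of_dominated_convergence' (fun _ => 1) (fun n => ?_) (fun n => ?_)
    (by simp) ?_
  · exact (univMeasurable_gridMean hX hC habs hg.continuous.measurable n _
      inferInstance).comp_measurable hτ.measurable_stateAt
  · exact Eventually.of_forall fun ω => gridMean_le_one hX hC habs hg n _
  · exact Eventually.of_forall fun ω => tendsto_gridMean hX hC habs hg _

theorem entranceMean_of_mem (hX : X.IsStrongMarkov) {C : Set (S ⊕ Unit)} {g : S ⊕ Unit → ℝ≥0∞}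
    {x : S ⊕ Unit} (hx : x ∈ C) : X.entranceMean C g x = g x := by
  have := hX.prob x
  rw [entranceMean, lintegral_congr_ae (g := fun _ => g x), lintegral_const, measure_univ, mul_one]
  filter_upwards [hX.normal x] with ω hω
  have h0 : X.path 0 ω ∈ C := hω ▸ hx
  have : entranceTime C (fun t => X.path t ω) = 0 :=
    le_antisymm (csInf_le (OrderBot.bddBelow _) h0) zero_le
  rw [entranceValue, if_pos ⟨0, h0⟩, this, hω]

theorem entranceMean_inr (hX : X.IsStrongMarkov) {C : Set (S ⊕ Unit)} {g : S ⊕ Unit → ℝ≥0∞}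
    (hC : Sum.inr () ∉ C) : X.entranceMean C g (Sum.inr ()) = 0 := by
  rw [entranceMean, lintegral_congr_ae (g := fun _ => 0), lintegral_zero]
  filter_upwards [hX.normal (Sum.inr ()), hX.cemetery (Sum.inr ())] with ω hω hc
  rw [entranceValue, if_neg]
  rintro ⟨t, ht⟩
  rw [hc 0 t zero_le hω] at ht
  exact hC ht

end ProcessFamily

theorem iInf_eq_entranceTime {T : Type*} {C : Set T} {w : ℝ≥0 → T} (h : ∃ t, w t ∈ C) :
    ⨅ (t : ℝ≥0) (_ : w t ∈ C), (t : ℝ≥0∞) = entranceTime C w := by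
  refine le_antisymm (ENNReal.le_of_forall_pos_le_add fun ε hε _ => ?_)
    (le_iInf₂ fun t ht => ENNReal.coe_le_coe.2 (csInf_le (OrderBot.bddBelow _) ht))
  obtain ⟨t, ht, hlt⟩ := exists_lt_of_csInf_lt (s := {t | w t ∈ C}) h
    (lt_add_of_pos_right (entranceTime C w) hε)
  exact (iInf₂_le t ht).trans (by exact_mod_cast hlt.le)

/-! ### Depth functions of edges, and Brownian paths leaving an edge -/

namespace MetricGraph

variable {V E I Ω : Type*} [MeasurableSpace Ω] {G : MetricGraph V E I}

/-- The distance is an infimum of chain lengths whose steps lie in closed edges, so an estimate on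
each edge sums up by the triangle inequality. -/
theorem lipschitzWith_of_param {φ : G.Point → ℝ} (h : ∀ l, ∀ s ∈ G.dom l, ∀ t ∈ G.dom l,
    |φ (G.param l s) - φ (G.param l t)| ≤ |s - t|) : LipschitzWith 1 φ := by
  have hseg : ∀ g g', edist (φ g) (φ g') ≤ G.segDist g g' := by
    intro g g'
    refine le_inf (le_iInf fun hgg => by simp [hgg]) ?_
    refine le_iInf fun l => le_iInf fun s => le_iInf fun t => le_iInf fun ⟨hs, ht, hg, hg'⟩ => ?_
    rw [edist_dist, Real.dist_eq, ← hg, ← hg']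
    exact ENNReal.ofReal_le_ofReal (h l s hs t ht)
  intro g g'
  rw [ENNReal.coe_one, one_mul]
  refine le_iInf fun c => ?_
  induction c generalizing g with
  | nil => exact hseg g g'
  | cons p c ih => exact (edist_triangle _ (φ p) _).trans (add_le_add (hseg g p) (ih p))

/-- The distance of the parameter `s` on the edge `l` to the end points of the edge. -/
def depthParam (G : MetricGraph V E I) : G.Edge → ℝ → ℝ
  | .inl _, s => s
  | .inr i, s => min s (G.len i - s)

open Classical in
/-- The distance of a point on the edge `l` to the end points of the edge, extended by `0`. -/
def depth (G : MetricGraph V E I) : G.Edge → G.Point → ℝ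
  | .inl e, .ext e' x _ => if e' = e then x else 0
  | .inr i, .int i' x _ _ => if i' = i then min x (G.len i - x) else 0
  | _, _ => 0

theorem depth_param_self (l : G.Edge) {s : ℝ} (hs : s ∈ G.dom l) :
    G.depth l (G.param l s) = G.depthParam l s := by
  rcases l with e | i
  · rcases (mem_Ici.1 hs).eq_or_lt with h | h
    · simp [param, depth, depthParam, ← h]
    · simp [param, depth, depthParam, h]
  · rcases hs.1.eq_or_lt with h | h
    · simp [param, depth, depthParam, ← h, (G.len_pos i).le]
    · rcases hs.2.eq_or_lt with h' | h'
      · simp [param, depth, depthParam, h', (G.len_pos i).le, G.len_pos i]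
      · simp [param, depth, depthParam, h, h']

theorem depth_param_of_ne {l l' : G.Edge} (h : l' ≠ l) (s : ℝ) :
    G.depth l (G.param l' s) = 0 := by
  rcases l with e | i <;> rcases l' with e' | i' <;> simp only [param] <;> split_ifs <;>
    simp_all [depth]

theorem depth_vertex (l : G.Edge) (v : V) : G.depth l (.vertex v) = 0 := by
  rcases l with e | i <;> rfl

theorem abs_depthParam_sub_le (l : G.Edge) (s t : ℝ) :
    |G.depthParam l s - G.depthParam l t| ≤ |s - t| := by
  rcases l with e | i
  · exact le_rfl
  · refine (abs_min_sub_min_le_max _ _ _ _).trans (max_le le_rfl ?_)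
    rw [sub_sub_sub_cancel_left, abs_sub_comm]

theorem lipschitzWith_depth (l : G.Edge) : LipschitzWith 1 (G.depth l) := by
  refine lipschitzWith_of_param fun l' s hs t ht => ?_
  by_cases h : l' = l
  · subst h
    rw [depth_param_self _ hs, depth_param_self _ ht]
    exact abs_depthParam_sub_le _ _ _
  · rw [depth_param_of_ne h, depth_param_of_ne h, sub_self, abs_zero]
    exact abs_nonneg _

theorem continuous_depthParam (l : G.Edge) : Continuous (G.depthParam l) := by
  rcases l with e | i
  · exact continuous_id
  · exact continuous_id.min (continuous_const.sub continuous_id)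

theorem depthParam_pos {l : G.Edge} {s : ℝ} : 0 < G.depthParam l s ↔ s ∈ G.openDom l := by
  rcases l with e | i
  · rfl
  · simp [depthParam, openDom]

theorem openDom_subset_dom (l : G.Edge) : G.openDom l ⊆ G.dom l := by
  rcases l with e | i
  · exact Ioi_subset_Ici_self
  · exact Ioo_subset_Icc_self

theorem isOpen_openDom (l : G.Edge) : IsOpen (G.openDom l) := by
  rcases l with e | i
  · exact isOpen_Ioi
  · exact isOpen_Ioo

theorem depth_pos_iff {l : G.Edge} {g : G.Point} : 0 < G.depth l g ↔ g ∈ G.openEdge l := by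
  constructor
  · intro h
    rcases exists_param_eq g with ⟨v, rfl⟩ | ⟨l', s, hs, rfl⟩
    · exact absurd h (by simp [depth_vertex])
    · by_cases hl : l' = l
      · exact hl ▸ mem_image_of_mem _ hs
      · exact absurd h (by simp [depth_param_of_ne hl])
  · rintro ⟨s, hs, rfl⟩
    rw [depth_param_self l (openDom_subset_dom l hs)]
    exact depthParam_pos.2 hs

theorem depth_nonneg (l : G.Edge) (g : G.Point) : 0 ≤ G.depth l g := by
  rcases exists_param_eq g with ⟨v, rfl⟩ | ⟨l', s, hs, rfl⟩
  · exact (depth_vertex l v).ge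
  · by_cases hl : l' = l
    · exact (depth_pos_iff.2 (hl ▸ mem_image_of_mem _ hs)).le
    · exact (depth_param_of_ne hl s).ge

theorem param_of_notMem_openDom {l : G.Edge} {s : ℝ} (hs : s ∉ G.openDom l) :
    ∃ v, G.param l s = .vertex v := by
  rcases l with e | i
  · exact ⟨_, dif_neg fun h : 0 < s => hs h⟩
  · simp only [param]
    split_ifs with h h'
    · exact absurd ⟨h, h'⟩ hs
    · exact ⟨_, rfl⟩
    · exact ⟨_, rfl⟩

/-- Describing the vertices by continuous functions makes the vertex set closed, hence Borel. -/
theorem range_vertex_eq : range (Point.vertex : V → G.Point) = ⋂ l, {g | G.depth l g ≤ 0} := by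
  ext g
  simp only [mem_range, mem_iInter, mem_ofPred_eq]
  constructor
  · rintro ⟨v, rfl⟩ l
    exact (depth_vertex l v).le
  · intro h
    rcases exists_param_eq g with ⟨v, rfl⟩ | ⟨l', s, hs, rfl⟩
    · exact ⟨v, rfl⟩
    · exact absurd (h l') (not_le.2 (depth_pos_iff.2 (mem_image_of_mem _ hs)))

theorem isClosed_range_vertex : IsClosed (range (Point.vertex : V → G.Point)) := by
  rw [range_vertex_eq]
  exact isClosed_iInter fun l => isClosed_le (lipschitzWith_depth l).continuous continuous_const

/-- `depth`, extended by `0` to the cemetery. -/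
def depthSum (G : MetricGraph V E I) (l : G.Edge) : G.Point ⊕ Unit → ℝ :=
  Sum.elim (G.depth l) fun _ => 0

theorem continuous_depthSum (l : G.Edge) : Continuous (G.depthSum l) :=
  (lipschitzWith_depth l).continuous.sumElim continuous_const

theorem mem_compl_openEdge_iff {l : G.Edge} {z : G.Point ⊕ Unit} :
    z ∈ (Sum.inl '' G.openEdge l : Set (G.Point ⊕ Unit))ᶜ ↔ G.depthSum l z ≤ 0 := by
  rcases z with g | u
  · simp only [mem_compl_iff, mem_image, Sum.inl.injEq, exists_eq_right, ← depth_pos_iff,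
      depthSum, Sum.elim_inl, not_lt]
  · simp [depthSum]

theorem isClosed_compl_openEdge (l : G.Edge) :
    IsClosed (Sum.inl '' G.openEdge l : Set (G.Point ⊕ Unit))ᶜ := by
  have : (Sum.inl '' G.openEdge l : Set (G.Point ⊕ Unit))ᶜ = {z | G.depthSum l z ≤ 0} :=
    Set.ext fun z => mem_compl_openEdge_iff
  rw [this]
  exact isClosed_le (continuous_depthSum l) continuous_const

/-- A continuous path that starts in `U` and is stopped at its exit from `U`. -/
theorem realStopped_cases {U : Set ℝ} (hU : IsOpen U) {b : ℝ≥0 → ℝ} (hb : Continuous b)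
    (t : ℝ≥0) : (∀ s ≤ t, b s ∈ U ∧ realStopped U b s = b s) ∨ realStopped U b t ∉ U := by
  by_cases h : ∃ s ≤ t, b s ∉ U
  · right
    obtain ⟨s, hst, hs⟩ := h
    have hex : ∃ s, b s ∈ Uᶜ := ⟨s, hs⟩
    have e : realExitTime U b = entranceTime Uᶜ b := iInf_eq_entranceTime (C := Uᶜ) hex
    have hle : entranceTime Uᶜ b ≤ t := (csInf_le (OrderBot.bddBelow _) hs).trans hst
    rw [realStopped, e, min_eq_right (ENNReal.coe_le_coe.2 hle), ENNReal.toNNReal_coe]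
    exact mem_entranceTime (fun _ => hb.continuousWithinAt) hU.isClosed_compl hex
  · left
    push Not at h
    refine fun s hs => ⟨h s hs, ?_⟩
    have : (s : ℝ≥0∞) ≤ realExitTime U b := by
      refine le_iInf₂ fun r hr => ?_
      by_contra hlt
      exact hr (h r ((ENNReal.coe_le_coe.1 (not_le.1 hlt).le).trans hs))
    rw [realStopped, min_eq_left this, ENNReal.toNNReal_coe]

/-- The paths, along rational times, that are at a vertex whenever they have come arbitrarily close
to the end points of the edge `l` before. -/
def EndsAtVertex (G : MetricGraph V E I) (l : G.Edge) (w : ℚ → G.Point ⊕ Unit) : Prop :=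
  ∀ t : ℚ, (∀ n : ℕ, ∃ q : ℚ, Real.toNNReal q < Real.toNNReal t ∧
    G.depthSum l (w q) < 1 / (n + 1)) → w t ∈ Sum.inl '' range (Point.vertex : V → G.Point)

theorem measurableSet_endsAtVertex (l : G.Edge) : MeasurableSet {w | G.EndsAtVertex l w} := by
  have hv : MeasurableSet (Sum.inl '' range (Point.vertex : V → G.Point) :
      Set (G.Point ⊕ Unit)) := isClosed_range_vertex.measurableSet.inl_image
  have h1 : ∀ (q : ℚ) (n : ℕ),
      MeasurableSet {w : ℚ → G.Point ⊕ Unit | G.depthSum l (w q) < 1 / (n + 1)} := fun q n =>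
    measurableSet_lt ((continuous_depthSum l).measurable.comp (measurable_pi_apply q))
      measurable_const
  have : {w | G.EndsAtVertex l w} = ⋂ t : ℚ, ((⋂ n : ℕ, ⋃ (q : ℚ)
      (_ : Real.toNNReal q < Real.toNNReal t), {w | G.depthSum l (w q) < 1 / (n + 1)})ᶜ ∪
      (fun w => w t) ⁻¹' (Sum.inl '' range (Point.vertex : V → G.Point))) := by
    ext w
    simp only [EndsAtVertex, mem_ofPred_eq, mem_iInter, mem_union, mem_compl_iff, mem_iUnion,
      mem_preimage, exists_prop, imp_iff_not_or]
  rw [this]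
  exact MeasurableSet.iInter fun t => ((MeasurableSet.iInter fun n => MeasurableSet.iUnion
    fun q => MeasurableSet.iUnion fun _ => h1 q n).compl).union (measurable_pi_apply t hv)

/-- If the path has stayed in the open interval up to time `t`, its depth has a positive minimum on
the compact `[0, t]`, so it did not come arbitrarily close to the ends. Otherwise it is stopped at a
parameter outside the open interval, which `param` sends to a vertex. -/
theorem endsAtVertex_realStopped (l : G.Edge) {b : ℝ≥0 → ℝ} (hb : Continuous b) :
    G.EndsAtVertex l fun q => Sum.inl (G.param l
      (realStopped (G.openDom l) b (Real.toNNReal q))) := by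
  intro t ht
  rcases realStopped_cases (isOpen_openDom l) hb (Real.toNNReal t) with h | h
  · exfalso
    have hc : ContinuousOn (fun s => G.depthParam l (b s)) (Icc 0 (Real.toNNReal t)) :=
      ((continuous_depthParam l).comp hb).continuousOn
    obtain ⟨s, hs, hmin⟩ := isCompact_Icc.exists_isMinOn ⟨0, le_rfl, zero_le⟩ hc
    obtain ⟨n, hn⟩ := exists_nat_one_div_lt (depthParam_pos.2 (h s hs.2).1)
    obtain ⟨q, hqt, hq⟩ := ht n
    have hq' := h _ hqt.le
    simp only [depthSum, Sum.elim_inl, hq'.2,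
      depth_param_self l (openDom_subset_dom l hq'.1)] at hq
    exact (hq.trans hn).not_ge (hmin ⟨zero_le, hqt.le⟩)
  · obtain ⟨v, hv⟩ := param_of_notMem_openDom h
    exact ⟨_, ⟨v, rfl⟩, congrArg Sum.inl hv.symm⟩

end MetricGraph

/-- Finite-dimensional distributions determine the law on a product, by uniqueness of projective
limits. Countably many times are used so that the path property to be transferred is a measurable
event; negative rationals all stand for time `0`. -/
theorem identDistrib_rat {T Ω Ω' : Type*} [MeasurableSpace T] [MeasurableSpace Ω]
    [MeasurableSpace Ω'] {P : Measure Ω} {Q : Measure Ω'} [IsProbabilityMeasure P]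
    {Y : ℝ≥0 → Ω → T} {Z : ℝ≥0 → Ω' → T}
    (h : ∀ J : Finset ℝ≥0, IdentDistrib (fun ω (t : J) => Y t ω) (fun ω (t : J) => Z t ω) P Q) :
    IdentDistrib (fun ω (q : ℚ) => Y (Real.toNNReal q) ω)
      (fun ω (q : ℚ) => Z (Real.toNNReal q) ω) P Q := by
  have hfin : ∀ K : Finset ℚ, IdentDistrib (fun ω => K.restrict fun q : ℚ => Y (Real.toNNReal q) ω)
      (fun ω => K.restrict fun q : ℚ => Z (Real.toNNReal q) ω) P Q := by
    intro K
    classical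
    let r : ℚ → ℝ≥0 := fun q => Real.toNNReal q
    let ρ : (↥(K.image r) → T) → (K → T) := fun f q =>
      f ⟨r q, Finset.mem_image_of_mem r q.2⟩
    have hρ : Measurable ρ := measurable_pi_lambda _ fun q => measurable_pi_apply _
    exact (h (K.image r)).comp hρ
  have hY : AEMeasurable (fun ω (q : ℚ) => Y (Real.toNNReal q) ω) P :=
    aemeasurable_pi_lambda _ fun q => (measurable_pi_apply
      (⟨q, Finset.mem_singleton_self q⟩ : ({q} : Finset ℚ))).comp_aemeasurable
        (hfin {q}).aemeasurable_fst
  have hZ : AEMeasurable (fun ω (q : ℚ) => Z (Real.toNNReal q) ω) Q :=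
    aemeasurable_pi_lambda _ fun q => (measurable_pi_apply
      (⟨q, Finset.mem_singleton_self q⟩ : ({q} : Finset ℚ))).comp_aemeasurable
        (hfin {q}).aemeasurable_snd
  refine ⟨hY, hZ, ?_⟩
  have h1 := isProjectiveLimit_map hY
  have h2 := isProjectiveLimit_map hZ
  have e : ∀ K : Finset ℚ, P.map (fun ω => K.restrict fun q : ℚ => Y (Real.toNNReal q) ω) =
      Q.map (fun ω => K.restrict fun q : ℚ => Z (Real.toNNReal q) ω) := fun K => (hfin K).map_eq
  simp_rw [← e] at h2
  exact h1.unique h2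

/-! ### Exit of a graph Brownian motion from an open edge -/

namespace MetricGraph

open ProcessFamily

variable {V E I Ω : Type*} [MeasurableSpace Ω] {G : MetricGraph V E I}
  {X : ProcessFamily G.Point Ω}

/-- The exit time from the open edge `l`. -/
def edgeExit (X : ProcessFamily G.Point Ω) (l : G.Edge) (ω : Ω) : ℝ≥0∞ :=
  ⨆ n : ℕ, X.hittingTime {z | G.depthSum l z < 1 / (n + 1)} ω

theorem isStop_edgeExit (hX : X.IsStrongMarkov) (l : G.Edge) : IsStop hX (edgeExit X l) :=
  IsStop.iSup fun _ => isStop_hittingTime hX (isOpen_lt (continuous_depthSum l) continuous_const)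

/-- `edgeExit` is a supremum of hitting times of open sets, hence a stopping time, but a priori only
a lower bound for the exit time. At a rational `t` beyond it, the stopped path has been arbitrarily
close to the ends at earlier rational times, so by hypothesis it is at a vertex at `t`; the exit has
then occurred by time `t`. Letting `t` decrease gives equality, and the stopped position at such a
`t` is the exit position. -/
theorem EndsAtVertex.edgeExit_eq (hX : X.IsStrongMarkov) {l : G.Edge} {ω : Ω}
    (h : G.EndsAtVertex l fun q =>
      X.stopped (Sum.inl '' G.openEdge l)ᶜ (Real.toNNReal q) ω) :
    edgeExit X l ω = X.hittingTime (Sum.inl '' G.openEdge l)ᶜ ω ∧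
      (edgeExit X l ω ≠ ⊤ →
        X.stateAt (edgeExit X l) ω ∈ Sum.inl '' range (Point.vertex : V → G.Point)) := by
  set C : Set (G.Point ⊕ Unit) := (Sum.inl '' G.openEdge l)ᶜ with hC
  have hsub : ∀ n : ℕ, C ⊆ {z | G.depthSum l z < 1 / (n + 1)} := fun n z hz =>
    (mem_compl_openEdge_iff.1 hz).trans_lt (by positivity)
  have hle : edgeExit X l ω ≤ X.hittingTime C ω :=
    iSup_le fun n => le_iInf₂ fun t ht => iInf₂_le t (hsub n ht)
  have hvC : Sum.inl '' range (Point.vertex : V → G.Point) ⊆ C := by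
    rintro _ ⟨_, ⟨v, rfl⟩, rfl⟩
    rw [hC, mem_compl_openEdge_iff]
    exact (depth_vertex l v).le
  have hstop1 : ∀ t : ℝ≥0, (t : ℝ≥0∞) ≤ X.hittingTime C ω → X.stopped C t ω = X.path t ω :=
    fun t ht => by rw [stopped, min_eq_left ht, ENNReal.toNNReal_coe]
  have hstop2 : ∀ t : ℝ≥0, X.hittingTime C ω < t → X.stopped C t ω ∈ C := by
    intro t ht
    obtain ⟨s, -, hs⟩ := hittingTime_lt_iff.1 ht
    have e : X.hittingTime C ω = entranceTime C fun t => X.path t ω :=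
      iInf_eq_entranceTime (w := fun t => X.path t ω) ⟨s, hs⟩
    rw [stopped, min_eq_right ht.le, e, ENNReal.toNNReal_coe]
    exact mem_entranceTime (w := fun t => X.path t ω) (hX.rightCont ω)
      (isClosed_compl_openEdge l) ⟨s, hs⟩
  have hmain : ∀ t : ℚ, edgeExit X l ω < Real.toNNReal t →
      X.stopped C (Real.toNNReal t) ω ∈ Sum.inl '' range (Point.vertex : V → G.Point) ∧
      X.hittingTime C ω ≤ Real.toNNReal t := by
    intro t ht
    have h1 : X.stopped C (Real.toNNReal t) ω ∈
        Sum.inl '' range (Point.vertex : V → G.Point) := by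
      refine h t fun n => ?_
      obtain ⟨s, hst, hs⟩ := hittingTime_lt_iff.1 ((le_iSup (fun n : ℕ => X.hittingTime
        {z | G.depthSum l z < 1 / (n + 1)} ω) n).trans_lt ht)
      obtain ⟨q, -, hqt, hq⟩ := exists_rat_mem_of_rightCont (hX.rightCont ω s)
        (isOpen_lt (continuous_depthSum l) continuous_const) hs (ENNReal.coe_lt_coe.1 hst)
      refine ⟨q, hqt, ?_⟩
      rcases le_or_gt (Real.toNNReal q : ℝ≥0∞) (X.hittingTime C ω) with hqH | hqH
      · show G.depthSum l (X.stopped C (Real.toNNReal q) ω) < _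
        rw [hstop1 _ hqH]
        exact hq
      · exact hsub n (hstop2 _ hqH)
    refine ⟨h1, not_lt.1 fun hlt => ?_⟩
    rw [hstop1 _ hlt.le] at h1
    exact notMem_of_lt_hittingTime hlt (hvC h1)
  have heq : edgeExit X l ω = X.hittingTime C ω := by
    refine le_antisymm hle (le_of_forall_gt fun b hb => ?_)
    obtain ⟨q, -, h1, h2⟩ := ENNReal.lt_iff_exists_rat_btwn.1 hb
    exact (hmain q h1).2.trans_lt h2
  refine ⟨heq, fun hne => ?_⟩
  obtain ⟨q, -, h1, -⟩ := ENNReal.lt_iff_exists_rat_btwn.1 hne.lt_top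
  have h2 := (hmain q h1).1
  rw [stopped, ← heq, min_eq_right h1.le] at h2
  exact h2

/-- Started inside an open edge, a Brownian motion leaves it through a vertex. -/
theorem IsBrownianMotion.ae_edgeExit (hX : G.IsBrownianMotion X) (l : G.Edge) {x : ℝ}
    (hx : x ∈ G.openDom l) :
    ∀ᵐ ω ∂X.law (.inl (G.param l x)),
      (∀ t : ℝ≥0, (t : ℝ≥0∞) < edgeExit X l ω → X.path t ω ∈ Sum.inl '' G.openEdge l) ∧
      (edgeExit X l ω ≠ ⊤ →
        X.stateAt (edgeExit X l) ω ∈ Sum.inl '' range (Point.vertex : V → G.Point)) := by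
  have := hX.prob (.inl (G.param l x))
  obtain ⟨Ω', _, Q, B, _, hB, hid⟩ := hX.edge l x hx
  have hid' := identDistrib_rat (Y := fun t ω => X.stopped (Sum.inl '' G.openEdge l)ᶜ t ω)
    (Z := fun t ω' => (Sum.inl (G.param l
          (realStopped (G.openDom l) (fun s => x + B s ω') t)) : G.Point ⊕ Unit)) hid
  have hends := hid'.symm.ae_snd (measurableSet_endsAtVertex l) (by
    filter_upwards [hB.cont] with ω' hω'
    exact endsAtVertex_realStopped l (continuous_const.add hω'))
  filter_upwards [hends] with ω hω
  obtain ⟨h1, h2⟩ := hω.edgeExit_eq hX.toIsStrongMarkov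
  refine ⟨fun t ht => ?_, h2⟩
  rw [h1] at ht
  exact notMem_compl_iff.1 (notMem_of_lt_hittingTime ht)

end MetricGraph

/-- On a finite-dimensional space of functions, finitely many evaluations determine a function. -/
theorem Submodule.exists_interpolation {ι : Type*} (S : Submodule ℝ (ι → ℝ))
    [FiniteDimensional ℝ S] :
    ∃ (K : Finset ι) (z : K → S), ∀ y ∈ S, y = ∑ j : K, y j • (z j : ι → ℝ) := by
  classical
  let ev : (K : Finset ι) → S →ₗ[ℝ] (K → ℝ) := fun K =>
    { toFun := fun y j => (y : ι → ℝ) j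
      map_add' := fun _ _ => rfl
      map_smul' := fun _ _ => rfl }
  -- With the kernel of smallest dimension: a nonzero `y` in it has some `y i ≠ 0`, and adding `i`
  -- to `K` would shrink the kernel further.
  set K := Function.argmin fun K : Finset ι => Module.finrank ℝ (LinearMap.ker (ev K)) with hK
  have hmin : ∀ K', Module.finrank ℝ (LinearMap.ker (ev K)) ≤
      Module.finrank ℝ (LinearMap.ker (ev K')) := fun K' => Function.argmin_le
        (fun K : Finset ι => Module.finrank ℝ (LinearMap.ker (ev K))) K'
  have hker : LinearMap.ker (ev K) = ⊥ := by
    rw [LinearMap.ker_eq_bot']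
    intro y hy
    by_contra hne
    obtain ⟨i, hi⟩ : ∃ i, (y : ι → ℝ) i ≠ 0 := by
      by_contra hall
      push Not at hall
      exact hne (Subtype.ext (funext hall))
    refine (hmin (insert i K)).not_gt (Submodule.finrank_lt_finrank_of_lt
      (lt_of_le_of_ne (fun v hv => ?_) fun h => ?_))
    · rw [LinearMap.mem_ker] at hv ⊢
      ext j
      exact congrFun hv ⟨j, Finset.mem_insert_of_mem j.2⟩
    · have hy' : y ∈ LinearMap.ker (ev (insert i K)) := h ▸ (LinearMap.mem_ker.2 hy)
      exact hi (congrFun (LinearMap.mem_ker.1 hy') ⟨i, Finset.mem_insert_self i K⟩)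
  obtain ⟨L, hL⟩ := LinearMap.exists_leftInverse_of_injective (ev K) hker
  -- The interpolating functions are the images of the unit vectors under a left inverse of the
  -- evaluation at `K`.
  refine ⟨K, fun j => L (Pi.single j 1), fun y hy => ?_⟩
  have h1 : L (ev K ⟨y, hy⟩) = ⟨y, hy⟩ := LinearMap.congr_fun hL ⟨y, hy⟩
  have h2 : ev K ⟨y, hy⟩ = ∑ j : K, y j • Pi.single j (1 : ℝ) := by
    ext j
    simp [ev, Finset.sum_apply, Pi.single_apply]
  rw [h2, map_sum] at h1
  have h3 := congrArg (Subtype.val) h1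
  simpa using h3.symm

/-! ### Finite-dimensional spaces of entrance laws -/

namespace ProcessFamily

variable {S Ω : Type*} [MeasurableSpace Ω] {X : ProcessFamily S Ω}
  [PseudoEMetricSpace S] [MeasurableSpace S] [BorelSpace S] {hX : X.IsStrongMarkov}

/-- The entrance law into `C`, as a function of the test function. -/
def entranceFun (X : ProcessFamily S Ω) (C : Set (S ⊕ Unit)) (y : S ⊕ Unit)
    (g : {g // IsTest C g}) : ℝ :=
  (X.entranceMean C g.1 y).toReal

theorem integrable_entranceFun (hX : X.IsStrongMarkov) {C : Set (S ⊕ Unit)} (hC : IsClopen C)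
    (habs : X.NeverLeaves C) {m : Measure Ω} [IsFiniteMeasure m] {Z : Ω → S ⊕ Unit}
    (hZ : Measurable Z) (g : {g // IsTest C g}) :
    Integrable (fun ω => X.entranceFun C (Z ω) g) m := by
  refine Integrable.of_bound (C := 1) (((univMeasurable_entranceMean hX hC habs g.2 _
    inferInstance).comp_measurable hZ).ennreal_toReal.aestronglyMeasurable)
    (Eventually.of_forall fun ω => ?_)
  rw [entranceFun, Real.norm_of_nonneg ENNReal.toReal_nonneg]
  exact ENNReal.toReal_le_of_le_ofReal zero_le_one
    (by simpa using entranceMean_le_one hX hC habs g.2 (Z ω))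

/-- Averages of functions in a finite-dimensional space remain in this space. -/
theorem integral_entranceFun_mem (hX : X.IsStrongMarkov) {C : Set (S ⊕ Unit)} (hC : IsClopen C)
    (habs : X.NeverLeaves C) (W : Submodule ℝ ({g // IsTest C g} → ℝ)) [FiniteDimensional ℝ W]
    {m : Measure Ω} [IsFiniteMeasure m] {Z : Ω → S ⊕ Unit} (hZ : Measurable Z)
    (hW : ∀ᵐ ω ∂m, X.entranceFun C (Z ω) ∈ W) :
    (fun g => ∫ ω, X.entranceFun C (Z ω) g ∂m) ∈ W := by
  -- Interpolation reduces the average of a random element of `W` to finitely many scalar integrals,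
  -- the coefficients of the `z j`.
  obtain ⟨K, z, hz⟩ := W.exists_interpolation
  have : (fun g => ∫ ω, X.entranceFun C (Z ω) g ∂m) =
      ∑ j : K, (∫ ω, X.entranceFun C (Z ω) j ∂m) • (z j : {g // IsTest C g} → ℝ) := by
    ext g
    rw [Finset.sum_apply]
    simp only [Pi.smul_apply, smul_eq_mul, ← integral_mul_const]
    rw [← integral_finsetSum _ fun j _ => (integrable_entranceFun hX hC habs hZ _).mul_const _]
    refine integral_congr_ae ?_
    filter_upwards [hW] with ω hω
    have := congrFun (hz _ hω) g
    simpa [Finset.sum_apply] using this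
  rw [this]
  exact W.sum_mem fun j _ => W.smul_mem _ (z j).2

theorem lintegral_entranceMean_toReal (hX : X.IsStrongMarkov) {C : Set (S ⊕ Unit)}
    (hC : IsClopen C) (habs : X.NeverLeaves C) {m : Measure Ω} [IsFiniteMeasure m]
    {Z : Ω → S ⊕ Unit} (hZ : Measurable Z) (g : {g // IsTest C g}) :
    (∫⁻ ω, X.entranceMean C g.1 (Z ω) ∂m).toReal = ∫ ω, X.entranceFun C (Z ω) g ∂m := by
  refine (integral_toReal ((univMeasurable_entranceMean hX hC habs g.2 _
    inferInstance).comp_measurable hZ) (Eventually.of_forall fun ω => ?_)).symm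
  exact (entranceMean_le_one hX hC habs g.2 (Z ω)).trans_lt ENNReal.one_lt_top

/-- The exit law of a stopping time before the entrance into `C`, restricted to `C`, belongs to
every finite-dimensional space that contains the entrance laws of the starting point and of all
points outside `C`. -/
theorem IsStop.exitLaw_mem {τ : Ω → ℝ≥0∞} (hτ : IsStop hX τ) {C : Set (S ⊕ Unit)}
    (hC : IsClopen C) (habs : X.NeverLeaves C) (W : Submodule ℝ ({g // IsTest C g} → ℝ))
    [FiniteDimensional ℝ W] (hW : ∀ y ∉ C, X.entranceFun C y ∈ W) {x : S ⊕ Unit} (hx : x ∉ C)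
    (hle : ∀ᵐ ω ∂X.law x, ∀ t : ℝ≥0, (t : ℝ≥0∞) < τ ω → X.path t ω ∉ C) :
    (fun g : {g // IsTest C g} =>
      (∫⁻ ω in {ω | τ ω ≠ ⊤}, g.1 (X.stateAt τ ω) ∂X.law x).toReal) ∈ W := by
  have := hX.prob x
  set D : Set Ω := {ω | τ ω ≠ ⊤} with hD
  have hsm := hτ.measurable_stateAt
  set A : Set Ω := X.stateAt τ ⁻¹' C with hA
  have hAm : MeasurableSet A := hsm hC.isOpen.measurableSet
  have h1 : (fun g => ∫ ω, X.entranceFun C (X.stateAt τ ω) g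
      ∂((X.law x).restrict D).restrict Aᶜ) ∈ W := by
    refine integral_entranceFun_mem hX hC habs W hsm ?_
    filter_upwards [ae_restrict_mem hAm.compl] with ω hω
    exact hW _ hω
  have h2 := W.sub_mem (hW x hx) h1
  convert h2 using 1
  ext g
  have hlt : ∀ m : Measure Ω, IsFiniteMeasure m → ∀ u : Ω → ℝ≥0∞, (∀ ω, u ω ≤ 1) →
      ∫⁻ ω, u ω ∂m ≠ ⊤ := fun m _ u hu =>
    ((lintegral_mono hu).trans_lt (by simp)).ne
  -- From a point of `C` the entrance is immediate, so on `{X_τ ∈ C}` the entrance mean is `g(X_τ)`.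
  -- Hence the exit law is the entrance law of `x` minus the contribution of `{X_τ ∉ C}`.
  have h3 : ∫⁻ ω in D, g.1 (X.stateAt τ ω) ∂X.law x =
      ∫⁻ ω in A, X.entranceMean C g.1 (X.stateAt τ ω) ∂(X.law x).restrict D := by
    rw [← lintegral_add_compl _ hAm, setLIntegral_congr_fun (g := fun _ => 0) hAm.compl
      fun ω hω => g.2.eq_zero _ hω, lintegral_zero, add_zero]
    exact setLIntegral_congr_fun hAm fun ω hω => (entranceMean_of_mem hX hω).symm
  have h4 := lintegral_add_compl (μ := (X.law x).restrict D)
    (fun ω => X.entranceMean C g.1 (X.stateAt τ ω)) hAm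
  rw [Pi.sub_apply, ← lintegral_entranceMean_toReal hX hC habs hsm g, entranceFun,
    hτ.entranceMean_eq hC habs g.2 x hle, h3, ← h4, ENNReal.toReal_add, add_sub_cancel_right]
  · exact hlt _ inferInstance _ fun ω => entranceMean_le_one hX hC habs g.2 _
  · exact hlt _ inferInstance _ fun ω => entranceMean_le_one hX hC habs g.2 _

theorem aemeasurable_entranceValue (hX : X.IsStrongMarkov) {C : Set (S ⊕ Unit)}
    (hC : IsClopen C) (habs : X.NeverLeaves C) {g : S ⊕ Unit → ℝ≥0∞} (hg : IsTest C g)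
    (y : S ⊕ Unit) : AEMeasurable (fun ω => entranceValue C g fun t => X.path t ω) (X.law y) := by
  refine aemeasurable_of_tendsto_metrizable_ae' (f := fun n ω => gridSum n C g fun t => X.path t ω)
    (fun n => ?_) ?_
  · simpa using (measurable_gridSum hX (measurable_const (a := 0)) n hC
      hg.continuous.measurable).aemeasurable (μ := X.law y)
  · filter_upwards [habs.ae_mono hX hC y] with ω hω
    exact tendsto_gridSum (hX.rightCont ω) hC.isClosed hω hg.continuous hg.eq_zero

/-- Dominated convergence: for fixed `y` the entrance law is a fixed sub-probability measure on `C`,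
so pointwise convergence of the test functions suffices. -/
theorem tendsto_entranceFun_zero (hX : X.IsStrongMarkov) {C : Set (S ⊕ Unit)}
    (hC : IsClopen C) (habs : X.NeverLeaves C) {g : ℕ → {g // IsTest C g}}
    (hg : ∀ z, Tendsto (fun n => (g n).1 z) atTop (𝓝 0)) (y : S ⊕ Unit) :
    Tendsto (fun n => X.entranceFun C y (g n)) atTop (𝓝 0) := by
  have := hX.prob y
  have h : Tendsto (fun n => X.entranceMean C (g n).1 y) atTop (𝓝 (∫⁻ _, 0 ∂X.law y)) := by
    refine tendsto_lintegral_of_dominated_convergence' (fun _ => 1)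
      (fun n => aemeasurable_entranceValue hX hC habs (g n).2 y)
      (fun n => Eventually.of_forall fun ω => ?_) (by simp) (Eventually.of_forall fun ω => ?_)
    · simp only [entranceValue]
      split_ifs
      · exact (g n).2.le_one _
      · exact zero_le
    · simp only [entranceValue]
      split_ifs
      · exact hg _
      · exact tendsto_const_nhds
  rw [lintegral_zero] at h
  exact (ENNReal.tendsto_toReal ENNReal.zero_ne_top).comp h

end ProcessFamily

/-! ### The span of the vertex entrance laws -/

namespace MetricGraph

open ProcessFamily

variable {V E I Ω : Type*} [MeasurableSpace Ω] {G : MetricGraph V E I}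
  {X : ProcessFamily G.Point Ω}

theorem param_mem_iff {F : Set G.Point} (hF : IsClopen F) {l : G.Edge} {s t : ℝ}
    (hs : s ∈ G.dom l) (ht : t ∈ G.dom l) : G.param l s ∈ F ↔ G.param l t ∈ F := by
  have hc : IsPreconnected (G.dom l) := by
    rcases l with e | i
    · exact isPreconnected_Ici
    · exact isPreconnected_Icc
  have key : ∀ s ∈ G.dom l, ∀ t ∈ G.dom l, G.param l s ∈ F → G.param l t ∈ F :=
    fun s hs t ht hsF => (hc.image _ (G.continuousOn_param l)).subset_isClopen hF
      ⟨_, mem_image_of_mem _ hs, hsF⟩ (mem_image_of_mem _ ht)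
  exact ⟨key s hs t ht, key t ht s hs⟩

theorem isClopen_inl_image {F : Set G.Point} (hF : IsClopen F) :
    IsClopen (Sum.inl '' F : Set (G.Point ⊕ Unit)) :=
  ⟨isClosedMap_inl _ hF.isClosed, isOpenMap_inl _ hF.isOpen⟩

theorem neverLeaves_of_isAbsorbing {F : Set G.Point} (h : X.IsAbsorbing F) :
    X.NeverLeaves (Sum.inl '' F) := by
  rintro _ ⟨x, hx, rfl⟩
  exact h x hx

/-- The span of the entrance laws of the vertices. -/
def vertexSpan (X : ProcessFamily G.Point Ω) (F : Set G.Point) :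
    Submodule ℝ ({g : G.Point ⊕ Unit → ℝ≥0∞ // IsTest (Sum.inl '' F) g} → ℝ) :=
  Submodule.span ℝ (range fun w : V => X.entranceFun (Sum.inl '' F) (.inl (.vertex w)))

instance [Finite V] (F : Set G.Point) : FiniteDimensional ℝ (vertexSpan X F) :=
  FiniteDimensional.span_of_finite ℝ (finite_range _)

/-- An edge is connected, so an edge containing a point outside the clopen `F` avoids `F`. Started
there, the process exits through a vertex before any entrance into `F`, and its entrance law is an
average of vertex entrance laws. From the cemetery the entrance law is `0`. -/
theorem entranceFun_mem_vertexSpan [Finite V] (hX : G.IsBrownianMotion X) {F : Set G.Point}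
    (hF : IsClopen F) (habs : X.IsAbsorbing F) {y : G.Point ⊕ Unit} (hy : y ∉ Sum.inl '' F) :
    X.entranceFun (Sum.inl '' F) y ∈ vertexSpan X F := by
  have hvert : ∀ w : V, X.entranceFun (Sum.inl '' F) (.inl (.vertex w)) ∈ vertexSpan X F :=
    fun w => Submodule.subset_span (mem_range_self w)
  rcases y with g | ⟨⟩
  · rcases exists_param_eq g with ⟨v, rfl⟩ | ⟨l, s, hs, rfl⟩
    · exact hvert v
    · have := hX.prob (.inl (G.param l s))
      have hC := isClopen_inl_image hF
      have hN := neverLeaves_of_isAbsorbing habs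
      have hτ := isStop_edgeExit hX.toIsStrongMarkov l
      have hexit := hX.ae_edgeExit l hs
      have hsF : G.param l s ∉ F := fun h => hy (mem_image_of_mem _ h)
      have hmem := integral_entranceFun_mem hX.toIsStrongMarkov hC hN (vertexSpan X F)
        (m := (X.law (.inl (G.param l s))).restrict {ω | edgeExit X l ω ≠ ⊤})
        hτ.measurable_stateAt (by
          have hDm : MeasurableSet {ω | edgeExit X l ω ≠ ⊤} :=
            hτ.measurable (measurableSet_singleton _).compl
          rw [ae_restrict_iff' hDm]
          filter_upwards [hexit] with ω hω hne
          obtain ⟨_, ⟨v, rfl⟩, hv⟩ := hω.2 hne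
          rw [← hv]
          exact hvert v)
      convert hmem using 1
      ext g
      rw [← lintegral_entranceMean_toReal hX.toIsStrongMarkov hC hN hτ.measurable_stateAt g,
        entranceFun, hτ.entranceMean_eq hC hN g.2]
      filter_upwards [hexit] with ω hω t ht hmem
      obtain ⟨_, ⟨r, hr, rfl⟩, hrt⟩ := hω.1 t ht
      obtain ⟨p, hp, hpt⟩ := hmem
      rw [← hrt, Sum.inl.injEq] at hpt
      rw [hpt] at hp
      exact hsF ((param_mem_iff hF (openDom_subset_dom l hs) (openDom_subset_dom l hr)).2 hp)
  · have : X.entranceFun (Sum.inl '' F) (.inr ()) = 0 := by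
      ext g
      rw [entranceFun, entranceMean_inr hX.toIsStrongMarkov hy]
      rfl
    rw [this]
    exact Submodule.zero_mem _

/-- The exit laws on an absorbing clopen set, once their masses are bounded by `1`, are uniformly
small on test functions that decrease to `0`. -/
theorem exists_uniform_bound [Finite V] (hX : G.IsBrownianMotion X) {F : Set G.Point}
    (hF : IsClopen F) (habs : X.IsAbsorbing F)
    {g : ℕ → {g : G.Point ⊕ Unit → ℝ≥0∞ // IsTest (Sum.inl '' F) g}}
    (hg : ∀ z, Tendsto (fun n => (g n).1 z) atTop (𝓝 0)) {x : G.Point} (hx : x ∉ F) :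
    ∃ b : ℕ → ℝ, Tendsto b atTop (𝓝 0) ∧
      ∀ (τ : Ω → ℝ≥0∞) (_ : IsStop hX.toIsStrongMarkov τ),
        (∀ᵐ ω ∂X.law (.inl x), ∀ t : ℝ≥0, (t : ℝ≥0∞) < τ ω → X.path t ω ∉ Sum.inl '' F) →
        ∀ c : ℝ≥0∞, (∀ f : G.Point ⊕ Unit → ℝ≥0∞, IsTest (Sum.inl '' F) f →
            c * ∫⁻ ω in {ω | τ ω ≠ ⊤}, f (X.stateAt τ ω) ∂X.law (.inl x) ≤ 1) →
          ∀ n, c * ∫⁻ ω in {ω | τ ω ≠ ⊤}, (g n).1 (X.stateAt τ ω) ∂X.law (.inl x) ≤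
            ENNReal.ofReal (b n) := by
  have hC := isClopen_inl_image hF
  have hN := neverLeaves_of_isAbsorbing habs
  obtain ⟨K, z, hz⟩ := (vertexSpan X F).exists_interpolation
  have hlim : ∀ y ∈ vertexSpan X F, Tendsto (fun n => y (g n)) atTop (𝓝 0) := by
    intro y hy
    induction hy using Submodule.span_induction with
    | mem y hy =>
      obtain ⟨w, rfl⟩ := hy
      exact tendsto_entranceFun_zero hX.toIsStrongMarkov hC hN hg _
    | zero => exact tendsto_const_nhds
    | add y y' _ _ h h' => simpa using h.add h'
    | smul a y _ h => simpa using h.const_mul a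
  -- A scaled exit law `y ∈ W` satisfies `y = ∑ y_j z_j` with `0 ≤ y_j ≤ 1`, since the `y_j` are its
  -- values at test functions. Thus `y (g n) ≤ ∑ |z_j (g n)|`, a bound depending neither on the
  -- stopping time nor on the scaling.
  refine ⟨fun n => ∑ j : K, |(z j : _ → ℝ) (g n)|, ?_, fun τ hτ hle c hc n => ?_⟩
  · have : Tendsto (fun n => ∑ j : K, |(z j : _ → ℝ) (g n)|) atTop (𝓝 (∑ j : K, 0)) :=
      tendsto_finsetSum _ fun j _ => by simpa using (hlim _ (z j).2).abs
    simpa using this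
  · set q := fun f : {g : G.Point ⊕ Unit → ℝ≥0∞ // IsTest (Sum.inl '' F) g} =>
      ∫⁻ ω in {ω | τ ω ≠ ⊤}, f.1 (X.stateAt τ ω) ∂X.law (.inl x) with hq
    have hqc : ∀ f, c * q f ≤ 1 := fun f => hc f.1 f.2
    have hmem : (fun f => (q f).toReal) ∈ vertexSpan X F :=
      hτ.exitLaw_mem hC hN _ (fun y hy => entranceFun_mem_vertexSpan hX hF habs hy)
        (by simpa using hx) hle
    have hmem' : (fun f => (c * q f).toReal) ∈ vertexSpan X F := by
      have := (vertexSpan X F).smul_mem c.toReal hmem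
      convert this using 1
      ext f
      simp
    show c * q (g n) ≤ _
    have h1 := congrFun (hz _ hmem') (g n)
    rw [Finset.sum_apply] at h1
    rw [← ENNReal.ofReal_toReal ((hqc (g n)).trans_lt ENNReal.one_lt_top).ne]
    refine ENNReal.ofReal_le_ofReal (h1.le.trans (Finset.sum_le_sum fun j _ => ?_))
    rw [Pi.smul_apply, smul_eq_mul]
    have h2 : (c * q j).toReal ≤ 1 :=
      ENNReal.toReal_le_of_le_ofReal zero_le_one (by simpa using hqc j)
    calc _ ≤ (c * q j).toReal * |(z j : _ → ℝ) (g n)| :=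
          mul_le_mul_of_nonneg_left (le_abs_self _) ENNReal.toReal_nonneg
      _ ≤ _ := mul_le_of_le_one_left (abs_nonneg _) h2

end MetricGraph

/-! ### Exit positions as states at stopping times -/

namespace ProcessFamily

variable {S Ω : Type*} [MeasurableSpace Ω] {X : ProcessFamily S Ω}
  [PseudoEMetricSpace S] [MeasurableSpace S] [BorelSpace S]

theorem measurableEmbedding_inl : MeasurableEmbedding (Sum.inl : S → S ⊕ Unit) :=
  IsOpenEmbedding.inl.measurableEmbedding

/-- The points at distance greater than `ε` from `x`. -/
def farSet (x : S) (ε : ℝ≥0) : Set (S ⊕ Unit) := {z | (ε : ℝ≥0∞) < cemeteryDist z (.inl x)}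

theorem isOpen_farSet (x : S) (ε : ℝ≥0) : IsOpen (farSet x ε) := by
  refine isOpen_sum_iff.2 ⟨?_, isOpen_discrete _⟩
  exact isOpen_lt continuous_const (continuous_id.edist continuous_const)

theorem exitTime_eq_hittingTime {x : S} {ε : ℝ≥0} {ω : Ω} (h : X.path 0 ω = .inl x) :
    X.exitTime ε ω = X.hittingTime (farSet x ε) ω := by
  rw [exitTime, h]
  rfl

theorem exitPosition_eq {x : S} {ε : ℝ≥0} {ω : Ω} (h : X.path 0 ω = .inl x) [Decidable
    (X.hittingTime (farSet x ε) ω = ⊤)] :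
    X.exitPosition ε ω = if X.hittingTime (farSet x ε) ω = ⊤ then .inr ()
      else X.stateAt (X.hittingTime (farSet x ε)) ω := by
  rw [exitPosition, exitTime_eq_hittingTime h]
  congr

/-- The distance in `exitTime` is taken to the random point `X_0`; almost surely `X_0 = x`, and the
exit time becomes the hitting time of a fixed open set. -/
theorem IsStrongMarkov.aemeasurable_exitPosition (hX : X.IsStrongMarkov) (x : S) (ε : ℝ≥0) :
    AEMeasurable (X.exitPosition ε) (X.law (.inl x)) := by
  classical
  have hτ := isStop_hittingTime hX (isOpen_farSet x ε)
  refine ⟨fun ω => if X.hittingTime (farSet x ε) ω = ⊤ then .inr ()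
      else X.stateAt (X.hittingTime (farSet x ε)) ω,
    Measurable.ite (hτ.measurable (measurableSet_singleton _)) measurable_const
      hτ.measurable_stateAt, ?_⟩
  filter_upwards [hX.normal (.inl x)] with ω hω
  exact exitPosition_eq hω

end ProcessFamily

namespace MetricGraph

open ProcessFamily

variable {V E I Ω : Type*} [MeasurableSpace Ω] {G : MetricGraph V E I}
  {X : ProcessFamily G.Point Ω}

theorem scaledExit_apply (hX : X.IsStrongMarkov) (v : V) (ε : ℝ≥0) {A : Set G.Point}
    (hA : MeasurableSet A) : scaledExit X v ε A = (meanExitTime X v ε)⁻¹ *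
      X.law (.inl (.vertex v)) (X.exitPosition ε ⁻¹' (Sum.inl '' A)) := by
  rw [scaledExit, Measure.smul_apply, smul_eq_mul, measurableEmbedding_inl.comap_apply,
    Measure.map_apply_of_aemeasurable (hX.aemeasurable_exitPosition _ ε) hA.inl_image]

theorem lintegral_scaledExit (hX : X.IsStrongMarkov) (v : V) (ε : ℝ≥0) {φ : G.Point ⊕ Unit → ℝ≥0∞}
    (hφ : Measurable φ) (hφ0 : φ (.inr ()) = 0) : ∫⁻ g, φ (.inl g) ∂scaledExit X v ε =
      (meanExitTime X v ε)⁻¹ * ∫⁻ ω, φ (X.exitPosition ε ω) ∂X.law (.inl (.vertex v)) := by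
  rw [scaledExit, lintegral_smul_measure, smul_eq_mul,
    ← measurableEmbedding_inl.lintegral_map, measurableEmbedding_inl.map_comap,
    ← lintegral_map' hφ.aemeasurable (hX.aemeasurable_exitPosition _ ε)]
  congr 1
  refine setLIntegral_eq_of_support_subset fun z hz => ?_
  rcases z with g | ⟨⟩
  · exact mem_range_self g
  · exact absurd hφ0 hz

/-! ### Deleting a clopen set: distances, exit laws, normalization -/

section Clopen

variable {F : Set G.Point}

/-- No closed edge meets both `F` and its complement. -/
theorem segDist_eq_top (hF : IsClopen F) {g h : G.Point} (hg : g ∈ F) (hh : h ∉ F) :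
    G.segDist g h = ⊤ := by
  rw [segDist, eq_top_iff]
  refine le_inf (le_iInf fun e => absurd (e ▸ hg) hh) ?_
  refine le_iInf fun l => le_iInf fun s => le_iInf fun t => le_iInf fun ⟨hs, ht, hg', hh'⟩ => ?_
  exact absurd (hh' ▸ (param_mem_iff hF hs ht).1 (hg'.symm ▸ hg)) hh

theorem chainLength_eq_top (hF : IsClopen F) (c : List G.Point) :
    ∀ {g h : G.Point}, g ∈ F → h ∉ F → G.chainLength g c h = ⊤ := by
  induction c with
  | nil => exact fun hg hh => segDist_eq_top hF hg hh
  | cons p c ih =>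
    intro g h hg hh
    by_cases hp : p ∈ F
    · rw [chainLength, ih hp hh, add_top]
    · rw [chainLength, segDist_eq_top hF hg hp, top_add]

theorem edist_eq_top (hF : IsClopen F) {g h : G.Point} (hg : g ∈ F) (hh : h ∉ F) :
    edist g h = ⊤ :=
  iInf_eq_top.2 fun c => chainLength_eq_top hF c hg hh

theorem dom_inclEdge (l : (G.delete F).Edge) : G.dom (G.inclEdge F l) = (G.delete F).dom l := by
  rcases l with e | i <;> rfl

theorem param_inclEdge (l : (G.delete F).Edge) (s : ℝ) :
    G.param (G.inclEdge F l) s = G.incl F ((G.delete F).param l s) := by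
  rcases l with e | i
  · simp only [inclEdge, Sum.map_inl, param]
    split_ifs <;> rfl
  · have e : (G.delete F).len i = G.len i.1 := rfl
    by_cases h : 0 < s
    · by_cases h' : s < G.len i.1
      · simp [param, inclEdge, h, h', e, incl]
      · simp [param, inclEdge, h, h', incl, delete]
    · simp [param, inclEdge, h, incl, delete]

theorem zero_mem_dom (l : G.Edge) : (0 : ℝ) ∈ G.dom l := by
  rcases l with e | i
  · exact self_mem_Ici
  · exact ⟨le_rfl, (G.len_pos i).le⟩

theorem exists_inclEdge_eq (hF : IsClopen F) {l : G.Edge} {s : ℝ} (hs : s ∈ G.dom l)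
    (h : G.param l s ∉ F) : ∃ l', G.inclEdge F l' = l := by
  have h0 := mt (param_mem_iff hF hs (zero_mem_dom l)).2 h
  rcases l with e | i
  · simp only [param, lt_irrefl, dite_false] at h0
    exact ⟨.inl ⟨e, h0⟩, rfl⟩
  · have h1 := mt (param_mem_iff hF hs (⟨(G.len_pos i).le, le_rfl⟩ :
      G.len i ∈ G.dom (.inr i))).2 h
    simp only [param, lt_irrefl, dite_false, G.len_pos i, dite_true] at h0 h1
    exact ⟨.inr ⟨i, h0, h1⟩, rfl⟩

theorem incl_notMem (hF : IsClopen F) (g : (G.delete F).Point) : G.incl F g ∉ F := by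
  have : G.incl F g ∈ range (G.incl F) := mem_range_self g
  rwa [range_incl G hF] at this

theorem exists_incl_eq (hF : IsClopen F) {p : G.Point} (hp : p ∉ F) : ∃ g, G.incl F g = p := by
  have : p ∈ Fᶜ := hp
  rwa [← range_incl G hF] at this

theorem segDist_incl (hF : IsClopen F) (g h : (G.delete F).Point) :
    G.segDist (G.incl F g) (G.incl F h) = (G.delete F).segDist g h := by
  refine le_antisymm (le_inf ?_ ?_) (le_inf ?_ ?_)
  · refine le_iInf fun e => ?_
    rw [e, segDist_self]
  · refine le_iInf fun l => le_iInf fun s => le_iInf fun t => le_iInf fun ⟨hs, ht, hg, hh⟩ => ?_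
    refine inf_le_right.trans (iInf_le_of_le (G.inclEdge F l) (iInf_le_of_le s
      (iInf_le_of_le t (iInf_le_of_le ⟨?_, ?_, ?_, ?_⟩ le_rfl))))
    · rwa [dom_inclEdge]
    · rwa [dom_inclEdge]
    · rw [param_inclEdge, hg]
    · rw [param_inclEdge, hh]
  · refine le_iInf fun e => ?_
    rw [G.incl_injective F e, segDist_self]
  · refine le_iInf fun l => le_iInf fun s => le_iInf fun t => le_iInf fun ⟨hs, ht, hg, hh⟩ => ?_
    obtain ⟨l, rfl⟩ := exists_inclEdge_eq hF hs (hg ▸ incl_notMem hF g)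
    rw [dom_inclEdge] at hs ht
    rw [param_inclEdge] at hg hh
    exact inf_le_right.trans (iInf_le_of_le l (iInf_le_of_le s (iInf_le_of_le t
      (iInf_le_of_le ⟨hs, ht, G.incl_injective F hg, G.incl_injective F hh⟩ le_rfl))))

theorem chainLength_incl (hF : IsClopen F) (c : List (G.delete F).Point) :
    ∀ g h, G.chainLength (G.incl F g) (c.map (G.incl F)) (G.incl F h) =
      (G.delete F).chainLength g c h := by
  induction c with
  | nil => exact fun g h => segDist_incl hF g h
  | cons p c ih =>
    intro g h
    rw [List.map_cons, chainLength, chainLength, segDist_incl hF, ih]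

/-- A chain that visits `F` has infinite length, and all other chains lift to `G \ F`. -/
theorem edist_le_chainLength_incl (hF : IsClopen F) (c : List G.Point) :
    ∀ g h : (G.delete F).Point, edist g h ≤ G.chainLength (G.incl F g) c (G.incl F h) := by
  induction c with
  | nil =>
    intro g h
    refine (iInf_le _ []).trans ?_
    rw [chainLength, chainLength, segDist_incl hF]
  | cons p c ih =>
    intro g h
    by_cases hp : p ∈ F
    · rw [chainLength, segDist_comm, segDist_eq_top hF hp (incl_notMem hF g), top_add]
      exact le_top
    · obtain ⟨p, rfl⟩ := exists_incl_eq hF hp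
      refine (edist_triangle g p h).trans (add_le_add ((iInf_le _ []).trans ?_) (ih p h))
      rw [chainLength, segDist_incl hF]

theorem isometry_incl (hF : IsClopen F) : Isometry (G.incl F) := by
  intro g h
  refine le_antisymm (le_iInf fun c => (iInf_le _ (c.map (G.incl F))).trans ?_)
    (le_iInf fun c => edist_le_chainLength_incl hF c g h)
  rw [chainLength_incl hF]

theorem isClosedEmbedding_incl (hF : IsClopen F) : IsClosedEmbedding (G.incl F) := by
  refine ⟨⟨(isometry_incl hF).isUniformInducing.isInducing, G.incl_injective F⟩, ?_⟩
  rw [range_incl G hF]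
  exact hF.isOpen.isClosed_compl

theorem measurableEmbedding_incl (hF : IsClopen F) : MeasurableEmbedding (G.incl F) :=
  (isClosedEmbedding_incl hF).measurableEmbedding

/-- `killMap`, extended to the cemetery. -/
def killSum (G : MetricGraph V E I) (F : Set G.Point) (z : G.Point ⊕ Unit) :
    (G.delete F).Point ⊕ Unit :=
  Sum.elim (G.killMap F) (fun _ => .inr ()) z

theorem killSum_incl (hF : IsClopen F) (g : (G.delete F).Point) :
    G.killSum F (.inl (G.incl F g)) = .inl g := by
  have h : G.incl F g ∉ F ∧ ∃ y, G.incl F y = G.incl F g := ⟨incl_notMem hF g, g, rfl⟩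
  rw [killSum, Sum.elim_inl, killMap, dif_pos h, G.incl_injective F h.2.choose_spec]

theorem killSum_of_mem {p : G.Point} (hp : p ∈ F) : G.killSum F (.inl p) = .inr () := by
  rw [killSum, Sum.elim_inl, killMap, dif_neg fun h => h.1 hp]

/-- Moving `F` to the cemetery changes no distance to `G \ F`, since both are infinitely far away.
This is why killing preserves exit times. -/
theorem cemeteryDist_killSum (hF : IsClopen F) (z : G.Point ⊕ Unit) (g : (G.delete F).Point) :
    cemeteryDist (G.killSum F z) (.inl g) = cemeteryDist z (.inl (G.incl F g)) := by
  rcases z with p | ⟨⟩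
  · by_cases hp : p ∈ F
    · rw [killSum_of_mem hp]
      exact (edist_eq_top hF hp (incl_notMem hF g)).symm
    · obtain ⟨h, rfl⟩ := exists_incl_eq hF hp
      rw [killSum_incl hF]
      exact ((isometry_incl hF).edist_eq h g).symm
  · rfl

theorem exitTime_killedProcess (hF : IsClopen F) (ε : ℝ≥0) {g : (G.delete F).Point} {ω : Ω}
    (h : X.path 0 ω = .inl (G.incl F g)) :
    (killedProcess X F).exitTime ε ω = X.exitTime ε ω := by
  have hpath : ∀ t, (killedProcess X F).path t ω = G.killSum F (X.path t ω) := fun t => rfl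
  simp only [exitTime, hpath, h, killSum_incl hF, cemeteryDist_killSum hF]

theorem exitPosition_killedProcess (hF : IsClopen F) (ε : ℝ≥0) {g : (G.delete F).Point} {ω : Ω}
    (h : X.path 0 ω = .inl (G.incl F g)) :
    (killedProcess X F).exitPosition ε ω = G.killSum F (X.exitPosition ε ω) := by
  rw [exitPosition, exitPosition, exitTime_killedProcess hF ε h]
  split_ifs <;> rfl

theorem weight_of_edist_eq_top {v : V} {g : G.Point} (h : edist (Point.vertex v) g = ⊤) :
    G.weight v g = 1 := by
  rw [weight, h]
  simp

theorem weight_of_mem (hF : IsClopen F) {v : V} (hv : Point.vertex v ∉ F) {g : G.Point}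
    (hg : g ∈ F) : G.weight v g = 1 :=
  weight_of_edist_eq_top (by rw [edist_comm]; exact edist_eq_top hF hg hv)

theorem weight_incl (hF : IsClopen F) (v : {v : V // Point.vertex v ∉ F})
    (g : (G.delete F).Point) : G.weight v.1 (G.incl F g) = (G.delete F).weight v g := by
  rw [weight, weight, ← (isometry_incl hF).edist_eq]
  rfl

theorem measurable_weight (v : V) : Measurable (G.weight v) := by
  have h1 : Measurable fun g : G.Point => edist (Point.vertex v) g :=
    (continuous_const.edist continuous_id).measurable
  exact measurable_const.sub (EReal.measurable_exp.comp
    (measurable_coe_ennreal_ereal.comp h1).neg)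

theorem meanExitTime_killedProcess (hX : X.IsStrongMarkov) (hF : IsClopen F)
    (v : {v : V // Point.vertex v ∉ F}) (ε : ℝ≥0) :
    meanExitTime (killedProcess X F) v ε = meanExitTime X v.1 ε := by
  refine lintegral_congr_ae ?_
  filter_upwards [hX.normal (.inl (.vertex v.1))] with ω hω
  exact exitTime_killedProcess hF ε (g := .vertex v) hω

/-- The killed process exits to `Δ` exactly when `X` exits to `Δ` or into `F`, two disjoint events.
-/
theorem killRate_killedProcess (hX : X.IsStrongMarkov) (hF : IsClopen F)
    (v : {v : V // Point.vertex v ∉ F}) (ε : ℝ≥0) :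
    killRate (killedProcess X F) v ε = killRate X v.1 ε + scaledExit X v.1 ε F := by
  rw [scaledExit_apply hX _ _ hF.isOpen.measurableSet, killRate, killRate,
    meanExitTime_killedProcess hX hF, ENNReal.div_eq_inv_mul, ENNReal.div_eq_inv_mul, ← mul_add]
  congr 1
  have h1 : NullMeasurableSet (X.exitPosition ε ⁻¹' (Sum.inl '' F))
      (X.law (.inl (.vertex v.1))) :=
    (hX.aemeasurable_exitPosition _ ε).nullMeasurable hF.isOpen.measurableSet.inl_image
  rw [← measure_union₀ h1]
  · refine measure_congr ?_
    filter_upwards [hX.normal (.inl (.vertex v.1))] with ω hω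
    refine propext ?_
    change (killedProcess X F).exitPosition ε ω = .inr () ↔
      X.exitPosition ε ω = .inr () ∨ X.exitPosition ε ω ∈ Sum.inl '' F
    rw [exitPosition_killedProcess hF ε (g := .vertex v) hω]
    rcases X.exitPosition ε ω with p | ⟨⟩
    · by_cases hp : p ∈ F
      · simp [killSum_of_mem hp, hp]
      · obtain ⟨g, rfl⟩ := exists_incl_eq hF hp
        simp [killSum_incl hF, hp]
    · simp [killSum]
  · refine Disjoint.aedisjoint (disjoint_left.2 ?_)
    rintro ω hω ⟨p, -, hp⟩
    rw [mem_ofPred_eq] at hω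
    rw [hω] at hp
    exact Sum.inl_ne_inr hp

theorem scaledExit_killedProcess (hX : X.IsStrongMarkov)
    (hY : (killedProcess X F).IsStrongMarkov) (hF : IsClopen F)
    (v : {v : V // Point.vertex v ∉ F}) (ε : ℝ≥0) :
    scaledExit (killedProcess X F) v ε = (scaledExit X v.1 ε).comap (G.incl F) := by
  ext A hA
  have hA' : MeasurableSet (G.incl F '' A) := (measurableEmbedding_incl hF).measurableSet_image.2 hA
  rw [(measurableEmbedding_incl hF).comap_apply, scaledExit_apply hX _ _ hA',
    scaledExit_apply hY _ _ hA, meanExitTime_killedProcess hX hF]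
  congr 1
  refine measure_congr ?_
  filter_upwards [hX.normal (.inl (.vertex v.1))] with ω hω
  refine propext ?_
  change (killedProcess X F).exitPosition ε ω ∈ Sum.inl '' A ↔
    X.exitPosition ε ω ∈ Sum.inl '' (G.incl F '' A)
  rw [exitPosition_killedProcess hF ε (g := .vertex v) hω]
  rcases X.exitPosition ε ω with p | ⟨⟩
  · by_cases hp : p ∈ F
    · simp only [killSum_of_mem hp, mem_image, reduceCtorEq, and_false, exists_false,
        Sum.inl.injEq, exists_eq_right, false_iff, not_exists, not_and]
      exact fun g _ h => incl_notMem hF g (h ▸ hp)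
    · obtain ⟨g, rfl⟩ := exists_incl_eq hF hp
      simp only [killSum_incl hF, mem_image, Sum.inl.injEq, exists_eq_right]
      exact ⟨fun h => ⟨g, h, rfl⟩, fun ⟨g', h, e⟩ => G.incl_injective F e ▸ h⟩
  · simp [killSum]

theorem lintegral_comap_incl (hF : IsClopen F) (m : Measure G.Point) (φ : G.Point → ℝ≥0∞) :
    ∫⁻ g, φ (G.incl F g) ∂m.comap (G.incl F) = ∫⁻ p in Fᶜ, φ p ∂m := by
  rw [← (measurableEmbedding_incl hF).lintegral_map, (measurableEmbedding_incl hF).map_comap,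
    range_incl G hF]

/-- The weight is `1` on `F`, so the part of the integral over `F` is exactly the amount added to
the kill rate. -/
theorem normalization_killedProcess (hX : X.IsStrongMarkov)
    (hY : (killedProcess X F).IsStrongMarkov) (hF : IsClopen F)
    (v : {v : V // Point.vertex v ∉ F}) (ε : ℝ≥0) :
    normalization (killedProcess X F) v ε = normalization X v.1 ε := by
  have h1 : ∫⁻ p in F, G.weight v.1 p ∂scaledExit X v.1 ε = scaledExit X v.1 ε F := by
    rw [setLIntegral_congr_fun (g := fun _ => 1) hF.isOpen.measurableSet
      fun p hp => weight_of_mem hF v.2 hp, setLIntegral_one]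
  rw [normalization, normalization, killRate_killedProcess hX hF,
    scaledExit_killedProcess hX hY hF, ← lintegral_add_compl _ hF.isOpen.measurableSet, h1]
  simp only [← weight_incl hF]
  rw [lintegral_comap_incl hF (φ := G.weight v.1)]
  ring

theorem normalizedExit_killedProcess (hX : X.IsStrongMarkov)
    (hY : (killedProcess X F).IsStrongMarkov) (hF : IsClopen F)
    (v : {v : V // Point.vertex v ∉ F}) (ε : ℝ≥0) :
    normalizedExit (killedProcess X F) v ε = (normalizedExit X v.1 ε).comap (G.incl F) := by
  ext A hA
  have hA' : MeasurableSet (G.incl F '' A) := (measurableEmbedding_incl hF).measurableSet_image.2 hA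
  rw [(measurableEmbedding_incl hF).comap_apply, normalizedExit, normalizedExit,
    Measure.smul_apply, Measure.smul_apply, withDensity_apply _ hA, withDensity_apply _ hA',
    normalization_killedProcess hX hY hF, scaledExit_killedProcess hX hY hF]
  congr 1
  have e : (G.delete F).weight v = fun g => G.weight v.1 (G.incl F g) :=
    funext fun g => (weight_incl hF v g).symm
  have e' : (A.indicator fun g => G.weight v.1 (G.incl F g)) =
      fun g => (G.incl F '' A).indicator (G.weight v.1) (G.incl F g) := by
    ext g
    by_cases h : g ∈ A
    · rw [indicator_of_mem h, indicator_of_mem (mem_image_of_mem _ h)]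
    · rw [indicator_of_notMem h, indicator_of_notMem]
      rintro ⟨g', h', e⟩
      exact h (G.incl_injective F e ▸ h')
  have hsub : G.incl F '' A ∩ Fᶜ = G.incl F '' A :=
    inter_eq_left.2 (by rintro _ ⟨g, -, rfl⟩; exact incl_notMem hF g)
  rw [e, ← lintegral_indicator hA, e', lintegral_comap_incl hF, setLIntegral_indicator hA', hsub]

end Clopen

end MetricGraph

/-! ### The compactification of the reduced graph, and tail functions -/

namespace MetricGraph

open ProcessFamily

variable {V E I Ω : Type*} [MeasurableSpace Ω] {G : MetricGraph V E I}
  {X : ProcessFamily G.Point Ω}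

namespace Compactification

theorem continuous_iff_param {v : V} {Y : Type*} [TopologicalSpace Y]
    {f : Compactification G v → Y} :
    Continuous f ↔ ∀ l, Continuous fun t => f (param G v l t) := by
  rw [continuous_iSup_dom]
  exact forall_congr' fun l => continuous_coinduced_dom

theorem isOpen_iff_param {v : V} {s : Set (Compactification G v)} :
    IsOpen s ↔ ∀ l, IsOpen (param G v l ⁻¹' s) := by
  rw [isOpen_iSup_iff]
  exact forall_congr' fun l => isOpen_coinduced

theorem toReal_mem_dom (e : E) (t : ℝ≥0∞) : t.toReal ∈ G.dom (.inl e) := ENNReal.toReal_nonneg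

theorem min_toReal_mem_dom (i : I) (t : ℝ≥0∞) :
    (min t (ENNReal.ofReal (G.len i))).toReal ∈ G.dom (.inr i) :=
  ⟨ENNReal.toReal_nonneg, ENNReal.toReal_le_of_le_ofReal (G.len_pos i).le (min_le_right _ _)⟩

section Incl

variable {F : Set G.Point}

/-- The inclusion of the compactification of `(G \ F) \ {v}` into the one of `G \ {v}`. -/
def incl {v : {v : V // Point.vertex v ∉ F}} :
    Compactification (G.delete F) v → Compactification G v.1
  | .inner g h => .inner (G.incl F g) fun e => h (G.incl_injective F (a₂ := .vertex v) e)
  | .germ l h => .germ (G.inclEdge F l) (incident_inclEdge h)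
  | .atInfinity e => .atInfinity e.1

variable {v : {v : V // Point.vertex v ∉ F}}

theorem inclEdge_injective : Function.Injective (G.inclEdge F) :=
  Subtype.val_injective.sumMap Subtype.val_injective

theorem incl_injective : Function.Injective (incl (G := G) (v := v)) := by
  rintro (⟨g, h⟩ | ⟨l, h⟩ | e) (⟨g', h'⟩ | ⟨l', h'⟩ | e') heq <;>
    simp only [incl, inner.injEq, germ.injEq, atInfinity.injEq, reduceCtorEq] at heq
  · cases G.incl_injective F heq
    rfl
  · cases inclEdge_injective heq
    rfl
  · cases Subtype.ext heq
    rfl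

theorem incl_place (l : (G.delete F).Edge) (s : ℝ) :
    incl (place (G.delete F) v l s) = place G v.1 (G.inclEdge F l) s := by
  have hiff : (G.delete F).param l s = .vertex v ↔ G.param (G.inclEdge F l) s = .vertex v.1 := by
    rw [param_inclEdge]
    exact (G.incl_injective F).eq_iff (b := .vertex v).symm
  by_cases h : (G.delete F).param l s = .vertex v
  · rw [place, dif_pos h, place, dif_pos (hiff.1 h)]
    rfl
  · rw [place, dif_neg h, place, dif_neg (mt hiff.2 h)]
    simp only [incl, param_inclEdge]

theorem incl_param (l : (G.delete F).Edge) (t : ℝ≥0∞) :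
    incl (param (G.delete F) v l t) = param G v.1 (G.inclEdge F l) t := by
  rcases l with e | i
  · simp only [param, inclEdge, Sum.map_inl]
    split_ifs
    · rfl
    · exact incl_place (.inl e) _
  · exact incl_place (.inr i) _

theorem place_notMem_range (hF : IsClopen F) {l : G.Edge} (hl : l ∉ range (G.inclEdge F)) {s : ℝ}
    (hs : s ∈ G.dom l) : place G v.1 l s ∉ range (incl (G := G) (v := v)) := by
  have hmem : G.param l s ∈ F := by
    by_contra h
    exact hl (exists_inclEdge_eq hF hs h)
  have hne : G.param l s ≠ .vertex v.1 := fun h => v.2 (h ▸ hmem)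
  rw [place, dif_neg hne]
  rintro ⟨⟨g, h⟩ | ⟨l, h⟩ | e, he⟩ <;> simp only [incl, inner.injEq, reduceCtorEq] at he
  exact incl_notMem hF g (he ▸ hmem)

theorem param_notMem_range (hF : IsClopen F) {l : G.Edge} (hl : l ∉ range (G.inclEdge F))
    (t : ℝ≥0∞) : param G v.1 l t ∉ range (incl (G := G) (v := v)) := by
  rcases l with e | i
  · simp only [param]
    split_ifs
    · rintro ⟨⟨g, h⟩ | ⟨l, h⟩ | e', he⟩ <;>
        simp only [incl, atInfinity.injEq, reduceCtorEq] at he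
      exact hl ⟨.inl e', congrArg Sum.inl he⟩
    · exact place_notMem_range hF hl (toReal_mem_dom e t)
  · exact place_notMem_range hF hl (min_toReal_mem_dom i t)

/-- Openness is tested on compact edges. On an edge of `G \ F` the trace of an image is the original
trace; on any other edge it is empty, as such an edge lies wholly in `F` together with its possible
end at infinity. -/
theorem isOpenEmbedding_incl (hF : IsClopen F) :
    IsOpenEmbedding (incl (G := G) (v := v)) := by
  refine .of_continuous_injective_isOpenMap ?_ incl_injective ?_
  · refine continuous_iff_param.2 fun l => ?_
    simp only [incl_param]
    exact continuous_iff_param.1 continuous_id _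
  · intro s hs
    refine isOpen_iff_param.2 fun l => ?_
    by_cases hl : l ∈ range (G.inclEdge F)
    · obtain ⟨l, rfl⟩ := hl
      have : param G v.1 (G.inclEdge F l) ⁻¹' (incl '' s) = param (G.delete F) v l ⁻¹' s := by
        ext t
        rw [mem_preimage, ← incl_param, incl_injective.mem_set_image, mem_preimage]
      rw [this]
      exact isOpen_iff_param.1 hs l
    · have : param G v.1 l ⁻¹' (incl '' s) = ∅ := by
        ext t
        simp only [mem_preimage, mem_empty_iff_false, iff_false]
        exact fun h => param_notMem_range hF hl t (image_subset_range _ _ h)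
      rw [this]
      exact isOpen_empty

theorem measurableEmbedding_incl (hF : IsClopen F) :
    MeasurableEmbedding (incl (G := G) (v := v)) :=
  (isOpenEmbedding_incl hF).measurableEmbedding

/-- Extension by `0` of a bounded continuous function. -/
def extend (hF : IsClopen F) (f : Compactification (G.delete F) v →ᵇ ℝ) :
    Compactification G v.1 →ᵇ ℝ :=
  BoundedContinuousFunction.ofNormedAddCommGroup (Function.extend incl f 0) (by
    refine continuous_iff_param.2 fun l => ?_
    by_cases hl : l ∈ range (G.inclEdge F)
    · obtain ⟨l, rfl⟩ := hl
      simp only [← incl_param, incl_injective.extend_apply]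
      exact continuous_iff_param.1 f.continuous l
    · have : ∀ t, Function.extend incl f 0 (param G v.1 l t) = 0 := fun t =>
        Function.extend_apply' _ _ _ fun h => param_notMem_range hF hl t h
      simp only [this]
      exact continuous_const) ‖f‖ (by
    intro y
    by_cases h : y ∈ range (incl (G := G) (v := v))
    · obtain ⟨y, rfl⟩ := h
      rw [incl_injective.extend_apply]
      exact f.norm_coe_le_norm y
    · rw [Function.extend_apply' _ _ _ h]
      simp)

theorem extend_incl (hF : IsClopen F) (f : Compactification (G.delete F) v →ᵇ ℝ)
    (y : Compactification (G.delete F) v) : extend hF f (incl y) = f y :=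
  incl_injective.extend_apply _ _ y

theorem extend_of_notMem (hF : IsClopen F) (f : Compactification (G.delete F) v →ᵇ ℝ)
    {y : Compactification G v.1} (hy : y ∉ range (incl (G := G) (v := v))) :
    extend hF f y = 0 :=
  Function.extend_apply' _ _ _ hy

theorem inner_mem_range_iff (hF : IsClopen F) {p : G.Point} (hp : p ≠ .vertex v.1) :
    .inner p hp ∈ range (incl (G := G) (v := v)) ↔ p ∉ F := by
  constructor
  · rintro ⟨⟨g, h⟩ | ⟨l, h⟩ | e, he⟩ <;> simp only [incl, inner.injEq, reduceCtorEq] at he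
    exact he ▸ incl_notMem hF g
  · intro h
    obtain ⟨g, rfl⟩ := exists_incl_eq hF h
    exact ⟨.inner g fun e => hp (congrArg (G.incl F) e), rfl⟩

/-- Since `v ∉ F`, every edge at `v` avoids `F`. Outside the range there remain only points of `F`
and ends at infinity of edges in `F`. -/
theorem germ_mem_range (hF : IsClopen F) {l : G.Edge} (hl : G.Incident v.1 l) :
    .germ l hl ∈ range (incl (G := G) (v := v)) := by
  have key : ∀ s ∈ G.dom l, G.param l s = .vertex v.1 →
      .germ l hl ∈ range (incl (G := G) (v := v)) := by
    intro s hs h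
    obtain ⟨l', rfl⟩ := exists_inclEdge_eq hF hs (h ▸ v.2)
    refine ⟨.germ l' ?_, rfl⟩
    rw [param_inclEdge] at h
    exact param_eq_vertex (G.incl_injective F (a₂ := .vertex v) h)
  rcases l with e | i
  · exact key 0 (zero_mem_dom _) (by simpa [param, Incident, MetricGraph.param] using hl)
  · rcases hl with h | h
    · exact key 0 (zero_mem_dom _) (by simpa [MetricGraph.param] using h)
    · exact key (G.len i) ⟨(G.len_pos i).le, le_rfl⟩
        (by simpa [MetricGraph.param, G.len_pos i] using h)

theorem atInfinity_mem_range_iff {e : E} :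
    .atInfinity e ∈ range (incl (G := G) (v := v)) ↔ Point.vertex (G.base e) ∉ F := by
  constructor
  · rintro ⟨⟨g, h⟩ | ⟨l, h⟩ | e', he⟩ <;> simp only [incl, atInfinity.injEq, reduceCtorEq] at he
    exact he ▸ e'.2
  · exact fun h => ⟨.atInfinity ⟨e, h⟩, rfl⟩

end Incl

end Compactification

/-- The continuous function that vanishes outside the external edge `e` and at the points of this
edge with parameter at most `n`, and is `1` at the points with parameter at least `n + 1`. -/
def tail (G : MetricGraph V E I) (e : E) (n : ℕ) (g : G.Point) : ℝ≥0∞ :=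
  min 1 (ENNReal.ofReal (G.depth (.inl e) g) - n)

theorem continuous_tail_aux (n : ℕ) : Continuous fun t : ℝ≥0∞ => min 1 (t - n) :=
  continuous_const.min (ENNReal.continuous_sub_right _)

theorem continuous_tail (e : E) (n : ℕ) : Continuous (G.tail e n) :=
  (continuous_tail_aux n).comp (ENNReal.continuous_ofReal.comp (lipschitzWith_depth _).continuous)

theorem tail_le_one (e : E) (n : ℕ) (g : G.Point) : G.tail e n g ≤ 1 := min_le_left _ _

theorem tail_of_depth_eq_zero {e : E} {g : G.Point} (h : G.depth (.inl e) g = 0) (n : ℕ) :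
    G.tail e n g = 0 := by
  simp [tail, h]

theorem tendsto_tail (e : E) (g : G.Point) :
    Tendsto (fun n => G.tail e n g) atTop (𝓝 0) := by
  obtain ⟨N, hN⟩ := exists_nat_ge (G.depth (.inl e) g)
  refine tendsto_const_nhds.congr' ?_
  filter_upwards [eventually_ge_atTop N] with n hn
  have : ENNReal.ofReal (G.depth (.inl e) g) ≤ n := by
    rw [ENNReal.ofReal_le_natCast]
    exact hN.trans (by exact_mod_cast hn)
  rw [tail, tsub_eq_zero_of_le this, min_eq_right zero_le]

open Classical in
/-- `tail`, as a function on the compactification. -/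
def compactTail (G : MetricGraph V E I) (v : V) (e : E) (n : ℕ) : Compactification G v → ℝ
  | .inner g _ => (G.tail e n g).toReal
  | .germ _ _ => 0
  | .atInfinity e' => if e' = e then 1 else 0

theorem compactTail_place (v : V) (e : E) (n : ℕ) (l : G.Edge) (s : ℝ) :
    compactTail G v e n (Compactification.place G v l s) = (G.tail e n (G.param l s)).toReal := by
  rw [Compactification.place]
  split_ifs with h
  · rw [h, tail_of_depth_eq_zero (depth_vertex _ v)]
    rfl
  · rfl

theorem compactTail_nonneg (v : V) (e : E) (n : ℕ) (y : Compactification G v) :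
    0 ≤ compactTail G v e n y := by
  rcases y with ⟨g, h⟩ | ⟨l, h⟩ | e'
  · exact ENNReal.toReal_nonneg
  · exact le_rfl
  · simp only [compactTail]
    split_ifs <;> norm_num

theorem compactTail_le_one (v : V) (e : E) (n : ℕ) (y : Compactification G v) :
    compactTail G v e n y ≤ 1 := by
  rcases y with ⟨g, h⟩ | ⟨l, h⟩ | e'
  · exact ENNReal.toReal_le_of_le_ofReal zero_le_one (by simpa using tail_le_one e n g)
  · exact zero_le_one
  · simp only [compactTail]
    split_ifs <;> norm_num

/-- On the compact edge `e` it is `min 1 (t - n)` with `t ∈ [0, ∞]`, continuous also at `∞`; on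
every other edge it vanishes. -/
theorem continuous_compactTail (v : V) (e : E) (n : ℕ) : Continuous (compactTail G v e n) := by
  refine Compactification.continuous_iff_param.2 fun l => ?_
  by_cases hl : l = .inl e
  · subst hl
    have : ∀ t : ℝ≥0∞, compactTail G v e n (Compactification.param G v (.inl e) t) =
        (min 1 (t - n)).toReal := by
      intro t
      simp only [Compactification.param]
      split_ifs with h
      · simp [h, compactTail]
      · rw [compactTail_place, tail, depth_param_self _ (Compactification.toReal_mem_dom e t)]
        simp only [depthParam]
        rw [ENNReal.ofReal_toReal h]
    simp only [this]
    exact ENNReal.continuousOn_toReal.comp_continuous (continuous_tail_aux n)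
      fun t => ((min_le_left _ _).trans_lt ENNReal.one_lt_top).ne
  · have : ∀ t : ℝ≥0∞, compactTail G v e n (Compactification.param G v l t) = 0 := by
      intro t
      rcases l with e' | i
      · simp only [Compactification.param]
        split_ifs with h
        · simp only [compactTail]
          rw [if_neg fun h => hl (congrArg Sum.inl h)]
        · rw [compactTail_place, tail_of_depth_eq_zero (depth_param_of_ne hl _)]
          rfl
      · simp only [Compactification.param]
        rw [compactTail_place, tail_of_depth_eq_zero (depth_param_of_ne hl _)]
        rfl
    simp only [this]
    exact continuous_const

/-- `compactTail` as a bounded continuous function. -/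
def tailBCF (G : MetricGraph V E I) (v : V) (e : E) (n : ℕ) : Compactification G v →ᵇ ℝ :=
  BoundedContinuousFunction.ofNormedAddCommGroup _ (continuous_compactTail v e n) 1 fun y => by
    rw [Real.norm_of_nonneg (compactTail_nonneg v e n y)]
    exact compactTail_le_one v e n y

theorem restrictFun_tailBCF (v : V) (e : E) (n : ℕ) (g : G.Point) :
    restrictFun (tailBCF G v e n) g = (G.tail e n g).toReal := by
  rw [restrictFun]
  split_ifs with h
  · rfl
  · rw [not_not] at h
    rw [h, tail_of_depth_eq_zero (depth_vertex _ v)]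
    rfl

end MetricGraph

/-! ### Limits of the normalized exit measures -/

namespace MetricGraph

open ProcessFamily

variable {V E I Ω : Type*} [MeasurableSpace Ω] {G : MetricGraph V E I}
  {X : ProcessFamily G.Point Ω} {F : Set G.Point}

theorem lintegral_normalizedExit (v : V) (ε : ℝ≥0) {φ : G.Point → ℝ≥0∞} (hφ : Measurable φ) :
    ∫⁻ g, φ g ∂normalizedExit X v ε =
      (normalization X v ε)⁻¹ * ∫⁻ g, G.weight v g * φ g ∂scaledExit X v ε := by
  rw [normalizedExit, lintegral_smul_measure, smul_eq_mul,
    lintegral_withDensity_eq_lintegral_mul _ (measurable_weight v) hφ]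
  rfl

theorem normalizedExit_apply_of_weight_eq_one (v : V) (ε : ℝ≥0) {A : Set G.Point}
    (hA : MeasurableSet A) (h : ∀ g ∈ A, G.weight v g = 1) :
    normalizedExit X v ε A = scaledExit X v ε A / normalization X v ε := by
  rw [normalizedExit, Measure.smul_apply, withDensity_apply _ hA,
    setLIntegral_congr_fun hA h, setLIntegral_one, smul_eq_mul, ENNReal.div_eq_inv_mul]

theorem normalizedExit_le_one (v : V) (ε : ℝ≥0) : normalizedExit X v ε univ ≤ 1 := by
  rw [normalizedExit, Measure.smul_apply, withDensity_apply _ MeasurableSet.univ, setLIntegral_univ,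
    smul_eq_mul, ← ENNReal.div_eq_inv_mul]
  exact ENNReal.div_le_of_le_mul (by rw [one_mul]; exact le_add_self)

instance (v : V) (ε : ℝ≥0) : IsFiniteMeasure (normalizedExit X v ε) :=
  ⟨(normalizedExit_le_one v ε).trans_lt ENNReal.one_lt_top⟩

/-- Integrals of test functions on a clopen set against the normalized exit measure. -/
theorem lintegral_normalizedExit_test (hX : X.IsStrongMarkov) (hF : IsClopen F) {v : V}
    (hv : Point.vertex v ∉ F) (ε : ℝ≥0) {f : G.Point ⊕ Unit → ℝ≥0∞}
    (hf : IsTest (Sum.inl '' F) f) :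
    ∫⁻ g, f (.inl g) ∂normalizedExit X v ε =
      (normalization X v ε)⁻¹ * (meanExitTime X v ε)⁻¹ *
        ∫⁻ ω in {ω | X.hittingTime (farSet (.vertex v) ε) ω ≠ ⊤},
          f (X.stateAt (X.hittingTime (farSet (.vertex v) ε)) ω) ∂X.law (.inl (.vertex v)) := by
  classical
  have hτ := isStop_hittingTime hX (isOpen_farSet (Point.vertex v : G.Point) ε)
  have hDm : MeasurableSet {ω | X.hittingTime (farSet (.vertex v) ε) ω ≠ ⊤} :=
    hτ.measurable (measurableSet_singleton _).compl
  have h0 : f (.inr ()) = 0 := hf.eq_zero _ (by simp)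
  -- The weight is `1` wherever `f` does not vanish, so it disappears from the integral.
  have hw : ∀ g, G.weight v g * f (.inl g) = f (.inl g) := by
    intro g
    by_cases hg : g ∈ F
    · rw [weight_of_mem hF hv hg, one_mul]
    · rw [hf.eq_zero _ (by simpa using hg), mul_zero]
  have hfm : Measurable fun g : G.Point => f (.inl g) :=
    hf.continuous.measurable.comp measurable_inl
  rw [lintegral_normalizedExit v ε hfm]
  simp only [hw]
  rw [lintegral_scaledExit hX v ε hf.continuous.measurable h0, mul_assoc,
    ← lintegral_indicator hDm]
  congr 2
  refine lintegral_congr_ae ?_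
  filter_upwards [hX.normal (.inl (.vertex v))] with ω hω
  rw [exitPosition_eq hω]
  split_ifs with h
  · rw [h0, indicator_of_notMem (by simpa using h)]
  · rw [indicator_of_mem (by simpa using h)]

/-- `tail`, extended by `0` to the cemetery. -/
def tailSum (G : MetricGraph V E I) (e : E) (n : ℕ) : G.Point ⊕ Unit → ℝ≥0∞ :=
  Sum.elim (G.tail e n) fun _ => 0

theorem isTest_tailSum (hF : IsClopen F) {e : E} (he : Point.vertex (G.base e) ∈ F) (n : ℕ) :
    IsTest (Sum.inl '' F) (G.tailSum e n) where
  continuous := (continuous_tail e n).sumElim continuous_const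
  eq_zero := by
    rintro (g | ⟨⟩) hg
    · refine tail_of_depth_eq_zero ?_ n
      rcases (depth_nonneg (.inl e) g).eq_or_lt with h | h
      · exact h.symm
      · obtain ⟨s, hs, rfl⟩ := depth_pos_iff.1 h
        have h0 : G.param (.inl e) 0 ∈ F := by simpa [param] using he
        exact absurd (mem_image_of_mem _ ((param_mem_iff hF (zero_mem_dom _)
          (openDom_subset_dom _ hs)).1 h0)) hg
    · rfl
  le_one := by
    rintro (g | ⟨⟩)
    · exact tail_le_one e n g
    · exact zero_le_one

/-- No mass escapes to infinity along the external edges in an absorbing clopen set. -/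
theorem measure_atInfinity_eq_zero [Finite V] (hX : G.IsBrownianMotion X) (hF : IsClopen F)
    (habs : X.IsAbsorbing F) {v : V} (hv : Point.vertex v ∉ F) {ε : ℕ → ℝ≥0}
    {μ : Measure (Compactification G v)} [IsFiniteMeasure μ]
    (hμ : ∀ f : Compactification G v →ᵇ ℝ,
      Tendsto (fun n => ∫ g, restrictFun f g ∂normalizedExit X v (ε n)) atTop (𝓝 (∫ y, f y ∂μ)))
    {e : E} (he : Point.vertex (G.base e) ∈ F) : μ {.atInfinity e} = 0 := by
  have hM := hX.toIsStrongMarkov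
  obtain ⟨b, hb, hbound⟩ := exists_uniform_bound hX hF habs
    (g := fun n => ⟨G.tailSum e n, isTest_tailSum hF he n⟩) (by
      rintro (g | ⟨⟩)
      · exact tendsto_tail e g
      · exact tendsto_const_nhds) hv
  have h1 : ∀ k n, ∫ g, restrictFun (tailBCF G v e k) g ∂normalizedExit X v (ε n) ≤
      max (b k) 0 := by
    intro k n
    -- All of `F` is infinitely far from `v`, so a visit to `F` is already an exit from the
    -- `ε`-ball.
    have hle : ∀ᵐ ω ∂X.law (.inl (.vertex v)), ∀ t : ℝ≥0,
        (t : ℝ≥0∞) < X.hittingTime (farSet (Point.vertex v) (ε n)) ω →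
          X.path t ω ∉ Sum.inl '' F := by
      refine Eventually.of_forall fun ω t ht => ?_
      rintro ⟨p, hp, hpt⟩
      refine notMem_of_lt_hittingTime ht ?_
      rw [← hpt]
      show (ε n : ℝ≥0∞) < edist p (Point.vertex v)
      rw [edist_eq_top hF hp hv]
      exact ENNReal.coe_lt_top
    -- With the factor `1 / (K_ε E_v(τ_ε))` exit integrals over `F` become integrals against `μ_ε`,
    -- whose mass is at most `1`; this is the bound required of `c`.
    have h2 := hbound _ (isStop_hittingTime hM (isOpen_farSet (Point.vertex v) (ε n))) hle
      ((normalization X v (ε n))⁻¹ * (meanExitTime X v (ε n))⁻¹) (fun f hf => by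
        rw [← lintegral_normalizedExit_test hM hF hv (ε n) hf]
        refine (lintegral_mono fun g => hf.le_one (.inl g)).trans ?_
        rw [lintegral_one]
        exact normalizedExit_le_one v (ε n)) k
    rw [← lintegral_normalizedExit_test hM hF hv (ε n) (isTest_tailSum hF he k)] at h2
    simp only [restrictFun_tailBCF]
    rw [integral_toReal (continuous_tail e k).measurable.aemeasurable
      (Eventually.of_forall fun g => (tail_le_one e k g).trans_lt ENNReal.one_lt_top)]
    refine ENNReal.toReal_le_of_le_ofReal (le_max_right _ _) (h2.trans ?_)
    exact ENNReal.ofReal_le_ofReal (le_max_left _ _)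
  -- The bound on the `k`-th tail is uniform in `n`, so `n → ∞` comes first, for fixed `k`. The tail
  -- function is `1` at the end of `e`, hence its limit integral dominates the mass there; then `k →
  -- ∞`.
  have h2 : ∀ k, μ.real {.atInfinity e} ≤ max (b k) 0 := by
    intro k
    refine le_trans ?_ (le_of_tendsto' (hμ (tailBCF G v e k)) fun n => h1 k n)
    have hint : Integrable (tailBCF G v e k) μ := (tailBCF G v e k).integrable μ
    have hsub : {.atInfinity e} ⊆ {y : Compactification G v | 1 ≤ tailBCF G v e k y} := by
      rintro _ rfl
      show (1 : ℝ) ≤ compactTail G v e k (.atInfinity e)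
      simp [compactTail]
    refine (measureReal_mono hsub).trans ?_
    have := mul_meas_ge_le_integral_of_nonneg (f := fun y => tailBCF G v e k y)
      (Eventually.of_forall (compactTail_nonneg v e k)) hint 1
    rwa [one_mul] at this
  have h3 : Tendsto (fun k => max (b k) 0) atTop (𝓝 0) := by
    simpa using hb.max (tendsto_const_nhds (x := (0 : ℝ)))
  have h4 : μ.real {.atInfinity e} = 0 :=
    le_antisymm (ge_of_tendsto' h3 h2) measureReal_nonneg
  exact (measureReal_eq_zero_iff).1 h4

/-- On `F` the inverse weight is `1`. The two functions differ only at the ends at infinity of edges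
in `F`, which are null by hypothesis. -/
theorem jumpDensity_ae_eq [Finite E] (hF : IsClopen F) {v : {v : V // Point.vertex v ∉ F}}
    {μ : Measure (Compactification G v.1)}
    (hμ : ∀ e : E, Point.vertex (G.base e) ∈ F → μ {.atInfinity e} = 0) :
    jumpDensity F =ᵐ[μ] (range (Compactification.incl (G := G) (v := v)))ᶜ.indicator 1 := by
  have h1 : ∀ᵐ y ∂μ, ∀ e : E, Point.vertex (G.base e) ∈ F → y ≠ .atInfinity e := by
    refine ae_all_iff.2 fun e => ?_
    by_cases he : Point.vertex (G.base e) ∈ F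
    · filter_upwards [compl_mem_ae_iff.2 (hμ e he)] with y hy _ using hy
    · exact Eventually.of_forall fun y h => absurd h he
  filter_upwards [h1] with y hy
  rcases y with ⟨p, hp⟩ | ⟨l, hl⟩ | e
  · by_cases h : p ∈ F
    · rw [indicator_of_mem (mem_compl (mt (Compactification.inner_mem_range_iff hF hp).1
        (not_not.2 h)))]
      simp [jumpDensity, h, weight_of_mem hF v.2 h]
    · rw [indicator_of_notMem (not_not.2 ((Compactification.inner_mem_range_iff hF hp).2 h))]
      simp [jumpDensity, h]
  · rw [indicator_of_notMem (not_not.2 (Compactification.germ_mem_range hF hl))]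
    rfl
  · rw [indicator_of_notMem (not_not.2 (Compactification.atInfinity_mem_range_iff.2
      fun h => hy e h rfl))]
    rfl

theorem restrictFun_one_sub_extend (hF : IsClopen F) {v : {v : V // Point.vertex v ∉ F}}
    (g : G.Point) : restrictFun (v := v.1) (fun y => 1 - Compactification.extend (v := v) hF 1 y) g
      = F.indicator (1 : G.Point → ℝ) g := by
  by_cases hv : g = .vertex v.1
  · rw [restrictFun, dif_neg (not_not.2 hv), indicator_of_notMem (hv ▸ v.2)]
  · rw [restrictFun, dif_pos hv]
    by_cases hg : g ∈ F
    · rw [indicator_of_mem hg, Compactification.extend_of_notMem hF _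
        (mt (Compactification.inner_mem_range_iff hF hv).1 (not_not.2 hg))]
      simp
    · obtain ⟨y, hy⟩ := (Compactification.inner_mem_range_iff hF hv).2 hg
      rw [indicator_of_notMem hg, ← hy, Compactification.extend_incl]
      simp

/-- The normalized exit measures of `F` converge to the jump mass of `F`. -/
theorem tendsto_normalizedExit_apply [Finite E] (hF : IsClopen F)
    {v : {v : V // Point.vertex v ∉ F}} {ε : ℕ → ℝ≥0}
    {μ : Measure (Compactification G v.1)} [IsFiniteMeasure μ]
    (hμ : ∀ f : Compactification G v.1 →ᵇ ℝ,
      Tendsto (fun n => ∫ g, restrictFun f g ∂normalizedExit X v.1 (ε n)) atTop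
        (𝓝 (∫ y, f y ∂μ)))
    (hinf : ∀ e : E, Point.vertex (G.base e) ∈ F → μ {.atInfinity e} = 0) :
    Tendsto (fun n => normalizedExit X v.1 (ε n) F) atTop (𝓝 (∫⁻ y, jumpDensity F y ∂μ)) := by
  have hR : MeasurableSet (range (Compactification.incl (G := G) (v := v))) :=
    (Compactification.measurableEmbedding_incl hF).measurableSet_range
  rw [lintegral_congr_ae (jumpDensity_ae_eq hF hinf), lintegral_indicator_one hR.compl]
  -- The range is clopen, so the indicator of its complement is an admissible test function; on the
  -- graph itself it is the indicator of `F`.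
  have h1 := hμ (1 - Compactification.extend (v := v) hF 1)
  have h2 : ∀ n, ∫ g, restrictFun (⇑(1 - Compactification.extend (v := v) hF 1)) g
      ∂normalizedExit X v.1 (ε n) = (normalizedExit X v.1 (ε n)).real F := by
    intro n
    rw [← integral_indicator_one hF.isOpen.measurableSet]
    congr 1
    ext g
    exact restrictFun_one_sub_extend hF g
  have h3 : ∫ y, (1 - Compactification.extend (v := v) hF 1) y ∂μ =
      μ.real (range (Compactification.incl (G := G) (v := v)))ᶜ := by
    rw [← integral_indicator_one hR.compl]
    congr 1
    ext y
    by_cases hy : y ∈ range (Compactification.incl (G := G) (v := v))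
    · rw [indicator_of_notMem (not_not.2 hy)]
      obtain ⟨y, rfl⟩ := hy
      simp [Compactification.extend_incl]
    · rw [indicator_of_mem (mem_compl hy)]
      simp [Compactification.extend_of_notMem hF _ hy]
  simp only [h2, h3] at h1
  have h4 := ENNReal.tendsto_ofReal h1
  simpa using h4

theorem restrictFun_incl (hF : IsClopen F) {v : {v : V // Point.vertex v ∉ F}}
    (f : Compactification (G.delete F) v →ᵇ ℝ) (g : (G.delete F).Point) :
    restrictFun (Compactification.extend hF f) (G.incl F g) = restrictFun f g := by
  by_cases h : g = .vertex v
  · subst h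
    have h₁ : ¬ G.incl F (.vertex v) ≠ Point.vertex v.1 := not_not.2 rfl
    have h₂ : ¬ (Point.vertex v : (G.delete F).Point) ≠ .vertex v := not_not.2 rfl
    rw [restrictFun, dif_neg h₁, restrictFun, dif_neg h₂]
  · have h' : G.incl F g ≠ .vertex v.1 := fun e => h (G.incl_injective F (a₂ := .vertex v) e)
    rw [restrictFun, dif_pos h', restrictFun, dif_pos h]
    exact Compactification.extend_incl hF f (.inner g h)

theorem restrictFun_extend_of_mem (hF : IsClopen F) {v : {v : V // Point.vertex v ∉ F}}
    (f : Compactification (G.delete F) v →ᵇ ℝ) {p : G.Point} (hp : p ∈ F) :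
    restrictFun (Compactification.extend hF f) p = 0 := by
  rw [restrictFun]
  split_ifs with h
  · exact Compactification.extend_of_notMem hF f
      (mt (Compactification.inner_mem_range_iff hF h).1 (not_not.2 hp))
  · rfl

/-- Weak convergence for the killed process thereby becomes weak convergence for `X`, tested on
functions extended by `0`. -/
theorem integral_restrictFun_killedProcess (hX : X.IsStrongMarkov)
    (hY : (killedProcess X F).IsStrongMarkov) (hF : IsClopen F)
    (v : {v : V // Point.vertex v ∉ F}) (ε : ℝ≥0) (f : Compactification (G.delete F) v →ᵇ ℝ) :
    ∫ g, restrictFun f g ∂normalizedExit (killedProcess X F) v ε =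
      ∫ p, restrictFun (Compactification.extend hF f) p ∂normalizedExit X v.1 ε := by
  rw [normalizedExit_killedProcess hX hY hF]
  simp only [← restrictFun_incl hF f]
  rw [← (measurableEmbedding_incl hF).integral_map, (measurableEmbedding_incl hF).map_comap,
    range_incl G hF]
  exact setIntegral_eq_integral_of_forall_compl_eq_zero fun p hp =>
    restrictFun_extend_of_mem hF f (not_not.1 hp)

theorem integral_comap_incl (hF : IsClopen F) {v : {v : V // Point.vertex v ∉ F}}
    (μ : Measure (Compactification G v.1)) (f : Compactification (G.delete F) v →ᵇ ℝ) :
    ∫ y, f y ∂μ.comap Compactification.incl = ∫ y, Compactification.extend hF f y ∂μ := by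
  simp only [← Compactification.extend_incl hF f]
  rw [← (Compactification.measurableEmbedding_incl hF).integral_map,
    (Compactification.measurableEmbedding_incl hF).map_comap]
  exact setIntegral_eq_integral_of_forall_compl_eq_zero fun p hp =>
    Compactification.extend_of_notMem hF f hp

theorem jumpDensity_incl (hF : IsClopen F) {v : {v : V // Point.vertex v ∉ F}}
    (A : Set (G.delete F).Point) (y : Compactification (G.delete F) v) :
    jumpDensity (G.incl F '' A) (Compactification.incl y) = jumpDensity A y := by
  rcases y with ⟨g, h⟩ | ⟨l, h⟩ | e
  · have h' : G.incl F g ∈ G.incl F '' A ↔ g ∈ A := (G.incl_injective F).mem_set_image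
    by_cases hg : g ∈ A <;>
      simp [Compactification.incl, jumpDensity, weight_incl hF, h', hg]
  · rfl
  · rfl

theorem lintegral_jumpDensity_incl (hF : IsClopen F) {v : {v : V // Point.vertex v ∉ F}}
    (μ : Measure (Compactification G v.1)) (A : Set (G.delete F).Point) :
    ∫⁻ y, jumpDensity (G.incl F '' A) y ∂μ =
      ∫⁻ y, jumpDensity A y ∂μ.comap (Compactification.incl (v := v)) := by
  simp only [← jumpDensity_incl hF A]
  rw [← (Compactification.measurableEmbedding_incl hF).lintegral_map,
    (Compactification.measurableEmbedding_incl hF).map_comap]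
  refine (setLIntegral_eq_of_support_subset fun y hy => ?_).symm
  rcases y with ⟨p, h⟩ | ⟨l, h⟩ | e
  · refine (Compactification.inner_mem_range_iff hF h).2 fun hp => hy ?_
    simp only [jumpDensity]
    rw [if_neg]
    rintro ⟨g, -, rfl⟩
    exact incl_notMem hF g hp
  · exact absurd rfl hy
  · exact absurd rfl hy

end MetricGraph

end

/-! ### The data of the killed process -/

theorem mainTheorem6 {V E I Ω : Type*} [Finite V] [Finite E] [Finite I] [MeasurableSpace Ω]
    (G : MetricGraph V E I) (X : ProcessFamily G.Point Ω) (hX : G.IsBrownianMotion X)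
    (ε : V → ℕ → ℝ≥0) (c : G.FellerWentzellData)
    (hc : MetricGraph.HasFellerWentzellData X ε c)
    (F : Set G.Point) (hF : F ≠ Set.univ) (hiso : IsClopen F) (habs : X.IsAbsorbing F)
    (hY : (G.delete F).IsBrownianMotion (MetricGraph.killedProcess X F)) :
    MetricGraph.HasFellerWentzellData (MetricGraph.killedProcess X F) (fun v => ε v.1)
      (c.killed F) := by
  intro v
  obtain ⟨hε, hε0, hkill, hdiff, μ, hfin, hμ, hinf, hrefl, hjump⟩ := hc v.1
  have hM := hX.toIsStrongMarkov
  have hM' := hY.toIsStrongMarkov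
  have hnull : ∀ e : E, MetricGraph.Point.vertex (G.base e) ∈ F → μ {.atInfinity e} = 0 :=
    fun e he => MetricGraph.measure_atInfinity_eq_zero hX hiso habs v.2 hμ he
  have hemb := MetricGraph.Compactification.measurableEmbedding_incl (G := G) (v := v) hiso
  refine ⟨hε, hε0, ?_, ?_, μ.comap MetricGraph.Compactification.incl, ?_, ?_, ?_, ?_, ?_⟩
  -- The new kill rate divided by `K_ε` is the old quotient plus `ν_ε(F) / K_ε`, and the latter
  -- equals `μ_ε(F)` because the weight is `1` on `F`.
  · have h1 := hkill.add (MetricGraph.tendsto_normalizedExit_apply hiso hμ hnull)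
    rw [← hjump F hiso.isOpen.measurableSet] at h1
    refine h1.congr fun n => ?_
    rw [MetricGraph.killRate_killedProcess hM hiso,
      MetricGraph.normalization_killedProcess hM hM' hiso, ENNReal.add_div,
      MetricGraph.normalizedExit_apply_of_weight_eq_one _ _ hiso.isOpen.measurableSet
        fun g hg => MetricGraph.weight_of_mem hiso v.2 hg]
  · simp only [MetricGraph.normalization_killedProcess hM hM' hiso]
    exact hdiff
  · refine ⟨?_⟩
    rw [hemb.comap_apply]
    exact measure_lt_top μ _
  · intro f
    simp only [MetricGraph.integral_restrictFun_killedProcess hM hM' hiso,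
      MetricGraph.integral_comap_incl hiso]
    exact hμ _
  · refine hinf.trans ?_
    -- External edges in `F` drop out of the sum, as their ends at infinity carry no mass.
    rw [← tsum_subtype_eq_of_support_subset
      (s := {e : E | MetricGraph.Point.vertex (G.base e) ∉ F}) fun e he h => he (hnull e h)]
    refine tsum_congr fun e => ?_
    rw [hemb.comap_apply, image_singleton]
    rfl
  · intro l
    rw [hemb.comap_apply, image_singleton]
    exact hrefl _
  · intro A hA
    rw [← MetricGraph.lintegral_jumpDensity_incl hiso]
    have hincl := MetricGraph.measurableEmbedding_incl (G := G) hiso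
    exact (hincl.comap_apply _ _).trans (hjump _ (hincl.measurableSet_image.2 hA))
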